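/- **Setting.** QCD has three kinds of lines, quark $e_1$, ghost $e_2$, gluon $e_3$, and five vertices $v_1,\dots,v_5$ with the following attached lines: $v_1$: two quark, one gluon; $v_2$: two ghost, one gluon; $v_3$: three gluon; $v_4$: four gluon; $v_5$ (mass vertex): two quark. Let $N_i(v)$ be the number of lines of kind $e_i$ at $v$ and $N(v)=\sum_i N_i(v)$. A Feynman graph is a finite graph built from these vertices by gluing pairs of half-lines of the same kind; half-lines that are not glued are its external lines. It is 1PI if it is connected, not a tree, and not disconnected by cutting a single internal edge. A graph has residue $r\in R=\{e_1,e_2,e_3,v_1,\dots,v_5\}$ if its external lines are those of $r$ (an edge $e_i$ has two ends of kind $e_i$); a graph with two external quark lines may be dressed with either residue, $e_1$ or $v_5$ (in the latter case it is written $\Gamma_\bullet$), and the two dressed graphs are distinct. Let $H_{CK}$ be the free commutative $\mathbb C$-algebra on the isomorphism classes of 1PI graphs dressed with a residue in $R$, with counit $\epsilon(\Gamma)=0$ and coproduct $$\Delta(\Gamma)=\Gamma\otimes 1+1\otimes\Gamma+\sum_{\emptyset\ne\gamma\subsetneq\Gamma}\gamma\otimes\Gamma/\gamma ,$$ the sum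 being over disjoint unions $\gamma$ of 1PI subgraphs dressed with residues in $R$, and $\Gamma/\gamma$ being obtained by contracting each component of $\gamma$ to its residue. It is graded by the loop number $L$ and by the degrees $d_j(\Gamma)=\#\{\text{vertices }v_j\text{ in }\Gamma\}-\delta_{v_j,\mathrm{res}(\Gamma)}\in\mathbb Z$, $j=1,\dots,5$, extended additively to products of graphs. On formal (infinite) linear combinations of monomials in the graphs, let $p_n$ ($n\in\mathbb Z^5$) be the projection to the part of multidegree $n$, and let $q_{l,s}$ ($l\ge 0$, $s\in\mathbb Z$) be the projection to the part of loop order $l$ and mass-vertex degree $d_5=s$. Thus the loop-order-$l$ component is the formal sum $q_l=\sum_s q_{l,s}$, which is in general infinite because a graph of given loop order can contain any number of mass vertices. The Green's functions are $$G^{e_i}=1-\sum_{\mathrm{res}(\Gamma)=e_i}\frac{\Gamma}{\mathrm{Sym}(\Gamma)},\qquad G^{v_j}=1+\sum_{\mathrm{res}(\Gamma)=v_j}\frac{\Gamma}{\mathrm{Sym}(\Gamma)},$$ where the sums run over graphs with distinguished external lines (the labels are then forgotten) and $\mathrm{Sym}(\Gamma)$ is the number of automorphisms fixing the external lines. Put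 $$Y_{v_j}=G^{v_j}\prod_{i=1}^{3}\bigl(G^{e_i}\bigr)^{-N_i(v_j)/2},$$ with powers defined by the binomial series. Let $H\subset H_{CK}$ be the subalgebra generated by all $p_n(G^{r})$, $r\in R$, $n\in\mathbb Z^5$. **Statement.** 1. All $p_n(G^r)$ are elements of $H_{CK}$ (finite sums), and for all $j,k\in\{1,2,3,4\}$, $l\ge0$, $s\in\mathbb Z$ the components $q_{l,s}\bigl(Y_{v_k}^{N(v_j)-2}\bigr)$ are elements of $H$. The coproduct $\Delta$ restricts to an algebra map $H\to H\otimes H$. 2. Let $J$ be the ideal of $H$ generated by the homogeneous components $$q_{l,s}\bigl(Y_{v_k}^{N(v_j)-2}-Y_{v_j}^{N(v_k)-2}\bigr),\qquad j,k=1,\dots,4,\ l\ge 0,\ s\in\mathbb Z .$$ Then $J$ is a Hopf ideal: $$\Delta(J)\subset J\otimes H+H\otimes J,\qquad \epsilon(J)=0 .$$ 3. In the quotient $H/J$ the Slavnov–Taylor identities for the couplings hold: for all $j,k\in\{1,\dots,4\}$, $l\ge 0$, $s\in\mathbb Z$, the elements $q_{l,s}\bigl(Y_{v_k}^{N(v_j)-2}\bigr)$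 and $q_{l,s}\bigl(Y_{v_j}^{N(v_k)-2}\bigr)$ of $H$ have the same class in $H/J$. -/

import Mathlib

open scoped TensorProduct

namespace QCD

/-! ### Lines, vertices, residues -/

/-- The three kinds of lines (edges) of QCD: straight `e₁`, dotted `e₂`, curly `e₃`. -/
inductive Line
  | quark
  | ghost
  | gluon
  deriving DecidableEq

instance : Fintype Line := ⟨{.quark, .ghost, .gluon}, by intro x; cases x <;> simp⟩

/-- The five vertices `v₁, …, v₅` of QCD; `mass` is the two-valent vertex `v₅`. -/
inductive Vertex
  | quarkGluon
  | ghostGluon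
  | gluon3
  | gluon4
  | mass
  deriving DecidableEq

instance : Fintype Vertex :=
  ⟨{.quarkGluon, .ghostGluon, .gluon3, .gluon4, .mass}, by intro x; cases x <;> simp⟩

/-- `v.legs i` is the number `N_i(v)` of lines of kind `i` attached to the vertex `v`. -/
def Vertex.legs : Vertex → Line → ℕ
  | .quarkGluon, .quark => 2
  | .quarkGluon, .ghost => 0
  | .quarkGluon, .gluon => 1
  | .ghostGluon, .quark => 0
  | .ghostGluon, .ghost => 2
  | .ghostGluon, .gluon => 1
  | .gluon3, .quark => 0
  | .gluon3, .ghost => 0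
  | .gluon3, .gluon => 3
  | .gluon4, .quark => 0
  | .gluon4, .ghost => 0
  | .gluon4, .gluon => 4
  | .mass, .quark => 2
  | .mass, .ghost => 0
  | .mass, .gluon => 0

/-- The valence `N(v)`. -/
def Vertex.valence (v : Vertex) : ℕ := ∑ i, v.legs i

/-- The set `R = R_V ∪ R_E` of possible residues. -/
inductive Res
  | vertex (v : Vertex)
  | edge (e : Line)
  deriving DecidableEq

/-- The number of lines of kind `i` attached to `r`; an edge has two ends. -/
def Res.legs : Res → Line → ℕ
  | .vertex v, i => v.legs i
  | .edge e, i => if i = e then 2 else 0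

/-- `r` is one of the five vertices. -/
def Res.IsVertex : Res → Prop
  | .vertex _ => True
  | .edge _ => False

/-- The vertex that `r` is. -/
def Res.toVertex : (r : Res) → r.IsVertex → Vertex
  | .vertex v, _ => v
  | .edge _, h => h.elim

/-- The sign of the graphs in the Green's function: `+` for vertices, `-` for edges. -/
def Res.sign : Res → ℂ
  | .vertex _ => 1
  | .edge _ => -1

/-! ### Feynman graphs -/

/-- A QCD Feynman graph: finite sets `V` of vertices and `D` of half-lines. Each half-line has a
kind and a vertex at which it is rooted, and the half-lines at a vertex are those prescribed by the
type of the vertex. The involution `link` glues half-lines of the same kind: its orbits with two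
elements are the internal edges, its fixed points are the external lines. -/
structure FGraph where
  V : Type
  D : Type
  finV : Finite V
  finD : Finite D
  vert : V → Vertex
  line : D → Line
  root : D → V
  legs_eq : ∀ v i, Nat.card {h : D // root h = v ∧ line h = i} = (vert v).legs i
  link : D → D
  link_link : ∀ h, link (link h) = h
  line_link : ∀ h, line (link h) = line h

namespace FGraph

attribute [instance] FGraph.finV FGraph.finD

/-- Isomorphisms of Feynman graphs; they may permute the external lines. -/
structure Iso (Γ Γ' : FGraph) where
  onV : Γ.V ≃ Γ'.V
  onD : Γ.D ≃ Γ'.D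
  vert_eq : ∀ v, Γ'.vert (onV v) = Γ.vert v
  line_eq : ∀ h, Γ'.line (onD h) = Γ.line h
  root_eq : ∀ h, Γ'.root (onD h) = onV (Γ.root h)
  link_eq : ∀ h, Γ'.link (onD h) = onD (Γ.link h)

/-- The identity. -/
def Iso.refl (Γ : FGraph) : Iso Γ Γ :=
  ⟨Equiv.refl _, Equiv.refl _, fun _ => rfl, fun _ => rfl, fun _ => rfl, fun _ => rfl⟩

/-- The inverse isomorphism. -/
def Iso.symm {Γ Γ' : FGraph} (φ : Iso Γ Γ') : Iso Γ' Γ where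
  onV := φ.onV.symm
  onD := φ.onD.symm
  vert_eq v := by simpa using (φ.vert_eq (φ.onV.symm v)).symm
  line_eq h := by simpa using (φ.line_eq (φ.onD.symm h)).symm
  root_eq h := by
    rw [Equiv.eq_symm_apply, ← φ.root_eq, Equiv.apply_symm_apply]
  link_eq h := by
    rw [Equiv.eq_symm_apply, ← φ.link_eq, Equiv.apply_symm_apply]

/-- Composition of isomorphisms. -/
def Iso.trans {Γ Γ' Γ'' : FGraph} (φ : Iso Γ Γ') (ψ : Iso Γ' Γ'') : Iso Γ Γ'' where
  onV := φ.onV.trans ψ.onV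
  onD := φ.onD.trans ψ.onD
  vert_eq v := by simp [φ.vert_eq, ψ.vert_eq]
  line_eq h := by simp [φ.line_eq, ψ.line_eq]
  root_eq h := by simp [φ.root_eq, ψ.root_eq]
  link_eq h := by simp [φ.link_eq, ψ.link_eq]

/-- `v` and `w` are joined by a path of edges whose half-lines lie in `S`. -/
def Reach (Γ : FGraph) (S : Set Γ.D) : Γ.V → Γ.V → Prop :=
  Relation.EqvGen fun v w => ∃ h ∈ S, Γ.root h = v ∧ Γ.root (Γ.link h) = w

/-- The number of internal edges; each consists of two half-lines. -/
noncomputable def numEdges (Γ : FGraph) : ℕ := Nat.card {h : Γ.D // Γ.link h ≠ h} / 2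

/-- The loop number `L = I - V + 1` of a connected graph. -/
noncomputable def loops (Γ : FGraph) : ℤ := (Γ.numEdges : ℤ) - Nat.card Γ.V + 1

/-- Non-empty and connected. -/
def Connected (Γ : FGraph) : Prop := Nonempty Γ.V ∧ ∀ v w, Γ.Reach Set.univ v w

/-- One-particle irreducible: connected, not a tree, and not disconnected by cutting one internal
edge. -/
def IsOnePI (Γ : FGraph) : Prop :=
  Γ.Connected ∧ Γ.loops ≠ 0 ∧ ∀ h, Γ.link h ≠ h → ∀ v w, Γ.Reach {h, Γ.link h}ᶜ v w

/-- The external lines of `Γ` are those of `r`. A graph with two external quark lines satisfies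
this both for the quark edge and for the mass vertex. -/
def HasRes (Γ : FGraph) (r : Res) : Prop :=
  ∀ i, Nat.card {h : Γ.D // Γ.link h = h ∧ Γ.line h = i} = r.legs i

/-! ### Connected components and subgraphs -/

/-- The equivalence relation of lying in the same connected component. -/
def compSetoid (Γ : FGraph) : Setoid Γ.V where
  r := Γ.Reach Set.univ
  iseqv := Relation.EqvGen.is_equivalence _

/-- The set of connected components. -/
def Comp (Γ : FGraph) : Type := Quotient Γ.compSetoid

instance (Γ : FGraph) : Finite Γ.Comp := inferInstanceAs (Finite (Quotient Γ.compSetoid))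

/-- The component containing the vertex `v`. -/
def comp (Γ : FGraph) (v : Γ.V) : Γ.Comp := Quotient.mk Γ.compSetoid v

theorem comp_root_link (Γ : FGraph) (h : Γ.D) :
    Γ.comp (Γ.root (Γ.link h)) = Γ.comp (Γ.root h) :=
  (Quotient.sound (s := Γ.compSetoid)
    (Relation.EqvGen.rel _ _ ⟨h, Set.mem_univ _, rfl, rfl⟩)).symm

/-- A connected component, as a Feynman graph. -/
def component (Γ : FGraph) (c : Γ.Comp) : FGraph where
  V := {v : Γ.V // Γ.comp v = c}
  D := {h : Γ.D // Γ.comp (Γ.root h) = c}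
  finV := inferInstance
  finD := inferInstance
  vert v := Γ.vert v.1
  line h := Γ.line h.1
  root h := ⟨Γ.root h.1, h.2⟩
  legs_eq v i := by
    rw [← Γ.legs_eq v.1 i]
    refine Nat.card_congr ⟨fun h => ⟨h.1.1, congrArg Subtype.val h.2.1, h.2.2⟩,
      fun h => ⟨⟨h.1, by rw [h.2.1]; exact v.2⟩, Subtype.ext h.2.1, h.2.2⟩,
      fun _ => rfl, fun _ => rfl⟩
  link h := ⟨Γ.link h.1, by rw [Γ.comp_root_link]; exact h.2⟩
  link_link h := Subtype.ext (Γ.link_link h.1)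
  line_link h := Γ.line_link h.1

/-- A set of internal edges, given as the set of its half-lines. -/
structure EdgeSet (Γ : FGraph) where
  carrier : Set Γ.D
  link_mem : ∀ h ∈ carrier, Γ.link h ∈ carrier
  internal : ∀ h ∈ carrier, Γ.link h ≠ h

/-- Keep the edges in `S` and cut all other internal edges into pairs of external lines. -/
noncomputable def cut (Γ : FGraph) (S : Γ.EdgeSet) : FGraph where
  V := Γ.V
  D := Γ.D
  finV := Γ.finV
  finD := Γ.finD
  vert := Γ.vert
  line := Γ.line
  root := Γ.root
  legs_eq := Γ.legs_eq
  link := by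
    classical
    exact fun h => if h ∈ S.carrier then Γ.link h else h
  link_link h := by
    by_cases hS : h ∈ S.carrier
    · simp [hS, S.link_mem h hS, Γ.link_link]
    · simp [hS]
  line_link h := by
    by_cases hS : h ∈ S.carrier
    · simp [hS, Γ.line_link]
    · simp [hS]

theorem cut_link_eq_self_iff (Γ : FGraph) (S : Γ.EdgeSet) (h : Γ.D) :
    (Γ.cut S).link h = h ↔ h ∉ S.carrier := by
  by_cases hS : h ∈ S.carrier
  · simp [cut, hS, S.internal h hS]
  · simp [cut, hS]

/-- A disjoint union `γ` of 1PI subgraphs of `Γ` with residues in `R`, together with the choice of a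
residue for each of them (two choices for a subgraph with two external quark lines).
`γ` is given by the set `edges` of its internal edges. The components of `Γ.cut edges` are the
connected components of `γ` together with the remaining single vertices of `Γ`; the latter keep
their type. All half-lines at the vertices of `γ` that are not in its internal edges are external
lines of `γ`. -/
structure Contraction (Γ : FGraph) where
  edges : Γ.EdgeSet
  res : (Γ.cut edges).Comp → Res
  hasRes : ∀ c, ((Γ.cut edges).component c).HasRes (res c)
  onePI : ∀ h ∈ edges.carrier,
    ((Γ.cut edges).component ((Γ.cut edges).comp (Γ.root h))).IsOnePI
  res_single : ∀ v, (∀ h ∈ edges.carrier, Γ.root h ≠ v) →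
    res ((Γ.cut edges).comp v) = .vertex (Γ.vert v)

end FGraph

/-! ### Following a chain of half-lines -/

/-- For two involutions `α`, `β`: apply `α`, then alternately `β` and `α`, until an application
of `α` leads to an element satisfying `P`. -/
noncomputable def fold {T : Type} (α β : T → T) (P : T → Prop) (x : T) : T :=
  α ((β ∘ α)^[sInf {k | P (α ((β ∘ α)^[k] x))}] x)

theorem fold_mem {T : Type} [Finite T] {α β : T → T} {P : T → Prop} {x : T}
    (hα : ∀ x, α (α x) = x) (hβ : ∀ x, β (β x) = x) (hP : ∀ x, P x → β x = x) (hx : P x) :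
    P (fold α β P x) := by
  have hinj : Function.Injective (β ∘ α) :=
    (Function.LeftInverse.injective hβ).comp (Function.LeftInverse.injective hα)
  obtain ⟨n, hn, hper⟩ := hinj.mem_periodicPts x
  have hne : {k | P (α ((β ∘ α)^[k] x))}.Nonempty := by
    refine ⟨n - 1, ?_⟩
    have h1 : β (α ((β ∘ α)^[n - 1] x)) = x := by
      have h2 : (β ∘ α)^[n - 1 + 1] x = x := by
        rw [Nat.sub_add_cancel hn]; exact hper
      rw [Function.iterate_succ_apply'] at h2
      exact h2
    have h3 : α ((β ∘ α)^[n - 1] x) = x := by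
      rw [← hβ (α ((β ∘ α)^[n - 1] x)), h1, hP x hx]
    show P _
    rw [h3]; exact hx
  exact Nat.sInf_mem hne

theorem iterate_back {T : Type} {α β : T → T}
    (hα : ∀ x, α (α x) = x) (hβ : ∀ x, β (β x) = x) (x : T) (j i : ℕ) :
    (β ∘ α)^[j] (α ((β ∘ α)^[j + i] x)) = α ((β ∘ α)^[i] x) := by
  induction j with
  | zero => simp
  | succ j ih =>
    rw [Function.iterate_succ_apply, ← ih]
    congr 1
    have : j + 1 + i = (j + i) + 1 := by omega
    rw [this, Function.iterate_succ_apply']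
    simp [hα, hβ]

theorem fold_fold {T : Type} [Finite T] {α β : T → T} {P : T → Prop} {x : T}
    (hα : ∀ x, α (α x) = x) (hβ : ∀ x, β (β x) = x) (hP : ∀ x, P x → β x = x) (hx : P x) :
    fold α β P (fold α β P x) = x := by
  set k := sInf {k | P (α ((β ∘ α)^[k] x))} with hk
  have hy : fold α β P x = α ((β ∘ α)^[k] x) := rfl
  have hPy : P (fold α β P x) := fold_mem hα hβ hP hx
  set y := fold α β P x with hydef
  have key : sInf {j | P (α ((β ∘ α)^[j] y))} = k := by
    apply le_antisymm
    · apply Nat.sInf_le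
      show P _
      have := iterate_back hα hβ x k 0
      rw [hy]
      simp only [add_zero] at this
      rw [this]
      simpa [hα] using hx
    · refine le_csInf ⟨k, ?_⟩ ?_
      · show P _
        have := iterate_back hα hβ x k 0
        rw [hy]
        simp only [add_zero] at this
        rw [this]
        simpa [hα] using hx
      · intro j hj
        by_contra hlt
        push Not at hlt
        obtain ⟨i, hi⟩ : ∃ i, k = j + (i + 1) := ⟨k - j - 1, by omega⟩
        have h1 : P (α ((β ∘ α)^[j] y)) := hj
        rw [hy, hi] at h1
        rw [show α ((β ∘ α)^[j] (α ((β ∘ α)^[j + (i + 1)] x))) = (β ∘ α)^[i + 1] x by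
          rw [iterate_back hα hβ x j (i + 1), hα]] at h1
        have h2 := hP _ h1
        rw [Function.iterate_succ_apply'] at h1 h2
        simp only [Function.comp_apply, hβ] at h1 h2
        rw [← h2] at h1
        have : k ≤ i := Nat.sInf_le h1
        omega
  show α ((β ∘ α)^[sInf {j | P (α ((β ∘ α)^[j] y))}] y) = x
  rw [key, hy]
  have := iterate_back hα hβ x k 0
  simp only [add_zero] at this
  rw [this]
  simp [hα]

theorem apply_fold {T X : Type} {α β : T → T} {P : T → Prop} {f : T → X}
    (hα : ∀ x, f (α x) = f x) (hβ : ∀ x, f (β x) = f x) (x : T) : f (fold α β P x) = f x := by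
  have h : ∀ k, f ((β ∘ α)^[k] x) = f x := by
    intro k
    induction k with
    | zero => rfl
    | succ k ih => rw [Function.iterate_succ_apply', Function.comp_apply, hβ, hα, ih]
  rw [fold, hα, h]

namespace FGraph.Contraction

variable {Γ : FGraph} (κ : Γ.Contraction)

/-- The component of `Γ.cut κ.edges` at which the half-line `h` is rooted. -/
noncomputable def compOf (h : Γ.D) : (Γ.cut κ.edges).Comp := (Γ.cut κ.edges).comp (Γ.root h)

/-- `h` lies outside the edges of the subgraph and is rooted in a component that is contracted to a
vertex: these half-lines survive in the quotient. -/
def Survives (h : Γ.D) : Prop := h ∉ κ.edges.carrier ∧ (κ.res (κ.compOf h)).IsVertex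

theorem line_eq_of_edge {e : Line} {h : Γ.D} (hS : h ∉ κ.edges.carrier)
    (he : κ.res (κ.compOf h) = .edge e) : Γ.line h = e := by
  by_contra hne
  have h1 := κ.hasRes (κ.compOf h) (Γ.line h)
  rw [he, Res.legs, if_neg hne, Finite.card_eq_zero_iff] at h1
  exact h1.elim ⟨⟨h, rfl⟩, Subtype.ext ((Γ.cut_link_eq_self_iff κ.edges h).2 hS), rfl⟩

theorem third_leg {e : Line} {a b c : Γ.D} (ha : a ∉ κ.edges.carrier)
    (hb : b ∉ κ.edges.carrier) (hc : c ∉ κ.edges.carrier)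
    (he : κ.res (κ.compOf a) = .edge e) (hba : κ.compOf b = κ.compOf a)
    (hca : κ.compOf c = κ.compOf a) (hab : b ≠ a) (hac : c ≠ a) : b = c := by
  have h1 := κ.hasRes (κ.compOf a) e
  rw [he, Res.legs, if_pos rfl, Nat.card_eq_two_iff] at h1
  obtain ⟨x, y, hxy, huniv⟩ := h1
  have key : ∀ d : Γ.D, d ∉ κ.edges.carrier → κ.compOf d = κ.compOf a →
      d = x.1.1 ∨ d = y.1.1 := by
    intro d hd hda
    have hm : (⟨⟨d, hda⟩, Subtype.ext ((Γ.cut_link_eq_self_iff κ.edges d).2 hd),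
      κ.line_eq_of_edge hd (by rw [hda, he])⟩ :
      {h : ((Γ.cut κ.edges).component (κ.compOf a)).D //
        ((Γ.cut κ.edges).component (κ.compOf a)).link h = h ∧
        ((Γ.cut κ.edges).component (κ.compOf a)).line h = e}) ∈
        (Set.univ : Set _) := Set.mem_univ _
    rw [← huniv] at hm
    rcases hm with hm | hm
    · left; exact congrArg (fun z => z.1.1) hm
    · right; exact congrArg (fun z => z.1.1) hm
  have h1 := key a ha rfl
  have h2 := key b hb hba
  have h3 := key c hc hca
  clear key he huniv
  generalize x.1.1 = p at *
  generalize y.1.1 = q at *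
  grind

/-- For an external line of a component of `γ` that is contracted to an edge: the other external
line of that component. All other half-lines are fixed. -/
noncomputable def mate (h : Γ.D) : Γ.D := by
  classical
  exact if H : (h ∉ κ.edges.carrier ∧ ∃ e, κ.res (κ.compOf h) = .edge e) ∧
      ∃ h', h' ≠ h ∧ h' ∉ κ.edges.carrier ∧ κ.compOf h' = κ.compOf h
    then H.2.choose else h

theorem mate_mate (h : Γ.D) : κ.mate (κ.mate h) = h := by
  by_cases H : (h ∉ κ.edges.carrier ∧ ∃ e, κ.res (κ.compOf h) = .edge e) ∧
      ∃ h', h' ≠ h ∧ h' ∉ κ.edges.carrier ∧ κ.compOf h' = κ.compOf h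
  · have h1 : κ.mate h = H.2.choose := by simp only [mate]; rw [dif_pos H]
    have hsp := H.2.choose_spec
    rw [h1]
    generalize H.2.choose = h' at hsp
    obtain ⟨hne, hS, hc⟩ := hsp
    obtain ⟨⟨hS0, e, he⟩, -⟩ := H
    have H' : (h' ∉ κ.edges.carrier ∧ ∃ e, κ.res (κ.compOf h') = .edge e) ∧
      ∃ h'', h'' ≠ h' ∧ h'' ∉ κ.edges.carrier ∧ κ.compOf h'' = κ.compOf h' :=
      ⟨⟨hS, e, by rw [hc, he]⟩, h, hne.symm, hS0, hc.symm⟩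
    have h2 : κ.mate h' = H'.2.choose := by simp only [mate]; rw [dif_pos H']
    obtain ⟨hne', hS', hc'⟩ := H'.2.choose_spec
    rw [h2]
    exact κ.third_leg hS hS' hS0 (by rw [hc, he]) hc' hc.symm hne' hne.symm
  · have h1 : κ.mate h = h := by simp only [mate]; rw [dif_neg H]
    rw [h1, h1]

theorem mate_of_survives {h : Γ.D} (hs : κ.Survives h) : κ.mate h = h := by
  simp only [mate]
  rw [dif_neg]
  rintro ⟨⟨-, e, he⟩, -⟩
  have := hs.2
  rw [he] at this
  exact this

theorem line_mate (h : Γ.D) : Γ.line (κ.mate h) = Γ.line h := by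
  by_cases H : (h ∉ κ.edges.carrier ∧ ∃ e, κ.res (κ.compOf h) = .edge e) ∧
      ∃ h', h' ≠ h ∧ h' ∉ κ.edges.carrier ∧ κ.compOf h' = κ.compOf h
  · have h1 : κ.mate h = H.2.choose := by simp only [mate]; rw [dif_pos H]
    obtain ⟨hne, hS, hc⟩ := H.2.choose_spec
    rw [h1]
    obtain ⟨e, he⟩ := H.1.2
    rw [κ.line_eq_of_edge hS (by rw [hc, he]), κ.line_eq_of_edge H.1.1 he]
  · have h1 : κ.mate h = h := by simp only [mate]; rw [dif_neg H]
    rw [h1]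

/-- The quotient `Γ/γ`. Its vertices are the components contracted to a vertex, and the untouched
vertices of `Γ`. A component contracted to an edge disappears: its two external lines are fused,
so that a surviving half-line is glued to the surviving half-line at the other end of
the chain `link, mate, link, mate, …, link`. -/
noncomputable def quotient : FGraph where
  V := {c : (Γ.cut κ.edges).Comp // (κ.res c).IsVertex}
  D := {h : Γ.D // κ.Survives h}
  finV := inferInstance
  finD := inferInstance
  vert c := (κ.res c.1).toVertex c.2
  line h := Γ.line h.1
  root h := ⟨κ.compOf h.1, h.2.2⟩
  legs_eq c i := by
    have h1 := κ.hasRes c.1 i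
    have h2 : (κ.res c.1).legs i = ((κ.res c.1).toVertex c.2).legs i := by
      have : ∀ (r : Res) (hr : r.IsVertex), r.legs i = (r.toVertex hr).legs i
        | .vertex _, _ => rfl
        | .edge _, hr => hr.elim
      exact this _ c.2
    rw [← h2, ← h1]
    refine Nat.card_congr ⟨fun h => ⟨⟨h.1.1, congrArg Subtype.val h.2.1⟩,
        Subtype.ext ((Γ.cut_link_eq_self_iff κ.edges h.1.1).2 h.1.2.1), h.2.2⟩,
      fun h => ⟨⟨h.1.1, (Γ.cut_link_eq_self_iff κ.edges h.1.1).1 (congrArg Subtype.val h.2.1),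
        ?_⟩, Subtype.ext h.1.2, h.2.2⟩, fun _ => rfl, fun _ => rfl⟩
    have h3 : κ.compOf h.1.1 = c.1 := h.1.2
    rw [h3]; exact c.2
  link h := ⟨fold Γ.link κ.mate κ.Survives h.1,
    fold_mem Γ.link_link κ.mate_mate (fun _ => κ.mate_of_survives) h.2⟩
  link_link h := Subtype.ext
    (fold_fold Γ.link_link κ.mate_mate (fun _ => κ.mate_of_survives) h.2)
  line_link h := apply_fold Γ.line_link κ.line_mate h.1

end FGraph.Contraction

/-! ### The Hopf algebra of Feynman graphs -/

/-- A 1PI Feynman graph dressed with its residue in `R`: for a graph with two external quark lines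
the residue `.vertex .mass` is the bullet. -/
structure RGraph where
  graph : FGraph
  res : Res
  onePI : graph.IsOnePI
  hasRes : graph.HasRes res

/-- Isomorphism of dressed graphs. -/
def rgraphSetoid : Setoid RGraph where
  r Γ Γ' := Γ.res = Γ'.res ∧ Nonempty (FGraph.Iso Γ.graph Γ'.graph)
  iseqv := ⟨fun _ => ⟨rfl, ⟨.refl _⟩⟩, fun ⟨h, ⟨φ⟩⟩ => ⟨h.symm, ⟨φ.symm⟩⟩,
    fun ⟨h, ⟨φ⟩⟩ ⟨h', ⟨ψ⟩⟩ => ⟨h.trans h', ⟨φ.trans ψ⟩⟩⟩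

/-- The generators of the Hopf algebra: 1PI graphs with residue in `R`, up to isomorphism. -/
def Gen : Type 1 := Quotient rgraphSetoid

/-- A representative of a generator. Everything below that is defined through it depends on
the isomorphism class only. -/
noncomputable def Gen.rep (g : Gen) : RGraph := Quotient.out g

/-- The residue. -/
noncomputable def Gen.res (g : Gen) : Res := g.rep.res

/-- The loop number. -/
noncomputable def Gen.loops (g : Gen) : ℤ := g.rep.graph.loops

/-- The degree `d_v`: the number of vertices `v`, minus one if `v` is the residue. -/
noncomputable def Gen.deg (g : Gen) (v : Vertex) : ℤ :=
  (Nat.card {w : g.rep.graph.V // g.rep.graph.vert w = v} : ℤ) -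
    if g.res = .vertex v then 1 else 0

/-- The free commutative algebra generated by the 1PI graphs with residue in `R`. -/
abbrev HCK : Type 1 := MvPolynomial Gen ℂ

/-- The generator given by the graph `Γ` dressed with the residue `r` (and `0` if this is not a 1PI
graph with residue `r`; this case does not occur in the coproduct). -/
noncomputable def graphElt (Γ : FGraph) (r : Res) : HCK := by
  classical
  exact if H : Γ.IsOnePI ∧ Γ.HasRes r then
    MvPolynomial.X (Quotient.mk rgraphSetoid ⟨Γ, r, H.1, H.2⟩) else 0

/-- The product of the connected components of the subgraph `γ`, as an element of the algebra. -/
noncomputable def FGraph.Contraction.subgraphElt {Γ : FGraph} (κ : Γ.Contraction) : HCK :=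
  ∏ᶠ c : {c : (Γ.cut κ.edges).Comp // ∃ h ∈ κ.edges.carrier, κ.compOf h = c},
    graphElt ((Γ.cut κ.edges).component c.1) (κ.res c.1)

/-- `γ` is neither empty nor all of `Γ`. -/
def FGraph.Contraction.IsProper {Γ : FGraph} (κ : Γ.Contraction) : Prop :=
  κ.edges.carrier ≠ ∅ ∧ κ.edges.carrier ≠ {h | Γ.link h ≠ h}

/-- The coproduct `Δ(Γ) = Γ ⊗ 1 + 1 ⊗ Γ + ∑ γ ⊗ Γ/γ`, extended multiplicatively. -/
noncomputable def comul : HCK →ₐ[ℂ] HCK ⊗[ℂ] HCK :=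
  MvPolynomial.aeval fun g =>
    MvPolynomial.X g ⊗ₜ 1 + 1 ⊗ₜ MvPolynomial.X g +
      ∑ᶠ κ : {κ : g.rep.graph.Contraction // κ.IsProper},
        κ.1.subgraphElt ⊗ₜ graphElt κ.1.quotient g.res

/-- The counit. -/
noncomputable def counit : HCK →ₐ[ℂ] ℂ := MvPolynomial.aeval fun _ => 0

/-! ### Green's functions -/

/-- The ways of identifying the external lines of `Γ` with those of `r`. -/
def Labelling (Γ : FGraph) (r : Res) : Type :=
  {e : {h : Γ.D // Γ.link h = h} ≃ (Σ i : Line, Fin (r.legs i)) // ∀ h, (e h).1 = Γ.line h.1}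

/-- Two labellings give isomorphic graphs with labelled external lines. -/
def labellingSetoid (Γ : FGraph) (r : Res) : Setoid (Labelling Γ r) where
  r a b := ∃ φ : FGraph.Iso Γ Γ, ∀ h h' : {h : Γ.D // Γ.link h = h},
    φ.onD h.1 = h'.1 → b.1 h' = a.1 h
  iseqv := by
    refine ⟨fun a => ⟨.refl Γ, fun h h' hh => ?_⟩, fun {a b} ⟨φ, hφ⟩ => ⟨φ.symm, fun h h' hh => ?_⟩,
      fun {a b c} ⟨φ, hφ⟩ ⟨ψ, hψ⟩ => ⟨φ.trans ψ, fun h h' hh => ?_⟩⟩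
    · rw [show h' = h from Subtype.ext hh.symm]
    · refine (hφ h' h ?_).symm
      rw [← hh]; exact φ.onD.apply_symm_apply _
    · have hm : Γ.link (φ.onD h.1) = φ.onD h.1 := by rw [φ.link_eq, h.2]
      rw [hψ ⟨φ.onD h.1, hm⟩ h' hh, hφ h ⟨φ.onD h.1, hm⟩ rfl]

/-- The symmetry factor: the number of automorphisms that fix the external lines. -/
noncomputable def symFactor (Γ : FGraph) : ℕ :=
  Nat.card {φ : FGraph.Iso Γ Γ // ∀ h, Γ.link h = h → φ.onD h = h}

/-- The coefficient of the generator `g` in `∑ Γ / Sym(Γ)`, where the sum runs over graphs with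
labelled external lines: there are as many such graphs over `g` as inequivalent labellings,
and all of them have the same symmetry factor. -/
noncomputable def weight (g : Gen) : ℂ :=
  (Nat.card (Quotient (labellingSetoid g.rep.graph g.res)) : ℂ) / symFactor g.rep.graph

/-- Formal (infinite) linear combinations of monomials in the graphs: the completion of `HCK`. -/
abbrev Formal : Type 1 := MvPowerSeries Gen ℂ

/-- The formal series `∑ c(g) g`, linear in the generators. -/
noncomputable def linearSeries (c : Gen → ℂ) : Formal := by
  classical
  exact fun m => ∑ᶠ g : Gen, if m = Finsupp.single g 1 then c g else 0

/-- The 1PI Green's function `G^r = 1 ± ∑_{res Γ = r} Γ / Sym(Γ)`. -/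
noncomputable def green (r : Res) : Formal :=
  1 + linearSeries fun g => if g.res = r then r.sign * weight g else 0

/-- The power `f ^ a` of a series `f` with constant coefficient `1`, as the binomial series
`∑ₖ (a choose k) (f - 1) ^ k`; only terms with `k ≤ deg m` contribute to the coefficient of
the monomial `m`. -/
noncomputable def formalPow (f : Formal) (a : ℂ) : Formal := fun m =>
  ∑ k ∈ Finset.range (m.degree + 1), Ring.choose a k * MvPowerSeries.coeff m ((f - 1) ^ k)

/-- `Y_v = G^v / ∏ᵢ (G^{eᵢ}) ^ (Nᵢ(v) / 2)`. -/
noncomputable def Y (v : Vertex) : Formal :=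
  green (.vertex v) * ∏ i : Line, formalPow (green (.edge i)) (-((v.legs i : ℂ) / 2))

/-- The loop order of a monomial. -/
noncomputable def monLoops (m : Gen →₀ ℕ) : ℤ := m.sum fun g k => (k : ℤ) * g.loops

/-- The vertex degree `d_v` of a monomial. -/
noncomputable def monDeg (m : Gen →₀ ℕ) (v : Vertex) : ℤ := m.sum fun g k => (k : ℤ) * g.deg v

/-- The part of a formal series that consists of the monomials satisfying `P`. -/
noncomputable def part (P : (Gen →₀ ℕ) → Prop) (f : Formal) : Formal := by
  classical
  exact fun m => if P m then f m else 0

/-- The projection `p_n` to vertex multidegree `n`. -/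
noncomputable def multidegPart (n : Vertex → ℤ) : Formal → Formal :=
  part fun m => ∀ v, monDeg m v = n v

/-- The projection `q_{l,s}` to loop order `l` and degree `s` in the mass vertex. -/
noncomputable def loopMassPart (l : ℕ) (s : ℤ) : Formal → Formal :=
  part fun m => monLoops m = l ∧ monDeg m .mass = s

/-- The subalgebra `H` generated by the Green's functions in each vertex multidegree. -/
noncomputable def H : Subalgebra ℂ HCK :=
  Algebra.adjoin ℂ {x | ∃ r n, (x : Formal) = multidegPart n (green r)}

/-- The ideal `J` of `H` generated by the components `q_{l,s}(Y_k ^ (N(j)-2) - Y_j ^ (N(k)-2))`,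
for `j`, `k` among `v₁, …, v₄`. -/
noncomputable def J : Ideal H :=
  Ideal.span {x : H | ∃ j k : Vertex, j ≠ .mass ∧ k ≠ .mass ∧ ∃ (l : ℕ) (s : ℤ),
    ((x : HCK) : Formal) = loopMassPart l s (Y k ^ (j.valence - 2) - Y j ^ (k.valence - 2))}

end QCD

namespace QCD

namespace FGraph

/-! ### Reachability, isomorphisms and one-particle irreducibility -/

/-! The heart of the matter is the formula Δ(f) = ∑ₙ f · `Ypow n` ⊗ pₙ(f) for f = G^r, where `Ypow
n` is the product of the powers Y_w ^ n_w. A series for which it holds is called `GroupLike`.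

For f = G^r the formula is a count. By orbit counting, a graph Γ of residue r has weight (kind
preserving permutations of the lines of r) / |Aut Γ| (`weight_eq`). So the coefficient of m ⊗ Γ'
counts, up to automorphisms, the graphs Γ with a subgraph γ of product m and an identification of
Γ/γ with Γ'. Such data amount to inserting a 1PI graph or nothing at each vertex of Γ', and a chain
of k ≥ 0 self-energy graphs on each internal edge. For fixed chain lengths this is an insertion into
a skeleton, namely Γ' with k beads on each edge (`beadsEquiv`, `card_presentation`). The number of
gluings at a slot is the numerator of the weight of the piece inserted there (`card_gluing`), so the
count is a product of weights (`finsum_monPresentation`). Summing over the chain lengths gives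
geometric series, in total ∏ G^v ∏ (G^e)⁻¹ over the vertices and internal edges of Γ'
(`finsum_quotientPresentation`). Counting the half-lines of Γ' turns this into G^r · `Ypow` of the
degree of Γ' (`green_mul_Ypow`).

The formula is stable under products because `Ypow` is additive in the exponent, and under complex
powers because the coefficients on both sides are polynomials in the exponent. Hence it holds for
every `Ypow n` (`groupLike_Ypow`). A 1PI graph has loop number at least 1 and degrees at least -1,
so every homogeneous part used here is a finite sum. Taking components gives Δ(H) ⊂ H ⊗ H.

For the ideal, the exponents n such that `Ypow n - 1` has components in J form a group. It contains
(N(j)-2) e_k - (N(k)-2) e_j for j, k among v₁, …, v₄, and these vectors generate all n of loop order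
and mass degree zero. So modulo J the series `Ypow n` depends only on the loop order and the mass
degree of n (`isJ_Ypow_sub`). Let f, g be the two sides of an identity, and let n' be a standard
exponent with the same loop order and mass degree as n. Then Δ(f - g) is the sum of (f - g) `Ypow n`
⊗ pₙ(f), of g (`Ypow n - Ypow n'`) ⊗ pₙ(f - g), and of g `Ypow n'` ⊗ pₙ(f - g)
(`comul_loopComp_sub`). In the first two sums the left factors lie in J. In the third the left
factor no longer sees n itself, so the right factors add up to full components q_{l,s}(f - g), which
are generators of J. -/

theorem reach_iff {Γ : FGraph} {S : Set Γ.D} {v w : Γ.V} :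
    Γ.Reach S v w ↔ ∀ U : Γ.V → Prop,
      (∀ h ∈ S, (U (Γ.root h) ↔ U (Γ.root (Γ.link h)))) → (U v ↔ U w) := by
  constructor
  · intro h U hU
    induction h with
    | rel x y h => obtain ⟨h, hS, rfl, rfl⟩ := h; exact hU h hS
    | refl => rfl
    | symm _ _ _ ih => exact ih.symm
    | trans _ _ _ _ _ ih1 ih2 => exact ih1.trans ih2
  · intro h
    refine (h (Γ.Reach S v) ?_).1 (.refl v)
    intro h hS
    have h1 : Γ.Reach S (Γ.root h) (Γ.root (Γ.link h)) := .rel _ _ ⟨h, hS, rfl, rfl⟩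
    exact ⟨fun a => .trans _ _ _ a h1, fun a => .trans _ _ _ a (.symm _ _ h1)⟩

theorem Iso.ext_onD {Γ Γ' : FGraph} {φ ψ : Iso Γ Γ'} (hV : ∀ v, φ.onV v = ψ.onV v)
    (hD : ∀ h, φ.onD h = ψ.onD h) : φ = ψ := by
  cases φ; cases ψ
  congr
  · exact Equiv.ext hV
  · exact Equiv.ext hD

instance (Γ Γ' : FGraph) : Finite (Iso Γ Γ') :=
  Finite.of_injective (fun φ : Iso Γ Γ' => (φ.onV, φ.onD)) fun φ ψ h => by
    simp only [Prod.mk.injEq] at h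
    exact Iso.ext_onD (fun v => by rw [h.1]) (fun v => by rw [h.2])

theorem exists_leg (Γ : FGraph) (v : Γ.V) : ∃ h, Γ.root h = v := by
  have : ∃ i, (Γ.vert v).legs i ≠ 0 := by
    cases Γ.vert v
    · exact ⟨.quark, by decide⟩
    · exact ⟨.ghost, by decide⟩
    · exact ⟨.gluon, by decide⟩
    · exact ⟨.gluon, by decide⟩
    · exact ⟨.quark, by decide⟩
  obtain ⟨i, hi⟩ := this
  rw [← Γ.legs_eq v i] at hi
  obtain ⟨⟨h, hh⟩⟩ := (Nat.card_ne_zero.1 hi).1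
  exact ⟨h, hh.1⟩

theorem link_injective (Γ : FGraph) : Function.Injective Γ.link :=
  Function.LeftInverse.injective Γ.link_link

/-- The simple graph underlying a Feynman graph. -/
def toSimpleGraph (Γ : FGraph) : SimpleGraph Γ.V where
  Adj v w := v ≠ w ∧ ∃ h, Γ.root h = v ∧ Γ.root (Γ.link h) = w
  symm := ⟨fun _ _ ⟨h, k, h1, h2⟩ => ⟨h.symm, Γ.link k, h2, by rw [Γ.link_link, h1]⟩⟩
  loopless := ⟨fun _ h => h.1 rfl⟩

/-- The spanning tree bound for the underlying simple graph suffices, because self-loops and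
multiple edges only increase the number of edges. -/
theorem Connected.card_le {Γ : FGraph} (h : Γ.Connected) : Nat.card Γ.V ≤ Γ.numEdges + 1 := by
  classical
  have := Fintype.ofFinite Γ.V
  have hc : Γ.toSimpleGraph.Connected := by
    have := h.1
    refine ⟨fun v w => ?_⟩
    refine (reach_iff.1 (h.2 v w) (Γ.toSimpleGraph.Reachable v) ?_).1 (.refl v)
    intro k _
    by_cases hk : Γ.root k = Γ.root (Γ.link k)
    · rw [← hk]
    · have ha : Γ.toSimpleGraph.Adj (Γ.root k) (Γ.root (Γ.link k)) := ⟨hk, k, rfl, rfl⟩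
      exact ⟨fun a => a.trans ha.reachable, fun a => a.trans ha.symm.reachable⟩
  have h1 := hc.card_vert_le_card_edgeSet_add_one
  -- Each oriented simple edge is realised by some internal half-line, and the half-line determines
  -- both ends.
  have h2 : 2 * Nat.card Γ.toSimpleGraph.edgeSet ≤ Nat.card {h : Γ.D // Γ.link h ≠ h} := by
    rw [Nat.card_eq_fintype_card, ← SimpleGraph.edgeFinset_card,
      ← SimpleGraph.dart_card_eq_twice_card_edges, ← Nat.card_eq_fintype_card]
    refine Nat.card_le_card_of_injective
      (fun d => ⟨d.adj.2.choose, fun hd => d.adj.1 ?_⟩) ?_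
    · have := d.adj.2.choose_spec
      exact this.1.symm.trans ((congrArg Γ.root hd).symm.trans this.2)
    · intro d d' hd
      have := d.adj.2.choose_spec
      have h' := d'.adj.2.choose_spec
      simp only [Subtype.mk.injEq] at hd
      rw [hd] at this
      exact SimpleGraph.Dart.ext _ _ (Prod.ext (this.1.symm.trans h'.1) (this.2.symm.trans h'.2))
  have : Nat.card Γ.toSimpleGraph.edgeSet ≤ Γ.numEdges := by
    rw [numEdges]; omega
  omega

theorem IsOnePI.exists_edge {Γ : FGraph} (h : Γ.IsOnePI) : ∃ k, Γ.link k ≠ k := by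
  by_contra! hl
  apply h.2.1
  have := h.1.1
  have h1 : Subsingleton Γ.V := ⟨fun v w =>
    (reach_iff.1 (h.1.2 v w) (fun x => v = x) fun k _ => by rw [hl]).1 rfl⟩
  have h2 : Nat.card Γ.V = 1 := Nat.card_eq_one_iff_unique.2 ⟨h1, h.1.1⟩
  have h3 : Nat.card {h : Γ.D // Γ.link h ≠ h} = 0 := by
    rw [Finite.card_eq_zero_iff]; exact ⟨fun k => k.2 (hl k.1)⟩
  simp [loops, numEdges, h3]

/-- With connectivity tested by predicates that do not change along edges, the condition "not a
tree" reduces to the presence of an edge: if that edge can be cut without disconnecting, the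
spanning tree bound for the cut graph already gives a positive loop number. -/
theorem isOnePI_iff {Γ : FGraph} : Γ.IsOnePI ↔ (∃ k, Γ.link k ≠ k) ∧
    ∀ k, Γ.link k ≠ k → ∀ U : Γ.V → Prop,
      (∀ h, h ≠ k → h ≠ Γ.link k → (U (Γ.root h) ↔ U (Γ.root (Γ.link h)))) →
      ∀ v w, U v ↔ U w := by
  constructor
  · intro h
    refine ⟨h.exists_edge, fun k hk U hU v w => reach_iff.1 (h.2.2 k hk v w) U fun x hx => ?_⟩
    simp only [Set.mem_compl_iff, Set.mem_insert_iff, Set.mem_singleton_iff, not_or] at hx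
    exact hU x hx.1 hx.2
  · rintro ⟨⟨k, hk⟩, H⟩
    have hr : ∀ k, Γ.link k ≠ k → ∀ v w, Γ.Reach {k, Γ.link k}ᶜ v w := fun k hk v w =>
      reach_iff.2 fun U hU => H k hk U (fun h h1 h2 => hU h (by simp [h1, h2])) v w
    have hn : Nonempty Γ.V := ⟨Γ.root k⟩
    refine ⟨⟨hn, fun v w => reach_iff.2 fun U hU =>
      H k hk U (fun h _ _ => hU h (Set.mem_univ _)) v w⟩, ?_, hr⟩
    let E : Γ.EdgeSet :=
      { carrier := {h | Γ.link h ≠ h ∧ h ≠ k ∧ h ≠ Γ.link k}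
        link_mem := fun h ⟨h1, h2, h3⟩ => ⟨fun h4 => h1 (Γ.link_injective h4),
          fun h4 => h3 (by rw [← h4, Γ.link_link]), fun h4 => h2 (Γ.link_injective h4)⟩
        internal := fun h hh => hh.1 }
    have hE : (Γ.cut E).Connected := ⟨hn, fun v w => reach_iff.2 fun U hU =>
      H k hk U (fun h h1 h2 => by
        by_cases h3 : Γ.link h = h
        · rw [h3]
        · have := hU h (Set.mem_univ _)
          have hm : h ∈ E.carrier := ⟨h3, h1, h2⟩
          simpa [cut, hm] using this) v w⟩
    have h1 := hE.card_le
    have h2 : Nat.card {h : Γ.D // Γ.link h ≠ h} = E.carrier.ncard + 2 := by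
      have : {h : Γ.D | Γ.link h ≠ h} = E.carrier ∪ {k, Γ.link k} := by
        ext h
        simp only [Set.mem_ofPred_eq, Set.mem_union, Set.mem_insert_iff, Set.mem_singleton_iff, E]
        constructor
        · intro h1; tauto
        · rintro (h1 | rfl | rfl)
          · exact h1.1
          · exact hk
          · rw [Γ.link_link]; exact hk.symm
      change Nat.card ↥{h : Γ.D | Γ.link h ≠ h} = _
      rw [Nat.card_coe_set_eq, this, Set.ncard_union_eq, Set.ncard_pair hk.symm]
      rw [Set.disjoint_left]
      rintro x ⟨-, h2, h3⟩ (h4 | h4)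
      · exact h2 h4
      · exact h3 h4
    have h3 : Nat.card {h : (Γ.cut E).D // (Γ.cut E).link h ≠ h} = E.carrier.ncard := by
      rw [← Nat.card_coe_set_eq]
      exact Nat.card_congr (Equiv.subtypeEquivRight fun h => by
        exact (not_congr (Γ.cut_link_eq_self_iff E h)).trans not_not)
    have h4 : Nat.card (Γ.cut E).V = Nat.card Γ.V := rfl
    simp only [numEdges, h3, h4, loops, h2] at h1 ⊢
    omega

theorem IsOnePI.loops_pos {Γ : FGraph} (h : Γ.IsOnePI) : 1 ≤ Γ.loops := by
  have h1 := h.1.card_le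
  have h2 := h.2.1
  simp only [loops] at *
  omega

theorem Iso.link_symm {Γ Γ' : FGraph} (φ : Iso Γ Γ') (h : Γ'.D) :
    Γ.link (φ.onD.symm h) = φ.onD.symm (Γ'.link h) := φ.symm.link_eq h

theorem Iso.link_eq_self_iff {Γ Γ' : FGraph} (φ : Iso Γ Γ') (h : Γ.D) :
    Γ'.link (φ.onD h) = φ.onD h ↔ Γ.link h = h := by
  rw [φ.link_eq, φ.onD.apply_eq_iff_eq]

theorem IsOnePI.of_iso {Γ Γ' : FGraph} (φ : Iso Γ Γ') (h : Γ.IsOnePI) : Γ'.IsOnePI := by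
  rw [isOnePI_iff] at h ⊢
  obtain ⟨⟨k, hk⟩, H⟩ := h
  refine ⟨⟨φ.onD k, by rwa [Ne, φ.link_eq_self_iff]⟩, fun k hk U hU v w => ?_⟩
  have := H (φ.onD.symm k) (by rwa [Ne, ← φ.link_eq_self_iff, Equiv.apply_symm_apply])
    (U ∘ φ.onV) (fun h h1 h2 => ?_) (φ.onV.symm v) (φ.onV.symm w)
  · simpa using this
  · have := hU (φ.onD h) (fun h3 => h1 (by simp [← h3])) (fun h3 => h2 (by
      rw [φ.link_symm, ← h3]; simp))
    simpa [φ.root_eq, φ.link_eq] using this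

theorem HasRes.of_iso {Γ Γ' : FGraph} (φ : Iso Γ Γ') {r : Res} (h : Γ.HasRes r) :
    Γ'.HasRes r := fun i => by
  rw [← h i]
  exact (Nat.card_congr (φ.onD.subtypeEquiv fun _ => by
    rw [φ.link_eq_self_iff, φ.line_eq])).symm

/-! ### Counting half-lines, edges and vertices -/

/-- A numbering of the half-lines. -/
noncomputable def enc (Γ : FGraph) : Γ.D ≃ Fin (Nat.card Γ.D) := Finite.equivFin _

/-- The internal edges, each represented by one of its two half-lines. -/
def Ed (Γ : FGraph) : Type := {h : Γ.D // Γ.enc h < Γ.enc (Γ.link h)}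

instance (Γ : FGraph) : Finite Γ.Ed := inferInstanceAs (Finite {h : Γ.D // _})

theorem Ed.link_ne {Γ : FGraph} (e : Γ.Ed) : Γ.link e.1 ≠ e.1 := fun h => by
  have := e.2; rw [h] at this; exact lt_irrefl _ this

theorem lt_or_lt_of_link_ne {Γ : FGraph} {h : Γ.D} (hh : Γ.link h ≠ h) :
    Γ.enc h < Γ.enc (Γ.link h) ∨ Γ.enc (Γ.link h) < Γ.enc (Γ.link (Γ.link h)) := by
  rw [Γ.link_link]
  exact lt_or_gt_of_ne fun h1 => hh (Γ.enc.injective h1).symm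

theorem card_internal (Γ : FGraph) (P : Γ.D → Prop) (hP : ∀ h, P (Γ.link h) ↔ P h) :
    Nat.card {h : Γ.D // Γ.link h ≠ h ∧ P h} = 2 * Nat.card {e : Γ.Ed // P e.1} := by
  classical
  have e1 : {e : Γ.Ed // P e.1} ⊕ {e : Γ.Ed // P e.1} ≃ {h : Γ.D // Γ.link h ≠ h ∧ P h} :=
    Equiv.ofBijective
      (Sum.elim (fun e => ⟨e.1.1, e.1.link_ne, e.2⟩)
        (fun e => ⟨Γ.link e.1.1, by rw [Γ.link_link]; exact e.1.link_ne.symm, (hP _).2 e.2⟩)) <| by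
      constructor
      · rintro (⟨⟨a, ha⟩, ha'⟩ | ⟨⟨a, ha⟩, ha'⟩) (⟨⟨b, hb⟩, hb'⟩ | ⟨⟨b, hb⟩, hb'⟩) hab <;>
          simp only [Sum.elim_inl, Sum.elim_inr, Subtype.mk.injEq] at hab
        · subst hab; rfl
        · subst hab; rw [Γ.link_link] at ha; exact absurd ha hb.asymm
        · subst hab; rw [Γ.link_link] at hb; exact absurd hb ha.asymm
        · obtain rfl := Γ.link_injective hab; rfl
      · rintro ⟨h, h1, h2⟩
        rcases lt_or_lt_of_link_ne h1 with h3 | h3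
        · exact ⟨.inl ⟨⟨h, h3⟩, h2⟩, rfl⟩
        · exact ⟨.inr ⟨⟨Γ.link h, h3⟩, (hP _).2 h2⟩, Subtype.ext (Γ.link_link h)⟩
  rw [← Nat.card_congr e1, Nat.card_sum, two_mul]

/-- The number of vertices of type `w`. -/
noncomputable def numV (Γ : FGraph) (w : Vertex) : ℕ := Nat.card {v : Γ.V // Γ.vert v = w}

theorem sum_vert {M : Type*} [AddCommMonoid M] (Γ : FGraph) [Fintype Γ.V] (f : Vertex → M) :
    ∑ v, f (Γ.vert v) = ∑ w, Γ.numV w • f w := by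
  classical
  rw [← Finset.sum_fiberwise (s := Finset.univ) (g := Γ.vert)]
  refine Finset.sum_congr rfl fun w _ => ?_
  rw [Finset.sum_congr rfl (g := fun _ => f w) (by simp +contextual), Finset.sum_const, numV,
    Nat.card_eq_fintype_card, Fintype.card_subtype]

theorem card_line (Γ : FGraph) (i : Line) :
    Nat.card {h : Γ.D // Γ.line h = i} = ∑ w, Γ.numV w * w.legs i := by
  classical
  have := Fintype.ofFinite Γ.V
  rw [← Nat.card_congr (Equiv.sigmaFiberEquiv fun h : {h : Γ.D // Γ.line h = i} => Γ.root h.1),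
    Nat.card_sigma]
  have := Γ.sum_vert fun w => w.legs i
  simp only [smul_eq_mul] at this
  rw [← this]
  refine Finset.sum_congr rfl fun v _ => ?_
  rw [← Γ.legs_eq]
  exact Nat.card_congr ⟨fun h => ⟨h.1.1, h.2, h.1.2⟩, fun h => ⟨⟨h.1, h.2.2⟩, h.2.1⟩,
    fun _ => rfl, fun _ => rfl⟩

/-- Double counting of the half-lines of kind `i`, by how they are glued and by the vertex that
carries them. Both the loop number and the exponents in `green_mul_Ypow` come from this relation. -/
theorem two_mul_edges (Γ : FGraph) (i : Line) :
    2 * Nat.card {e : Γ.Ed // Γ.line e.1 = i} + Nat.card {h : Γ.D // Γ.link h = h ∧ Γ.line h = i}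
      = ∑ w, Γ.numV w * w.legs i := by
  classical
  rw [← card_line, ← Γ.card_internal (fun h => Γ.line h = i) fun h => by rw [Γ.line_link],
    ← Nat.card_sum]
  refine Nat.card_congr ⟨Sum.elim (fun h => ⟨h.1, h.2.2⟩) fun h => ⟨h.1, h.2.2⟩,
    fun h => if h1 : Γ.link h.1 = h.1 then .inr ⟨h.1, h1, h.2⟩ else .inl ⟨h.1, h1, h.2⟩, ?_, ?_⟩
  · rintro (⟨h, h1, h2⟩ | ⟨h, h1, h2⟩) <;> simp [h1]
  · rintro ⟨h, h2⟩
    by_cases h1 : Γ.link h = h <;> simp [h1]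

theorem sum_line {M : Type*} [AddCommMonoid M] (f : Line → M) :
    ∑ i, f i = f .quark + f .ghost + f .gluon := by
  change ∑ i ∈ ({.quark, .ghost, .gluon} : Finset Line), f i = _
  rw [Finset.sum_insert (by decide), Finset.sum_insert (by decide), Finset.sum_singleton, add_assoc]

theorem sum_vertex {M : Type*} [AddCommMonoid M] (f : Vertex → M) :
    ∑ v, f v = f .quarkGluon + f .ghostGluon + f .gluon3 + f .gluon4 + f .mass := by
  change ∑ i ∈ ({.quarkGluon, .ghostGluon, .gluon3, .gluon4, .mass} : Finset Vertex), f i = _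
  rw [Finset.sum_insert (by decide), Finset.sum_insert (by decide), Finset.sum_insert (by decide),
    Finset.sum_insert (by decide), Finset.sum_singleton]
  simp only [add_assoc]

theorem numEdges_eq (Γ : FGraph) :
    Γ.numEdges = ∑ i, Nat.card {e : Γ.Ed // Γ.line e.1 = i} := by
  classical
  have h1 := Γ.card_internal (fun _ => True) fun _ => Iff.rfl
  have h2 : Nat.card {h : Γ.D // Γ.link h ≠ h ∧ True} = Nat.card {h : Γ.D // Γ.link h ≠ h} :=
    Nat.card_congr (Equiv.subtypeEquivRight fun h => iff_of_eq (and_true _))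
  have h3 : Nat.card {e : Γ.Ed // True} = Nat.card Γ.Ed :=
    Nat.card_congr (Equiv.subtypeUnivEquiv fun _ => trivial)
  rw [numEdges, ← h2, h1, h3, Nat.mul_div_cancel_left _ two_pos,
    ← Nat.card_congr (Equiv.sigmaFiberEquiv fun e : Γ.Ed => Γ.line e.1), Nat.card_sigma]

theorem card_V_eq (Γ : FGraph) : Nat.card Γ.V = ∑ w, Γ.numV w := by
  rw [← Nat.card_congr (Equiv.sigmaFiberEquiv Γ.vert), Nat.card_sigma]; rfl

/-- The degree `d_w` of a graph with residue `r`. -/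
noncomputable def degree (Γ : FGraph) (r : Res) (w : Vertex) : ℤ :=
  (Γ.numV w : ℤ) - if r = .vertex w then 1 else 0

/-- Euler's relation combined with the half-line count. A vertex residue `v` removes `N(v)` external
lines and the constant 2 of the Euler relation restores part of them, which is the shift by one in
the degree; an edge residue cancels against that constant. Mass vertices have coefficient 0, so the
loop number does not bound their number. -/
theorem two_mul_loops {Γ : FGraph} {r : Res} (h : Γ.HasRes r) :
    2 * Γ.loops = ∑ w, ((w.valence : ℤ) - 2) * Γ.degree r w := by
  have h1 := fun i => Γ.two_mul_edges i
  simp only [h _] at h1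
  have ha := h1 .quark
  have hb := h1 .ghost
  have hc := h1 .gluon
  rw [loops, numEdges_eq, card_V_eq]
  simp only [sum_vertex, sum_line, Vertex.valence, degree] at *
  rcases r with v | e
  · cases v <;> simp [Vertex.legs, Res.legs] at * <;> omega
  · cases e <;> simp [Vertex.legs, Res.legs] at * <;> omega

theorem numV_iso {Γ Γ' : FGraph} (φ : Iso Γ Γ') (w : Vertex) : Γ.numV w = Γ'.numV w :=
  Nat.card_congr (φ.onV.subtypeEquiv fun v => by rw [φ.vert_eq])

end FGraph

/-! ### Generators -/

/-- The isomorphism class of a dressed graph. -/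
def Gen.mk (X : RGraph) : Gen := Quotient.mk rgraphSetoid X

theorem Gen.mk_rep (g : Gen) : Gen.mk g.rep = g := Quotient.out_eq g

theorem Gen.mk_eq_mk {X X' : RGraph} : Gen.mk X = Gen.mk X' ↔
    X.res = X'.res ∧ Nonempty (FGraph.Iso X.graph X'.graph) :=
  Quotient.eq (r := rgraphSetoid)

theorem Gen.mk_eq_iff {X : RGraph} {g : Gen} : Gen.mk X = g ↔
    X.res = g.res ∧ Nonempty (FGraph.Iso X.graph g.rep.graph) := by
  conv_lhs => rw [← g.mk_rep]
  exact Gen.mk_eq_mk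

theorem Gen.deg_eq (g : Gen) (w : Vertex) : g.deg w = g.rep.graph.degree g.res w := rfl

theorem Gen.deg_mk (X : RGraph) (w : Vertex) :
    Gen.deg (Gen.mk X) w = X.graph.degree X.res w := by
  obtain ⟨h1, ⟨φ⟩⟩ := (Gen.mk_eq_iff (X := X)).1 rfl
  rw [Gen.deg_eq, FGraph.degree, FGraph.degree, FGraph.numV_iso φ, h1]

theorem Gen.res_mk (X : RGraph) : Gen.res (Gen.mk X) = X.res :=
  ((Gen.mk_eq_iff (X := X)).1 rfl).1.symm

theorem Gen.two_mul_loops (g : Gen) :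
    2 * g.loops = ∑ w, ((w.valence : ℤ) - 2) * g.deg w :=
  FGraph.two_mul_loops g.rep.hasRes

theorem Gen.loops_pos (g : Gen) : 1 ≤ g.loops := g.rep.onePI.loops_pos

theorem Gen.neg_one_le_deg (g : Gen) (w : Vertex) : -1 ≤ g.deg w := by
  rw [Gen.deg_eq, FGraph.degree]; split_ifs <;> omega

theorem Res.finite : Finite Res := Finite.of_injective
  (fun r : Res => (match r with | .vertex v => .inl v | .edge e => .inr e : Vertex ⊕ Line)) <| by
    rintro (a | a) (b | b) h <;> simp_all

/-- There are finitely many generators with given numbers of vertices and half-lines. -/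
theorem Gen.finite_of_card (n d : ℕ) : {g : Gen | Nat.card g.rep.graph.V = n ∧
    Nat.card g.rep.graph.D = d}.Finite := by
  classical
  have := Res.finite
  let code : {g : Gen | Nat.card g.rep.graph.V = n ∧ Nat.card g.rep.graph.D = d} →
      (Fin n → Vertex) × (Fin d → Line) × (Fin d → Fin n) × (Fin d → Fin d) × Res := fun g =>
    let eV := Finite.equivFinOfCardEq g.2.1
    let eD := Finite.equivFinOfCardEq g.2.2
    (fun v => g.1.rep.graph.vert (eV.symm v), fun h => g.1.rep.graph.line (eD.symm h),
      fun h => eV (g.1.rep.graph.root (eD.symm h)), fun h => eD (g.1.rep.graph.link (eD.symm h)),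
      g.1.res)
  refine Finite.of_injective code fun g g' h => ?_
  simp only [code, Prod.mk.injEq] at h
  obtain ⟨h1, h2, h3, h4, h5⟩ := h
  refine Subtype.ext ?_
  rw [← g.1.mk_rep, ← g'.1.mk_rep, Gen.mk_eq_mk]
  refine ⟨h5, ⟨⟨(Finite.equivFinOfCardEq g.2.1).trans (Finite.equivFinOfCardEq g'.2.1).symm,
    (Finite.equivFinOfCardEq g.2.2).trans (Finite.equivFinOfCardEq g'.2.2).symm,
    fun v => ?_, fun d => ?_, fun d => ?_, fun d => ?_⟩⟩⟩
  · simpa using (congrFun h1 (Finite.equivFinOfCardEq g.2.1 v)).symm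
  · simpa using (congrFun h2 (Finite.equivFinOfCardEq g.2.2 d)).symm
  · simpa [Equiv.eq_symm_apply] using (congrFun h3 (Finite.equivFinOfCardEq g.2.2 d)).symm
  · simpa [Equiv.eq_symm_apply] using (congrFun h4 (Finite.equivFinOfCardEq g.2.2 d)).symm

theorem FGraph.card_D_eq (Γ : FGraph) : Nat.card Γ.D = ∑ w, Γ.numV w * w.valence := by
  rw [← Nat.card_congr (Equiv.sigmaFiberEquiv Γ.line), Nat.card_sigma]
  simp only [FGraph.card_line, Vertex.valence, Finset.mul_sum]
  exact Finset.sum_comm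

/-- There are finitely many generators of a given multidegree. -/
theorem Gen.finite_of_deg (n : Vertex → ℤ) : {g : Gen | g.deg = n}.Finite := by
  have : Finite Res := Res.finite
  let S : Set (ℕ × ℕ) := Set.range fun r : Res =>
    (∑ w, (n w + if r = .vertex w then 1 else 0).toNat,
      ∑ w, (n w + if r = .vertex w then 1 else 0).toNat * w.valence)
  refine ((Set.finite_range _ : S.Finite).biUnion fun p _ =>
    Gen.finite_of_card p.1 p.2).subset fun g hg => ?_
  have h : ∀ w, g.rep.graph.numV w = (n w + if g.res = .vertex w then 1 else 0).toNat := by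
    intro w
    have := congrFun hg w
    rw [Gen.deg_eq, FGraph.degree] at this
    omega
  simp only [Set.mem_iUnion]
  refine ⟨_, ⟨g.res, rfl⟩, ?_, ?_⟩
  · rw [FGraph.card_V_eq]; simp only [h]
  · rw [FGraph.card_D_eq]; simp only [h]


/-! ### Counting label preserving bijections -/

theorem exists_labelled_equiv {X Y I : Type*} [Finite X] [Finite Y] (a : X → I) (b : Y → I)
    (h : ∀ i, Nat.card {x // a x = i} = Nat.card {y // b y = i}) :
    ∃ e : X ≃ Y, ∀ x, b (e x) = a x := by
  have e : ∀ i, Nonempty ({x // a x = i} ≃ {y // b y = i}) := fun i => Finite.card_eq.1 (h i)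
  exact ⟨(Equiv.sigmaFiberEquiv a).symm.trans ((Equiv.sigmaCongrRight fun i => (e i).some).trans
    (Equiv.sigmaFiberEquiv b)), fun x => ((e (a x)).some ⟨x, rfl⟩).2⟩

/-- Composing with one fixed bijection turns the others into the label preserving permutations of
`X`, a product of symmetric groups. -/
theorem card_labelled_equiv {X Y I : Type*} [Finite X] [Finite Y] [Fintype I]
    (a : X → I) (b : Y → I) (h : ∀ i, Nat.card {x // a x = i} = Nat.card {y // b y = i}) :
    Nat.card {e : X ≃ Y // ∀ x, b (e x) = a x} = ∏ i, (Nat.card {x // a x = i}).factorial := by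
  classical
  have := Fintype.ofFinite X
  obtain ⟨e₀, he⟩ := exists_labelled_equiv a b h
  have h1 : {e : X ≃ Y // ∀ x, b (e x) = a x} ≃ {g : Equiv.Perm X // a ∘ g = a} :=
    { toFun := fun e => ⟨e.1.trans e₀.symm, by
        funext x
        have := he (e₀.symm (e.1 x))
        rw [Equiv.apply_symm_apply, e.2] at this
        exact this.symm⟩
      invFun := fun g => ⟨g.1.trans e₀, fun x => by
        rw [Equiv.trans_apply, he]; exact congrFun g.2 x⟩
      left_inv := fun _ => by ext; simp
      right_inv := fun _ => by ext; simp }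
  rw [Nat.card_congr h1, Nat.card_eq_fintype_card, DomMulAct.stabilizer_card]
  simp only [Nat.card_eq_fintype_card]

namespace FGraph

/-! ### Symmetry factors -/

theorem card_iso_eq {Γ Γ' : FGraph} (φ : Iso Γ Γ') :
    Nat.card (Iso Γ Γ') = Nat.card (Iso Γ Γ) :=
  Nat.card_congr ⟨fun ψ => ψ.trans φ.symm, fun ψ => ψ.trans φ,
    fun _ => Iso.ext_onD (fun _ => by simp [Iso.trans, Iso.symm])
      (fun _ => by simp [Iso.trans, Iso.symm]),
    fun _ => Iso.ext_onD (fun _ => by simp [Iso.trans, Iso.symm])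
      (fun _ => by simp [Iso.trans, Iso.symm])⟩

theorem card_iso_pos (Γ : FGraph) : 0 < Nat.card (Iso Γ Γ) :=
  have : Nonempty (Iso Γ Γ) := ⟨.refl Γ⟩
  Nat.card_pos

/-- The permutation of the external lines given by an isomorphism. -/
def Iso.ext {Γ Γ' : FGraph} (φ : Iso Γ Γ') :
    {h : Γ.D // Γ.link h = h} ≃ {h : Γ'.D // Γ'.link h = h} :=
  φ.onD.subtypeEquiv fun h => (φ.link_eq_self_iff h).symm

/-- The action of the isomorphisms on labellings of the external lines. -/
def Iso.act {Γ : FGraph} (φ : Iso Γ Γ) {r : Res} (a : Labelling Γ r) : Labelling Γ r :=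
  ⟨φ.ext.symm.trans a.1, fun h => by
    rw [Equiv.trans_apply, a.2, ← φ.line_eq]
    exact congrArg Γ.line (congrArg Subtype.val (φ.ext.apply_symm_apply h))⟩

theorem labelling_rel_iff {Γ : FGraph} {r : Res} {a b : Labelling Γ r} :
    labellingSetoid Γ r a b ↔ ∃ φ : Iso Γ Γ, φ.act a = b := by
  refine exists_congr fun φ => ⟨fun h => ?_, ?_⟩
  · refine Subtype.ext (Equiv.ext fun h' => ?_)
    exact (h (φ.ext.symm h') h' (congrArg Subtype.val (φ.ext.apply_symm_apply h'))).symm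
  · rintro rfl h h' hh
    have : h' = φ.ext h := Subtype.ext hh.symm
    rw [this]
    simp [Iso.act]

instance (Γ : FGraph) (r : Res) : Finite (Labelling Γ r) :=
  inferInstanceAs (Finite {e : {h : Γ.D // Γ.link h = h} ≃ (Σ i : Line, Fin (r.legs i)) // _})

/-- Orbit-stabiliser: an automorphism preserves a labelling exactly when it fixes every external
line. -/
theorem card_labelling_class {Γ : FGraph} {r : Res} (a : Labelling Γ r) :
    Nat.card {b // labellingSetoid Γ r a b} * symFactor Γ = Nat.card (Iso Γ Γ) := by
  have := Fintype.ofFinite {b // labellingSetoid Γ r a b}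
  let f : Iso Γ Γ → {b // labellingSetoid Γ r a b} := fun φ => ⟨φ.act a, labelling_rel_iff.2 ⟨φ, rfl⟩⟩
  rw [← Nat.card_congr (Equiv.sigmaFiberEquiv f), Nat.card_sigma,
    Finset.sum_congr rfl (g := fun _ => symFactor Γ), Finset.sum_const, Finset.card_univ,
    smul_eq_mul, Nat.card_eq_fintype_card]
  rintro ⟨b, hb⟩ -
  obtain ⟨φ₀, h₀⟩ := labelling_rel_iff.1 hb
  -- The fibre over `b` is thus a coset of the group counted by `symFactor`.
  have key : ∀ φ : Iso Γ Γ, f φ = ⟨b, hb⟩ ↔ ∀ h, Γ.link h = h → φ.onD h = φ₀.onD h := by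
    intro φ
    rw [Subtype.mk.injEq, ← h₀]
    constructor
    · intro h1 h hh
      have h2 : (φ.act a).1 (φ.ext ⟨h, hh⟩) = (φ₀.act a).1 (φ.ext ⟨h, hh⟩) := by rw [h1]
      simp only [Iso.act, Equiv.trans_apply, Equiv.symm_apply_apply] at h2
      have h3 := congrArg φ₀.ext (a.1.injective h2)
      rw [Equiv.apply_symm_apply] at h3
      exact (congrArg Subtype.val h3).symm
    · intro h1
      have : φ.ext = φ₀.ext := Equiv.ext fun h => Subtype.ext (h1 h.1 h.2)
      exact Subtype.ext (by simp [Iso.act, this])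
  refine Nat.card_congr ⟨fun φ => ⟨φ.1.trans φ₀.symm, fun h hh => ?_⟩,
    fun φ => ⟨φ.1.trans φ₀, (key _).2 fun h hh => ?_⟩, fun φ => ?_, fun φ => ?_⟩
  · have := (key φ.1).1 φ.2 h hh
    simp [Iso.trans, Iso.symm, this]
  · simp [Iso.trans, φ.2 h hh]
  · exact Subtype.ext (Iso.ext_onD (fun _ => by simp [Iso.trans, Iso.symm])
      (fun _ => by simp [Iso.trans, Iso.symm]))
  · exact Subtype.ext (Iso.ext_onD (fun _ => by simp [Iso.trans, Iso.symm])
      (fun _ => by simp [Iso.trans, Iso.symm]))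

end FGraph

/-- The number of kind preserving permutations of the lines of `r`. -/
def Res.perms (r : Res) : ℕ := ∏ i, (r.legs i).factorial

theorem Res.perms_pos (r : Res) : 0 < r.perms := Finset.prod_pos fun _ _ => Nat.factorial_pos _

namespace FGraph

theorem card_labelling {Γ : FGraph} {r : Res} (h : Γ.HasRes r) :
    Nat.card (Labelling Γ r) = r.perms := by
  have h1 : ∀ i, Nat.card {x : {h : Γ.D // Γ.link h = h} // Γ.line x.1 = i} = r.legs i := by
    intro i
    rw [← h i]
    exact Nat.card_congr (Equiv.subtypeSubtypeEquivSubtypeInter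
      (fun h => Γ.link h = h) fun h => Γ.line h = i)
  have := card_labelled_equiv (fun x : {h : Γ.D // Γ.link h = h} => Γ.line x.1)
    (fun y : Σ i : Line, Fin (r.legs i) => y.1) fun i => by
      rw [h1, Nat.card_congr (Equiv.sigmaSubtype i), Nat.card_fin]
  simp only [h1] at this
  exact this

end FGraph

theorem Gen.hasRes (g : Gen) : g.rep.graph.HasRes g.res := g.rep.hasRes

/-- There are `perms` labellings in all, and each orbit has |Aut| / Sym elements. In this form the
weight no longer refers to labels, and sums over graphs become sums over structures divided by
automorphisms. -/
theorem weight_eq (g : Gen) :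
    weight g = (g.res.perms : ℂ) / Nat.card (FGraph.Iso g.rep.graph g.rep.graph) := by
  set Γ := g.rep.graph
  set Q := Quotient (labellingSetoid Γ g.res) with hQ
  have : Finite Q := inferInstanceAs (Finite (Quotient _))
  have := Fintype.ofFinite Q
  have h0 := FGraph.card_iso_pos Γ
  have h1 : g.res.perms * symFactor Γ = Nat.card Q * Nat.card (FGraph.Iso Γ Γ) := by
    rw [← FGraph.card_labelling g.hasRes,
      ← Nat.card_congr (Equiv.sigmaFiberEquiv (Quotient.mk (labellingSetoid Γ g.res))),
      Nat.card_sigma, Finset.sum_mul, Finset.sum_congr rfl, Finset.sum_const, Finset.card_univ,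
      smul_eq_mul, Nat.card_eq_fintype_card (α := Q)]
    intro q _
    obtain ⟨a, rfl⟩ := Quotient.exists_rep q
    rw [← FGraph.card_labelling_class a]
    congr 1
    exact Nat.card_congr (Equiv.subtypeEquivRight fun b => by
      rw [Quotient.eq]; exact ⟨(labellingSetoid Γ g.res).symm, (labellingSetoid Γ g.res).symm⟩)
  have h2 : symFactor Γ ≠ 0 := by
    intro h2
    rw [h2, mul_zero, eq_comm, mul_eq_zero] at h1
    have : Nonempty (Labelling Γ g.res) := by
      by_contra h
      have := FGraph.card_labelling g.hasRes
      rw [Nat.card_eq_zero.2 (.inl (not_nonempty_iff.1 h))] at this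
      exact g.res.perms_pos.ne this
    have : Nonempty Q := this.map (Quotient.mk _)
    have : 0 < Nat.card Q := Nat.card_pos
    omega
  rw [weight, div_eq_div_iff (by exact_mod_cast h2) (by exact_mod_cast h0.ne')]
  exact_mod_cast h1.symm

/-! ### Pieces: 1PI graphs and single vertices -/

namespace FGraph

/-- `Γ` is a single vertex of type `v` all of whose half-lines are external. -/
def IsStar (Γ : FGraph) (v : Vertex) : Prop :=
  Nat.card Γ.V = 1 ∧ (∀ w, Γ.vert w = v) ∧ ∀ h, Γ.link h = h

/-- With one vertex and no gluing, an isomorphism is just a kind preserving bijection of the legs.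
The count makes the weight of a bare vertex equal to 1. -/
theorem card_iso_of_isStar {Γ Γ' : FGraph} {v : Vertex} (h : Γ.IsStar v) (h' : Γ'.IsStar v) :
    Nat.card (Iso Γ Γ') = (Res.vertex v).perms := by
  have key : ∀ {Γ : FGraph}, Γ.IsStar v → ∀ i, Nat.card {h : Γ.D // Γ.line h = i} = v.legs i := by
    intro Γ h i
    obtain ⟨_, ⟨w⟩⟩ := Nat.card_eq_one_iff_unique.1 h.1
    rw [← h.2.1 w, ← Γ.legs_eq w]
    exact Nat.card_congr (Equiv.subtypeEquivRight fun _ => by simp [eq_iff_true_of_subsingleton])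
  obtain ⟨_, ⟨w⟩⟩ := Nat.card_eq_one_iff_unique.1 h.1
  obtain ⟨_, ⟨w'⟩⟩ := Nat.card_eq_one_iff_unique.1 h'.1
  have h2 := card_labelled_equiv Γ.line Γ'.line fun i => by rw [key h, key h']
  simp only [key h] at h2
  rw [Res.perms]
  refine (Nat.card_congr ?_).trans h2
  exact
    { toFun := fun φ => ⟨φ.onD, φ.line_eq⟩
      invFun := fun e => ⟨⟨fun _ => w', fun _ => w, fun _ => Subsingleton.elim _ _,
        fun _ => Subsingleton.elim _ _⟩, e.1, fun _ => by rw [h.2.1, h'.2.1], e.2,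
        fun _ => Subsingleton.elim _ _, fun _ => by rw [h.2.2, h'.2.2]⟩
      left_inv := fun φ => Iso.ext_onD (fun _ => Subsingleton.elim _ _) fun _ => rfl
      right_inv := fun _ => rfl }

theorem IsStar.not_isOnePI {Γ : FGraph} {v : Vertex} (h : Γ.IsStar v) : ¬ Γ.IsOnePI := fun h' =>
  let ⟨k, hk⟩ := h'.exists_edge
  hk (h.2.2 k)

theorem IsStar.hasRes {Γ : FGraph} {v : Vertex} (h : Γ.IsStar v) : Γ.HasRes (.vertex v) := by
  intro i
  obtain ⟨_, ⟨w⟩⟩ := Nat.card_eq_one_iff_unique.1 h.1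
  rw [Res.legs, ← h.2.1 w, ← Γ.legs_eq w]
  exact Nat.card_congr (Equiv.subtypeEquivRight fun _ => by
    simp [eq_iff_true_of_subsingleton, h.2.2])

/-- The graph consisting of a single vertex. -/
def star (v : Vertex) : FGraph where
  V := Unit
  D := Σ i : Line, Fin (v.legs i)
  finV := inferInstance
  finD := inferInstance
  vert _ := v
  line h := h.1
  root _ := ()
  legs_eq _ i := by
    simp only [true_and]
    rw [Nat.card_congr (Equiv.sigmaSubtype i), Nat.card_fin]
  link h := h
  link_link _ := rfl
  line_link _ := rfl

theorem star_isStar (v : Vertex) : (star v).IsStar v :=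
  ⟨Nat.card_unique (α := Unit), fun _ => rfl, fun _ => rfl⟩

/-- `Γ` is a 1PI graph with residue `r` or a single vertex `r`. -/
def IsPiece (Γ : FGraph) (r : Res) : Prop :=
  (Γ.IsOnePI ∧ Γ.HasRes r) ∨ ∃ v, r = .vertex v ∧ Γ.IsStar v

/-- The class of a 1PI graph with residue `r`; `none` for other graphs. -/
noncomputable def pieceType (Γ : FGraph) (r : Res) : Option Gen := by
  classical
  exact if H : Γ.IsOnePI ∧ Γ.HasRes r then some (Gen.mk ⟨Γ, r, H.1, H.2⟩) else none

/-- A graph of the given type. -/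
noncomputable def pieceGraph : Res → Option Gen → FGraph
  | _, some g => g.rep.graph
  | .vertex v, none => star v
  | .edge _, none => star .mass

theorem pieceType_of_onePI {Γ : FGraph} {r : Res} (h : Γ.IsOnePI) (h' : Γ.HasRes r) :
    pieceType Γ r = some (Gen.mk ⟨Γ, r, h, h'⟩) := dif_pos ⟨h, h'⟩

theorem pieceType_of_not_onePI {Γ : FGraph} {r : Res} (h : ¬ Γ.IsOnePI) :
    pieceType Γ r = none := dif_neg fun h' => h h'.1

/-- The types of pieces that may have residue `r`. -/
def Admissible (r : Res) : Option Gen → Prop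
  | some g => g.res = r
  | none => r.IsVertex

theorem isPiece_pieceGraph {r : Res} {t : Option Gen} (h : Admissible r t) :
    (pieceGraph r t).IsPiece r := by
  rcases t with _ | g
  · rcases r with v | e
    · exact .inr ⟨v, rfl, star_isStar v⟩
    · exact h.elim
  · obtain rfl : g.res = r := h
    exact .inl ⟨g.rep.onePI, g.hasRes⟩

theorem IsPiece.admissible {Γ : FGraph} {r : Res} (h : Γ.IsPiece r) :
    Admissible r (pieceType Γ r) := by
  rcases h with h | ⟨v, rfl, h⟩
  · rw [pieceType_of_onePI h.1 h.2]; exact Gen.res_mk _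
  · rw [pieceType_of_not_onePI h.not_isOnePI]; exact trivial

theorem IsPiece.nonempty_iso {Γ : FGraph} {r : Res} (h : Γ.IsPiece r) :
    Nonempty (Iso (pieceGraph r (pieceType Γ r)) Γ) := by
  rcases h with h | ⟨v, rfl, h⟩
  · rw [pieceType_of_onePI h.1 h.2]
    exact ((Gen.mk_eq_iff (X := ⟨Γ, r, h.1, h.2⟩)).1 rfl).2.map Iso.symm
  · rw [pieceType_of_not_onePI h.not_isOnePI]
    have := card_iso_of_isStar (star_isStar v) h
    exact (Nat.card_ne_zero.1 (this.trans_ne (Res.perms_pos _).ne')).1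

theorem pieceType_iso {Γ Γ' : FGraph} (φ : Iso Γ Γ') (r : Res) :
    pieceType Γ r = pieceType Γ' r := by
  by_cases h : Γ.IsOnePI ∧ Γ.HasRes r
  · rw [pieceType_of_onePI h.1 h.2, pieceType_of_onePI (h.1.of_iso φ) (h.2.of_iso φ)]
    exact congrArg some (Gen.mk_eq_mk.2 ⟨rfl, ⟨φ⟩⟩)
  · have h' : ¬ (Γ'.IsOnePI ∧ Γ'.HasRes r) := fun h' =>
      h ⟨h'.1.of_iso φ.symm, h'.2.of_iso φ.symm⟩
    rw [pieceType, pieceType, dif_neg h, dif_neg h']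

theorem pieceType_pieceGraph {r : Res} {t : Option Gen} (h : Admissible r t) :
    pieceType (pieceGraph r t) r = t := by
  rcases t with _ | g
  · rcases r with v | e
    · exact pieceType_of_not_onePI (star_isStar v).not_isOnePI
    · exact h.elim
  · obtain rfl : g.res = r := h
    exact (pieceType_of_onePI g.rep.onePI g.hasRes).trans (congrArg some g.mk_rep)

-- Isomorphisms onto a given piece form a torsor under the automorphisms of the model as soon as one
-- exists, and the type decides existence.
open Classical in
theorem card_iso_pieceGraph {Γ : FGraph} {r : Res} {t : Option Gen} (h : Admissible r t)
    (h' : Γ.IsPiece r) : Nat.card (Iso (pieceGraph r t) Γ) =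
      if pieceType Γ r = t then Nat.card (Iso (pieceGraph r t) (pieceGraph r t)) else 0 := by
  split_ifs with ht
  · subst ht
    exact card_iso_eq h'.nonempty_iso.some
  · rw [Nat.card_eq_zero]
    refine .inl ⟨fun φ => ht ?_⟩
    rw [← pieceType_iso φ, pieceType_pieceGraph h]

theorem IsPiece.hasRes {Γ : FGraph} {r : Res} (h : Γ.IsPiece r) : Γ.HasRes r := by
  rcases h with h | ⟨v, rfl, h⟩
  · exact h.2
  · exact h.hasRes

theorem IsPiece.connected {Γ : FGraph} {r : Res} (h : Γ.IsPiece r) : Γ.Connected := by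
  rcases h with h | ⟨v, rfl, h⟩
  · exact h.1.1
  · obtain ⟨_, hw⟩ := Nat.card_eq_one_iff_unique.1 h.1
    exact ⟨hw, fun v w => reach_iff.2 fun U _ => by rw [Subsingleton.elim v w]⟩

end FGraph

open FGraph in
open Classical in
/-- The weight of a piece: the coefficient of a generator, or of the empty graph, in `G^r`
for a vertex `r`, and in `1 - G^r` for an edge `r`. -/
noncomputable def pieceWeight (r : Res) (t : Option Gen) : ℂ :=
  if Admissible r t then (r.perms : ℂ) / Nat.card (Iso (pieceGraph r t) (pieceGraph r t)) else 0

open Classical in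
theorem pieceWeight_some (r : Res) (g : Gen) :
    pieceWeight r (some g) = if g.res = r then weight g else 0 := by
  rw [weight_eq]
  by_cases h : g.res = r
  · rw [if_pos h, h]; exact if_pos h
  · rw [if_neg h]; exact if_neg h

theorem pieceWeight_none_vertex (v : Vertex) : pieceWeight (.vertex v) none = 1 := by
  refine (if_pos trivial).trans ?_
  have := FGraph.card_iso_of_isStar (FGraph.star_isStar v) (FGraph.star_isStar v)
  rw [FGraph.pieceGraph, this]
  exact div_self (by exact_mod_cast (Res.perms_pos _).ne')

/-- An edge slot is never left empty: an edge without insertion is an edge with zero beads, not a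
bead with nothing in it. -/
theorem pieceWeight_none_edge (e : Line) : pieceWeight (.edge e) none = 0 := if_neg id

open FGraph

/-! ### Skeletons -/

/-- A graph whose vertices ("slots") are of any type in `R`, including edges, viewed as two-valent
vertices. -/
structure Skel where
  S : Type
  P : Type
  finS : Finite S
  finP : Finite P
  res : S → Res
  line : P → Line
  root : P → S
  legs_eq : ∀ s i, Nat.card {p : P // root p = s ∧ line p = i} = (res s).legs i
  link : P → P
  link_link : ∀ p, link (link p) = p
  line_link : ∀ p, line (link p) = line p

namespace Skel

attribute [instance] Skel.finS Skel.finP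

/-- Isomorphisms of skeletons. -/
structure Iso (K K' : Skel) where
  onS : K.S ≃ K'.S
  onP : K.P ≃ K'.P
  res_eq : ∀ s, K'.res (onS s) = K.res s
  line_eq : ∀ p, K'.line (onP p) = K.line p
  root_eq : ∀ p, K'.root (onP p) = onS (K.root p)
  link_eq : ∀ p, K'.link (onP p) = onP (K.link p)

theorem Iso.ext_on {K K' : Skel} {φ ψ : Iso K K'} (hS : ∀ s, φ.onS s = ψ.onS s)
    (hP : ∀ p, φ.onP p = ψ.onP p) : φ = ψ := by
  cases φ; cases ψ
  congr
  · exact Equiv.ext hS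
  · exact Equiv.ext hP

instance (K K' : Skel) : Finite (Iso K K') :=
  Finite.of_injective (fun φ : Iso K K' => (φ.onS, φ.onP)) fun φ ψ h => by
    simp only [Prod.mk.injEq] at h
    exact Iso.ext_on (fun v => by rw [h.1]) (fun v => by rw [h.2])

theorem exists_port (K : Skel) (s : K.S) : ∃ p, K.root p = s := by
  have : ∃ i, (K.res s).legs i ≠ 0 := by
    rcases K.res s with v | e
    · cases v
      · exact ⟨.quark, by decide⟩
      · exact ⟨.ghost, by decide⟩
      · exact ⟨.gluon, by decide⟩
      · exact ⟨.gluon, by decide⟩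
      · exact ⟨.quark, by decide⟩
    · exact ⟨e, by simp [Res.legs]⟩
  obtain ⟨i, hi⟩ := this
  rw [← K.legs_eq s i] at hi
  obtain ⟨⟨h, hh⟩⟩ := (Nat.card_ne_zero.1 hi).1
  exact ⟨h, hh.1⟩

/-- The external lines of `K` are those of `r`. -/
def HasRes (K : Skel) (r : Res) : Prop :=
  ∀ i, Nat.card {p : K.P // K.link p = p ∧ K.line p = i} = r.legs i

/-- `K` has an edge, and it stays connected if one edge is cut. -/
def IsOnePI (K : Skel) : Prop := (∃ p, K.link p ≠ p) ∧
  ∀ p, K.link p ≠ p → ∀ U : K.S → Prop,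
    (∀ q, q ≠ p → q ≠ K.link p → (U (K.root q) ↔ U (K.root (K.link q)))) → ∀ s t, U s ↔ U t

/-! ### Inserting graphs into the slots of a skeleton -/

section Insert

variable (K : Skel) (γ : K.S → FGraph)

/-- The external lines of a family of graphs. -/
abbrev Ext : Type := {x : Σ s, (γ s).D // (γ x.1).link x.2 = x.2}

/-- The ways of identifying the external lines of the graphs `γ s` with the lines at the slots. -/
abbrev Gluing : Type :=
  {e : K.Ext γ ≃ K.P // ∀ x, (K.root (e x), K.line (e x)) = (x.1.1, (γ x.1.1).line x.1.2)}

variable {K γ}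

theorem Gluing.root_eq (l : K.Gluing γ) (x : K.Ext γ) : K.root (l.1 x) = x.1.1 :=
  congrArg Prod.fst (l.2 x)

theorem Gluing.line_eq (l : K.Gluing γ) (x : K.Ext γ) :
    K.line (l.1 x) = (γ x.1.1).line x.1.2 := congrArg Prod.snd (l.2 x)

/-- A gluing is a bijection preserving the pair (slot, kind). The number does not depend on the
inserted graphs, and it supplies the numerators of the piece weights. -/
theorem card_gluing (h : ∀ s, (γ s).HasRes (K.res s)) [Fintype K.S] :
    Nat.card (K.Gluing γ) = ∏ s, (K.res s).perms := by
  have h1 : ∀ q : K.S × Line, Nat.card {x : K.Ext γ // (x.1.1, (γ x.1.1).line x.1.2) = q} =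
      (K.res q.1).legs q.2 := by
    rintro ⟨s, i⟩
    rw [← h s i]
    refine (Nat.card_congr (Equiv.ofBijective (fun x => ⟨⟨⟨s, x.1⟩, x.2.1⟩, by simp [x.2.2]⟩)
      ⟨fun x y hxy => ?_, ?_⟩)).symm
    · simpa [Subtype.ext_iff] using hxy
    · rintro ⟨⟨⟨s', x⟩, hx⟩, hx'⟩
      simp only [Prod.mk.injEq] at hx'
      obtain ⟨rfl, h2⟩ := hx'
      exact ⟨⟨x, hx, h2⟩, rfl⟩
  have := card_labelled_equiv (fun x : K.Ext γ => (x.1.1, (γ x.1.1).line x.1.2))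
    (fun p : K.P => (K.root p, K.line p)) fun q => by
      rw [h1, ← K.legs_eq]
      exact Nat.card_congr (Equiv.subtypeEquivRight fun p => by rw [Prod.ext_iff])
  simp only [h1] at this
  rw [Gluing, this, Fintype.prod_prod_type]
  rfl

open Classical in
/-- The gluing of the half-lines after insertion. -/
noncomputable def insertLink (l : K.Gluing γ) (x : Σ s, (γ s).D) : Σ s, (γ s).D :=
  if hx : (γ x.1).link x.2 = x.2 then (l.1.symm (K.link (l.1 ⟨x, hx⟩))).1
  else ⟨x.1, (γ x.1).link x.2⟩

theorem insertLink_ext (l : K.Gluing γ) (x : K.Ext γ) :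
    insertLink l x.1 = (l.1.symm (K.link (l.1 x))).1 := dif_pos x.2

theorem insertLink_int (l : K.Gluing γ) {s : K.S} {d : (γ s).D} (hd : (γ s).link d ≠ d) :
    insertLink l ⟨s, d⟩ = ⟨s, (γ s).link d⟩ := dif_neg hd

theorem insertLink_symm (l : K.Gluing γ) (p : K.P) :
    insertLink l (l.1.symm p).1 = (l.1.symm (K.link p)).1 := by
  rw [insertLink_ext, Equiv.apply_symm_apply]

/-- The graph obtained by inserting the graphs `γ s` into the slots of `K`. -/
noncomputable abbrev insert (l : K.Gluing γ) : FGraph where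
  V := Σ s, (γ s).V
  D := Σ s, (γ s).D
  finV := inferInstance
  finD := inferInstance
  vert x := (γ x.1).vert x.2
  line x := (γ x.1).line x.2
  root x := ⟨x.1, (γ x.1).root x.2⟩
  legs_eq := by
    rintro ⟨s, v⟩ i
    rw [← (γ s).legs_eq v i]
    refine (Nat.card_congr (Equiv.ofBijective (fun x => ⟨⟨s, x.1⟩, by rw [x.2.1], x.2.2⟩)
      ⟨fun x y hxy => ?_, ?_⟩)).symm
    · simpa [Subtype.ext_iff] using hxy
    · rintro ⟨⟨s', x⟩, h1, h2⟩
      cases h1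
      exact ⟨⟨x, rfl, h2⟩, rfl⟩
  link := insertLink l
  link_link := by
    rintro ⟨s, d⟩
    by_cases hd : (γ s).link d = d
    · rw [insertLink_ext l ⟨⟨s, d⟩, hd⟩, insertLink_symm, K.link_link, Equiv.symm_apply_apply]
    · rw [insertLink_int l hd, insertLink_int l, (γ s).link_link]
      rw [(γ s).link_link]; exact fun h => hd h.symm
  line_link := by
    rintro ⟨s, d⟩
    by_cases hd : (γ s).link d = d
    · rw [insertLink_ext l ⟨⟨s, d⟩, hd⟩, ← l.line_eq, Equiv.apply_symm_apply, K.line_link, l.line_eq]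
    · rw [insertLink_int l hd, (γ s).line_link]

theorem insert_link_eq_self_iff (l : K.Gluing γ) (p : K.P) :
    insertLink l (l.1.symm p).1 = (l.1.symm p).1 ↔ K.link p = p := by
  rw [insertLink_symm, Subtype.coe_inj, l.1.symm.apply_eq_iff_eq]

theorem insert_hasRes (l : K.Gluing γ) {r : Res} (hK : K.HasRes r) : (insert l).HasRes r := by
  intro i
  rw [← hK i]
  have hl : ∀ p, (insert l).line (l.1.symm p).1 = K.line p := fun p => by
    rw [← l.line_eq, Equiv.apply_symm_apply]
  refine (Nat.card_congr (Equiv.ofBijective (fun p : {p // K.link p = p ∧ K.line p = i} =>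
    (⟨(l.1.symm p.1).1, (insert_link_eq_self_iff l p.1).2 p.2.1, (hl p.1).trans p.2.2⟩ :
      {x // (insert l).link x = x ∧ (insert l).line x = i})) ⟨fun p q h => ?_, ?_⟩)).symm
  · have h' := congrArg (fun z => z.1) h
    exact Subtype.ext (l.1.symm.injective (Subtype.ext h'))
  · rintro ⟨⟨s, d⟩, h1, h2⟩
    have hd : (γ s).link d = d := by
      by_contra hd
      have h3 := (insertLink_int l hd).symm.trans h1
      simp only [Sigma.mk.injEq, heq_eq_eq, true_and] at h3
      exact hd h3
    refine ⟨⟨l.1 ⟨⟨s, d⟩, hd⟩, ?_, (l.line_eq _).trans h2⟩, Subtype.ext (by simp)⟩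
    rw [← insert_link_eq_self_iff l, Equiv.symm_apply_apply]; exact h1

/-- The cut edge lies either inside one piece or in the skeleton. In both cases every piece stays
connected, and so does the skeleton; a predicate respecting the remaining edges is therefore
constant on pieces and descends to the slots. -/
theorem insert_isOnePI (l : K.Gluing γ) (hK : K.IsOnePI) (hγ : ∀ s, (γ s).IsPiece (K.res s)) :
    (insert l).IsOnePI := by
  rw [isOnePI_iff]
  constructor
  · obtain ⟨p, hp⟩ := hK.1
    exact ⟨(l.1.symm p).1, (insert_link_eq_self_iff l p).not.2 hp⟩
  · rintro ⟨s₀, d₀⟩ hd₀ U hU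
    -- `U` is constant on the pieces
    have h1 : ∀ s v w, U ⟨s, v⟩ ↔ U ⟨s, w⟩ := by
      intro s v w
      by_cases hs : ∃ d, (⟨s, d⟩ : Σ s, (γ s).D) = ⟨s₀, d₀⟩ ∧ (γ s).link d ≠ d
      · obtain ⟨d, hd, hdi⟩ := hs
        obtain rfl : s = s₀ := congrArg Sigma.fst hd
        obtain rfl : d = d₀ := eq_of_heq (Sigma.mk.inj hd).2
        have h1 : (γ s).IsOnePI := by
          rcases hγ s with h | ⟨v, -, h⟩
          · exact h.1
          · exact absurd (h.2.2 d) hdi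
        refine (isOnePI_iff.1 h1).2 d hdi (fun v => U ⟨s, v⟩) (fun h h2 h3 => ?_) v w
        by_cases hh : (γ s).link h = h
        · rw [hh]
        · have := hU ⟨s, h⟩ (fun h4 => h2 (eq_of_heq (Sigma.mk.inj h4).2)) (fun h4 => h3 ?_)
          · have h5 : (insert l).link ⟨s, h⟩ = ⟨s, (γ s).link h⟩ := insertLink_int l hh
            rwa [h5] at this
          · have h5 : (insert l).link ⟨s, d⟩ = ⟨s, (γ s).link d⟩ := insertLink_int l hdi
            rw [h5] at h4
            exact eq_of_heq (Sigma.mk.inj h4).2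
      · refine reach_iff.1 ((hγ s).connected.2 v w) (fun v => U ⟨s, v⟩) fun h _ => ?_
        by_cases hh : (γ s).link h = h
        · rw [hh]
        · have h5 : (insert l).link ⟨s, h⟩ = ⟨s, (γ s).link h⟩ := insertLink_int l hh
          have := hU ⟨s, h⟩ (fun h4 => hs ⟨h, h4, hh⟩) (fun h4 => hs ⟨(γ s).link h, h5.symm.trans
            ((congrArg (insert l).link h4).trans ((insert l).link_link _)), ?_⟩)
          · rwa [h5] at this
          · rw [(γ s).link_link]; exact fun h => hh h.symm
    have hn : ∀ s, Nonempty (γ s).V := fun s => (hγ s).connected.1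
    let U' : K.S → Prop := fun s => U ⟨s, (hn s).some⟩
    have h2 : ∀ s v, U ⟨s, v⟩ ↔ U' s := fun s v => h1 s v _
    have h3 : ∀ p, (l.1.symm p).1 ≠ ⟨s₀, d₀⟩ → (l.1.symm p).1 ≠ (insert l).link ⟨s₀, d₀⟩ →
        (U' (K.root p) ↔ U' (K.root (K.link p))) := by
      intro p ha hb
      have h4 := hU (l.1.symm p).1 ha hb
      have h5 : (insert l).link (l.1.symm p).1 = (l.1.symm (K.link p)).1 := insertLink_symm l p
      rw [h5] at h4
      have h6 : ∀ p, U ((insert l).root (l.1.symm p).1) ↔ U' (K.root p) := by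
        intro p
        refine (h2 _ _).trans ?_
        rw [← l.root_eq, Equiv.apply_symm_apply]
      rwa [h6, h6] at h4
    have h4 : ∀ s t, U' s ↔ U' t := by
      by_cases hd : (γ s₀).link d₀ = d₀
      · have hp : (l.1.symm (l.1 ⟨⟨s₀, d₀⟩, hd⟩)).1 = ⟨s₀, d₀⟩ := by rw [Equiv.symm_apply_apply]
        refine hK.2 (l.1 ⟨⟨s₀, d₀⟩, hd⟩) ?_ U' fun q ha hb => h3 q (fun h => ha ?_) fun h => hb ?_
        · rw [Ne, ← insert_link_eq_self_iff l, hp]; exact hd₀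
        · rw [← l.1.apply_symm_apply q]
          exact congrArg l.1 (Subtype.ext h)
        · have h5 : (insert l).link ⟨s₀, d₀⟩ = _ := insertLink_ext l ⟨⟨s₀, d₀⟩, hd⟩
          exact l.1.symm.injective (Subtype.ext (h.trans h5))
      · have h5 : ∀ x : K.Ext γ, ∀ d, x.1 = ⟨s₀, d⟩ → (γ s₀).link d = d := by
          rintro ⟨_, hx⟩ d rfl; exact hx
        -- The cut edge is internal to a piece, so all skeleton edges are present and an arbitrary
        -- one may be ignored.
        obtain ⟨p, hp⟩ := hK.1
        refine hK.2 p hp U' fun q _ _ => h3 q (fun h => hd (h5 _ _ h)) fun h => hd ?_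
        have h6 : (insert l).link ⟨s₀, d₀⟩ = _ := insertLink_int l hd
        have := h5 _ _ (h.trans h6)
        rw [(γ s₀).link_link] at this
        exact this.symm
    rintro ⟨s, v⟩ ⟨t, w⟩
    rw [h2, h2]
    exact h4 s t

end Insert

end Skel


/-! ### The skeleton of a contraction -/

namespace FGraph

theorem EdgeSet.link_not_mem {Γ : FGraph} (E : Γ.EdgeSet) {h : Γ.D} (hh : h ∉ E.carrier) :
    Γ.link h ∉ E.carrier := fun h1 => hh (by
  have := E.link_mem _ h1
  rwa [Γ.link_link] at this)

theorem EdgeSet.ext_carrier {Γ : FGraph} {E E' : Γ.EdgeSet} (h : E.carrier = E'.carrier) :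
    E = E' := by
  cases E; cases E'; congr

theorem cut_link_mem {Γ : FGraph} {E : Γ.EdgeSet} {h : Γ.D} (hh : h ∈ E.carrier) :
    (Γ.cut E).link h = Γ.link h := if_pos hh

theorem cut_link_not_mem {Γ : FGraph} {E : Γ.EdgeSet} {h : Γ.D} (hh : h ∉ E.carrier) :
    (Γ.cut E).link h = h := if_neg hh

theorem comp_eq_iff {Γ : FGraph} {v w : Γ.V} : Γ.comp v = Γ.comp w ↔
    ∀ U : Γ.V → Prop, (∀ h, (U (Γ.root h) ↔ U (Γ.root (Γ.link h)))) → (U v ↔ U w) := by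
  refine (Quotient.eq (r := Γ.compSetoid)).trans (reach_iff.trans ?_)
  simp only [Set.mem_univ, true_implies]

theorem comp_cut_eq_iff {Γ : FGraph} {E : Γ.EdgeSet} {v w : Γ.V} :
    (Γ.cut E).comp v = (Γ.cut E).comp w ↔ ∀ U : Γ.V → Prop,
      (∀ h ∈ E.carrier, (U (Γ.root h) ↔ U (Γ.root (Γ.link h)))) → (U v ↔ U w) := by
  refine comp_eq_iff.trans (forall_congr' fun U => imp_congr_left ?_)
  refine forall_congr' fun h => ?_
  by_cases hh : h ∈ E.carrier
  · rw [cut_link_mem hh]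
    exact ⟨fun h1 _ => h1, fun h1 => h1 hh⟩
  · rw [cut_link_not_mem hh]
    exact ⟨fun _ h1 => absurd h1 hh, fun _ => Iff.rfl⟩

theorem exists_comp (Γ : FGraph) (c : Γ.Comp) : ∃ v, Γ.comp v = c := Quotient.exists_rep c

namespace Contraction

theorem ext_res {Γ : FGraph} {κ κ' : Γ.Contraction} (h : κ.edges.carrier = κ'.edges.carrier)
    (h' : ∀ v, κ.res ((Γ.cut κ.edges).comp v) = κ'.res ((Γ.cut κ'.edges).comp v)) : κ = κ' := by
  obtain ⟨E, res, _, _, _⟩ := κ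
  obtain ⟨E', res', _, _, _⟩ := κ'
  obtain rfl : E = E' := EdgeSet.ext_carrier h
  obtain rfl : res = res' := funext fun c => by
    obtain ⟨v, rfl⟩ := exists_comp _ c
    exact h' v
  rfl

instance (Γ : FGraph) : Finite Γ.Contraction := by
  have := Res.finite
  exact Finite.of_injective
    (fun κ : Γ.Contraction => (κ.edges.carrier, fun v : Γ.V => κ.res ((Γ.cut κ.edges).comp v)))
    fun κ κ' h => ext_res (congrArg Prod.fst h) fun v => congrFun (congrArg Prod.snd h) v

variable {Γ : FGraph} (κ : Γ.Contraction)

/-- A connected component of the subgraph or a single vertex. -/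
noncomputable abbrev part (c : (Γ.cut κ.edges).Comp) : FGraph := (Γ.cut κ.edges).component c

/-- A component that meets no edge of the subgraph cannot contain a second vertex; `res_single` then
forces its residue to be its own type. -/
theorem isPiece (c : (Γ.cut κ.edges).Comp) : (κ.part c).IsPiece (κ.res c) := by
  obtain ⟨v, hv⟩ := exists_comp _ c
  by_cases H : ∃ h ∈ κ.edges.carrier, κ.compOf h = c
  · obtain ⟨h, hh, rfl⟩ := H
    exact .inl ⟨κ.onePI h hh, κ.hasRes _⟩
  · push Not at H
    have h1 : ∀ h ∈ κ.edges.carrier, Γ.root h ≠ v := fun h hh hr => H h hh (by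
      rw [← hv, ← hr]; rfl)
    have h2 : ∀ w, (Γ.cut κ.edges).comp w = c → w = v := by
      intro w hw
      rw [← hv] at hw
      refine (comp_cut_eq_iff.1 hw (fun x => x = v) fun h hh => ?_).2 rfl
      exact iff_of_false (h1 h hh) (h1 _ (κ.edges.link_mem h hh))
    refine .inr ⟨Γ.vert v, hv ▸ κ.res_single v h1, ?_, fun w => ?_, fun h => Subtype.ext ?_⟩
    · exact Nat.card_eq_one_iff_unique.2
        ⟨⟨fun a b => Subtype.ext ((h2 a.1 a.2).trans (h2 b.1 b.2).symm)⟩, ⟨⟨v, hv⟩⟩⟩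
    · exact congrArg Γ.vert (h2 w.1 w.2)
    · exact cut_link_not_mem fun hh => H h.1 hh h.2

/-- The type of a component: `none` for a single vertex. -/
noncomputable def type (c : (Γ.cut κ.edges).Comp) : Option Gen := pieceType (κ.part c) (κ.res c)

/-- The graph with the same half-lines as the quotient, except that the components with an edge as
residue are not removed. -/
noncomputable def skel : Skel where
  S := (Γ.cut κ.edges).Comp
  P := {h : Γ.D // h ∉ κ.edges.carrier}
  finS := inferInstance
  finP := inferInstance
  res := κ.res
  line h := Γ.line h.1
  root h := κ.compOf h.1
  legs_eq c i := by
    rw [← κ.hasRes c i]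
    exact Nat.card_congr
      ⟨fun h => ⟨⟨h.1.1, h.2.1⟩, Subtype.ext (cut_link_not_mem h.1.2), h.2.2⟩,
      fun h => ⟨⟨h.1.1, (Γ.cut_link_eq_self_iff κ.edges h.1.1).1 (congrArg Subtype.val h.2.1)⟩,
        h.1.2, h.2.2⟩, fun _ => rfl, fun _ => rfl⟩
  link h := ⟨Γ.link h.1, κ.edges.link_not_mem h.2⟩
  link_link h := Subtype.ext (Γ.link_link h.1)
  line_link h := Γ.line_link h.1

end Contraction

end FGraph

namespace Skel

variable {K : Skel} {γ : K.S → FGraph} {Γ : FGraph}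

/-! ### Insertions correspond to contractions -/

section Assemble

variable {κ : Γ.Contraction} (Θ : Iso K κ.skel) (ψ : ∀ s, FGraph.Iso (γ s) (κ.part (Θ.onS s)))

/-- The vertices of `Γ`, sorted by the components of the contraction. -/
noncomputable def assembleV : (Σ s, (γ s).V) ≃ Γ.V :=
  (Equiv.sigmaCongr Θ.onS fun s => (ψ s).onV).trans
    (Equiv.sigmaFiberEquiv fun v => (Γ.cut κ.edges).comp v)

/-- The half-lines of `Γ`, sorted by the components of the contraction. -/
noncomputable def assembleD : (Σ s, (γ s).D) ≃ Γ.D :=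
  (Equiv.sigmaCongr Θ.onS fun s => (ψ s).onD).trans
    (Equiv.sigmaFiberEquiv fun h => κ.compOf h)

theorem assembleD_mem_iff (x : Σ s, (γ s).D) :
    (γ x.1).link x.2 = x.2 ↔ assembleD Θ ψ x ∉ κ.edges.carrier := by
  rw [← (ψ x.1).link_eq_self_iff, ← Γ.cut_link_eq_self_iff κ.edges]
  exact Subtype.ext_iff

theorem compOf_assembleD (x : Σ s, (γ s).D) : κ.compOf (assembleD Θ ψ x) = Θ.onS x.1 :=
  ((ψ x.1).onD x.2).2

/-- The external lines of the components are the half-lines outside the subgraph. -/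
noncomputable def assembleExt : K.Ext γ ≃ κ.skel.P :=
  (assembleD Θ ψ).subtypeEquiv (q := fun h => h ∉ κ.edges.carrier) (assembleD_mem_iff Θ ψ)

/-- The gluing of the components of the subgraph. -/
noncomputable def assembleGluing : K.Gluing γ :=
  ⟨(assembleExt Θ ψ).trans Θ.onP.symm, fun x => by
    set y := assembleExt Θ ψ x with hy
    have hy' : y.1 = assembleD Θ ψ x.1 := rfl
    refine Prod.ext (Θ.onS.injective ?_) ?_
    · rw [← Θ.root_eq, Equiv.trans_apply, ← hy, Equiv.apply_symm_apply]
      exact compOf_assembleD Θ ψ x.1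
    · rw [← Θ.line_eq, Equiv.trans_apply, ← hy, Equiv.apply_symm_apply]
      exact (ψ x.1.1).line_eq x.1.2⟩

/-- A contraction presents `Γ` as an insertion into its skeleton. -/
noncomputable def assembleIso : FGraph.Iso (insert (assembleGluing Θ ψ)) Γ where
  onV := assembleV Θ ψ
  onD := assembleD Θ ψ
  vert_eq x := (ψ x.1).vert_eq x.2
  line_eq x := (ψ x.1).line_eq x.2
  root_eq x := congrArg Subtype.val ((ψ x.1).root_eq x.2)
  link_eq := by
    rintro ⟨s, d⟩
    by_cases hd : (γ s).link d = d
    · have h1 := insertLink_ext (assembleGluing Θ ψ) ⟨⟨s, d⟩, hd⟩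
      refine Eq.trans ?_ (congrArg (assembleD Θ ψ) h1.symm)
      set x : K.Ext γ := ⟨⟨s, d⟩, hd⟩
      set y := assembleExt Θ ψ x with hy
      have h2 : (assembleGluing Θ ψ).1 x = Θ.onP.symm y := rfl
      have h3 : ∀ p, assembleD Θ ψ ((assembleGluing Θ ψ).1.symm p).1 = (Θ.onP p).1 := by
        intro p
        obtain ⟨z, rfl⟩ := (assembleGluing Θ ψ).1.surjective p
        rw [Equiv.symm_apply_apply]
        have : (assembleGluing Θ ψ).1 z = Θ.onP.symm
          (assembleExt Θ ψ z) := rfl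
        rw [this, Equiv.apply_symm_apply]
        rfl
      rw [h3, ← Θ.link_eq, h2, Equiv.apply_symm_apply]
      rfl
    · have h1 := insertLink_int (assembleGluing Θ ψ) hd
      refine Eq.trans ?_ (congrArg (assembleD Θ ψ) h1.symm)
      have h2 := congrArg Subtype.val ((ψ s).link_eq d)
      refine Eq.trans ?_ h2
      refine (cut_link_mem ?_).symm
      by_contra h3
      exact hd ((assembleD_mem_iff Θ ψ ⟨s, d⟩).2 h3)

end Assemble

theorem sigma_ext {x y : Σ l : K.Gluing γ, FGraph.Iso (insert l) Γ}
    (h1 : ∀ z, x.1.1 z = y.1.1 z) (h2 : ∀ z : Σ s, (γ s).V, x.2.onV z = y.2.onV z)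
    (h3 : ∀ z : Σ s, (γ s).D, x.2.onD z = y.2.onD z) : x = y := by
  obtain ⟨l, φ⟩ := x
  obtain ⟨l', φ'⟩ := y
  obtain rfl : l = l' := Subtype.ext (Equiv.ext h1)
  obtain rfl : φ = φ' := FGraph.Iso.ext_onD h2 h3
  rfl

/-- The map from contractions of `Γ` with given skeleton and components to insertions. -/
noncomputable def assemble
    (x : Σ κ : Γ.Contraction, Σ Θ : Iso K κ.skel, ∀ s, FGraph.Iso (γ s) (κ.part (Θ.onS s))) :
    Σ l : K.Gluing γ, FGraph.Iso (insert l) Γ :=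
  ⟨assembleGluing x.2.1 x.2.2, assembleIso x.2.1 x.2.2⟩

/-- All data can be read off from the assembled isomorphism: the edges of the subgraph are the
images of the internal half-lines of the pieces, the residues come from `K`, the slot of a component
is where its vertices come from, and the isomorphisms of the pieces are restrictions. -/
theorem assemble_injective (hγ : ∀ s, (γ s).IsPiece (K.res s)) :
    Function.Injective (assemble (K := K) (γ := γ) (Γ := Γ)) := by
  rintro ⟨κ, Θ, ψ⟩ ⟨κ', Θ', ψ'⟩ h
  have hD := congrArg (fun z : Σ l : K.Gluing γ, FGraph.Iso (insert l) Γ =>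
    show (Σ s, (γ s).D) ≃ Γ.D from z.2.onD) h
  change assembleD Θ ψ = assembleD Θ' ψ' at hD
  have hV := congrArg (fun z : Σ l : K.Gluing γ, FGraph.Iso (insert l) Γ =>
    show (Σ s, (γ s).V) ≃ Γ.V from z.2.onV) h
  change assembleV Θ ψ = assembleV Θ' ψ' at hV
  have hG : assembleGluing Θ ψ = assembleGluing Θ' ψ' := congrArg Sigma.fst h
  clear h
  obtain rfl : κ = κ' := by
    refine Contraction.ext_res ?_ fun v => ?_
    · ext h
      obtain ⟨x, rfl⟩ := (assembleD Θ ψ).surjective h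
      have h1 := assembleD_mem_iff Θ ψ x
      have h2 := assembleD_mem_iff Θ' ψ' x
      rw [← hD] at h2
      exact not_iff_not.1 (h1.symm.trans h2)
    · obtain ⟨⟨s, w⟩, hw⟩ := (assembleV Θ ψ).surjective v
      have h1 : (Γ.cut κ.edges).comp (assembleV Θ ψ ⟨s, w⟩) = Θ.onS s := ((ψ s).onV w).2
      have h2 : (Γ.cut κ'.edges).comp (assembleV Θ' ψ' ⟨s, w⟩) = Θ'.onS s := ((ψ' s).onV w).2
      rw [← hV, hw] at h2
      rw [hw] at h1
      rw [h1, h2]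
      exact (Θ.res_eq s).trans (Θ'.res_eq s).symm
  obtain rfl : Θ = Θ' := by
    refine Iso.ext_on (fun s => ?_) fun p => ?_
    · obtain ⟨w⟩ := (hγ s).connected.1
      have h1 : (Γ.cut κ.edges).comp (assembleV Θ ψ ⟨s, w⟩) = Θ.onS s := ((ψ s).onV w).2
      have h2 : (Γ.cut κ.edges).comp (assembleV Θ' ψ' ⟨s, w⟩) = Θ'.onS s := ((ψ' s).onV w).2
      rw [← hV] at h2
      exact h1.symm.trans h2
    · obtain ⟨z, rfl⟩ := (assembleGluing Θ ψ).1.surjective p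
      have h1 : (assembleGluing Θ ψ).1 z = Θ.onP.symm
          (assembleExt Θ ψ z) := rfl
      have h2 : (assembleGluing Θ' ψ').1 z = Θ'.onP.symm
          (assembleExt Θ' ψ' z) := rfl
      conv_rhs => rw [hG, h2]
      rw [h1, Equiv.apply_symm_apply, Equiv.apply_symm_apply]
      exact Subtype.ext (congrFun (congrArg DFunLike.coe hD) z.1)
  obtain rfl : ψ = ψ' := by
    funext s
    refine FGraph.Iso.ext_onD (fun v => Subtype.ext ?_) fun d => Subtype.ext ?_
    · exact congrFun (congrArg DFunLike.coe hV) ⟨s, v⟩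
    · exact congrFun (congrArg DFunLike.coe hD) ⟨s, d⟩
  rfl

/-! ### Recovering a contraction from an insertion -/

section Disassemble

variable {l : K.Gluing γ} (φ : FGraph.Iso (insert l) Γ)

/-- The half-line is internal in one of the inserted graphs. -/
def Internal (γ : K.S → FGraph) (x : Σ s, (γ s).D) : Prop := (γ x.1).link x.2 ≠ x.2

theorem internal_symm_iff (s : K.S) (d : (γ s).D) :
    Internal γ (φ.onD.symm (φ.onD ⟨s, d⟩)) ↔ (γ s).link d ≠ d := by
  have : φ.onD.symm (φ.onD ⟨s, d⟩) = ⟨s, d⟩ := φ.onD.symm_apply_apply _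
  rw [this]
  rfl

/-- The internal edges of the inserted graphs. -/
noncomputable def insertedEdges : Γ.EdgeSet where
  carrier := {h | Internal γ (φ.onD.symm h)}
  link_mem := by
    intro h
    obtain ⟨⟨s, d⟩, rfl⟩ := φ.onD.surjective h
    intro hh
    have hd := (internal_symm_iff φ s d).1 hh
    have h1 : (insert l).link ⟨s, d⟩ = _ := insertLink_int l hd
    rw [φ.link_eq, h1]
    refine (internal_symm_iff φ s _).2 ?_
    rw [(γ s).link_link]
    exact hd.symm
  internal := by
    intro h
    obtain ⟨⟨s, d⟩, rfl⟩ := φ.onD.surjective h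
    intro hh
    have hd := (internal_symm_iff φ s d).1 hh
    have h1 : (insert l).link ⟨s, d⟩ = _ := insertLink_int l hd
    rw [φ.link_eq, h1, Ne, φ.onD.apply_eq_iff_eq]
    intro h2
    exact hd (eq_of_heq (Sigma.mk.inj h2).2)

theorem mem_insertedEdges (s : K.S) (d : (γ s).D) :
    φ.onD ⟨s, d⟩ ∈ (insertedEdges φ).carrier ↔ (γ s).link d ≠ d :=
  internal_symm_iff φ s d

/-- After cutting the skeleton edges only edges inside the pieces remain, and each piece is
connected. -/
theorem comp_inserted_eq_iff (hγ : ∀ s, (γ s).IsPiece (K.res s)) (x y : Σ s, (γ s).V) :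
    (Γ.cut (insertedEdges φ)).comp (φ.onV x) = (Γ.cut (insertedEdges φ)).comp (φ.onV y) ↔
      x.1 = y.1 := by
  rw [comp_cut_eq_iff]
  have key : ∀ s d, (γ s).link d ≠ d → Γ.link (φ.onD ⟨s, d⟩) = φ.onD ⟨s, (γ s).link d⟩ :=
    fun s d hd => by
      have h1 : (insert l).link ⟨s, d⟩ = _ := insertLink_int l hd
      rw [φ.link_eq, h1]
  constructor
  · intro h
    have := h (fun v => (φ.onV.symm v).1 = y.1) fun k hk => by
      obtain ⟨⟨s, d⟩, rfl⟩ := φ.onD.surjective k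
      rw [mem_insertedEdges] at hk
      rw [key s d hk, φ.root_eq, φ.root_eq, Equiv.symm_apply_apply, Equiv.symm_apply_apply]
    simpa using this
  · obtain ⟨s, v⟩ := x
    obtain ⟨t, w⟩ := y
    rintro rfl U hU
    refine reach_iff.1 ((hγ s).connected.2 v w) (fun v => U (φ.onV ⟨s, v⟩)) fun d _ => ?_
    by_cases hd : (γ s).link d = d
    · rw [hd]
    · have := hU _ ((mem_insertedEdges φ s d).2 hd)
      rwa [key s d hd, φ.root_eq, φ.root_eq] at this

variable (hγ : ∀ s, (γ s).IsPiece (K.res s))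

/-- The slots correspond to the components. -/
noncomputable def slotEquiv : K.S ≃ (Γ.cut (insertedEdges φ)).Comp :=
  Equiv.ofBijective
    (fun s => (Γ.cut (insertedEdges φ)).comp (φ.onV ⟨s, (hγ s).connected.1.some⟩)) <| by
    constructor
    · exact fun s t h => (comp_inserted_eq_iff φ hγ _ _).1 h
    · intro c
      obtain ⟨v, rfl⟩ := exists_comp _ c
      obtain ⟨⟨s, v⟩, rfl⟩ := φ.onV.surjective v
      exact ⟨s, (comp_inserted_eq_iff φ hγ _ _).2 rfl⟩

theorem comp_inserted (x : Σ s, (γ s).V) :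
    (Γ.cut (insertedEdges φ)).comp (φ.onV x) = slotEquiv φ hγ x.1 :=
  (comp_inserted_eq_iff φ hγ _ _).2 rfl

/-- The inserted graphs are the components. -/
noncomputable def partIso (s : K.S) :
    FGraph.Iso (γ s) ((Γ.cut (insertedEdges φ)).component (slotEquiv φ hγ s)) where
  onV := Equiv.ofBijective (fun v => ⟨φ.onV ⟨s, v⟩, comp_inserted φ hγ ⟨s, v⟩⟩) <| by
    constructor
    · intro v w h
      have := φ.onV.injective (congrArg Subtype.val h)
      exact eq_of_heq (Sigma.mk.inj this).2
    · rintro ⟨v, hv⟩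
      obtain ⟨⟨t, v⟩, rfl⟩ := φ.onV.surjective v
      obtain rfl : t = s := (slotEquiv φ hγ).injective ((comp_inserted φ hγ ⟨t, v⟩).symm.trans hv)
      exact ⟨v, rfl⟩
  onD := Equiv.ofBijective (fun d => ⟨φ.onD ⟨s, d⟩, by
      have := comp_inserted φ hγ ⟨s, (γ s).root d⟩
      rwa [← φ.root_eq ⟨s, d⟩] at this⟩) <| by
    constructor
    · intro v w h
      have := φ.onD.injective (congrArg Subtype.val h)
      exact eq_of_heq (Sigma.mk.inj this).2
    · rintro ⟨v, hv⟩
      obtain ⟨⟨t, v⟩, rfl⟩ := φ.onD.surjective v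
      have h1 := comp_inserted φ hγ ⟨t, (γ t).root v⟩
      rw [← φ.root_eq ⟨t, v⟩] at h1
      obtain rfl : t = s := (slotEquiv φ hγ).injective (h1.symm.trans hv)
      exact ⟨v, rfl⟩
  vert_eq v := φ.vert_eq ⟨s, v⟩
  line_eq d := φ.line_eq ⟨s, d⟩
  root_eq d := Subtype.ext (φ.root_eq ⟨s, d⟩)
  link_eq d := by
    refine Subtype.ext ?_
    by_cases hd : (γ s).link d = d
    · refine Eq.trans (cut_link_not_mem (mt (mem_insertedEdges φ s d).1 (not_not.2 hd))) ?_
      exact congrArg (fun d => φ.onD ⟨s, d⟩) hd.symm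
    · refine Eq.trans (cut_link_mem ((mem_insertedEdges φ s d).2 hd)) ?_
      have h1 : (insert l).link ⟨s, d⟩ = _ := insertLink_int l hd
      exact (φ.link_eq _).trans (congrArg φ.onD h1)

/-- The contraction of the inserted graphs. -/
noncomputable def insertedContraction : Γ.Contraction where
  edges := insertedEdges φ
  res c := K.res ((slotEquiv φ hγ).symm c)
  hasRes c := by
    obtain ⟨s, rfl⟩ := (slotEquiv φ hγ).surjective c
    rw [Equiv.symm_apply_apply]
    exact (hγ s).hasRes.of_iso (partIso φ hγ s)
  onePI h := by
    obtain ⟨⟨s, d⟩, rfl⟩ := φ.onD.surjective h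
    intro hh
    rw [mem_insertedEdges] at hh
    have h1 : (γ s).IsOnePI := by
      rcases hγ s with h | ⟨v, -, h⟩
      · exact h.1
      · exact absurd (h.2.2 d) hh
    rw [φ.root_eq ⟨s, d⟩, comp_inserted φ hγ ⟨s, (γ s).root d⟩]
    exact h1.of_iso (partIso φ hγ s)
  res_single v := by
    obtain ⟨⟨s, v⟩, rfl⟩ := φ.onV.surjective v
    intro hv
    rw [comp_inserted φ hγ ⟨s, v⟩, Equiv.symm_apply_apply, φ.vert_eq ⟨s, v⟩]
    have h1 : ∀ d, (γ s).root d = v → (γ s).link d = d := by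
      intro d hd
      by_contra h1
      refine hv _ ((mem_insertedEdges φ s d).2 h1) ?_
      rw [φ.root_eq]; simp [hd]
    -- A 1PI piece is impossible: `v` meets no internal edge, so connectedness would make it the
    -- only vertex, while a 1PI graph has an edge.
    rcases hγ s with h | ⟨w, hw, h⟩
    · exfalso
      obtain ⟨k, hk⟩ := h.1.exists_edge
      apply hk
      apply h1
      refine (reach_iff.1 (h.1.1.2 v _) (fun w => w = v) fun d _ => ?_).1 rfl
      constructor
      · intro hd; rw [h1 d hd, hd]
      · intro hd
        have := h1 _ hd
        rw [(γ s).link_link] at this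
        rwa [← this] at hd
    · exact hw.trans (congrArg Res.vertex (h.2.1 v).symm)

/-- The skeleton of this contraction. -/
noncomputable def insertedSkelIso : Iso K (insertedContraction φ hγ).skel where
  onS := slotEquiv φ hγ
  onP := l.1.symm.trans (φ.onD.subtypeEquiv fun x => by
    obtain ⟨s, d⟩ := x
    exact not_not.symm.trans (not_congr (mem_insertedEdges φ s d).symm))
  res_eq s := congrArg K.res ((slotEquiv φ hγ).symm_apply_apply s)
  line_eq p := by
    refine (φ.line_eq _).trans ((l.line_eq _).symm.trans ?_)
    rw [Equiv.apply_symm_apply]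
  root_eq p := by
    have h1 := comp_inserted φ hγ ((insert l).root (l.1.symm p).1)
    rw [← φ.root_eq] at h1
    refine h1.trans (congrArg (slotEquiv φ hγ) ((l.root_eq (l.1.symm p)).symm.trans ?_))
    rw [Equiv.apply_symm_apply]
  link_eq p := by
    refine Subtype.ext ((φ.link_eq _).trans (congrArg φ.onD ?_))
    exact insertLink_symm l p

end Disassemble

theorem assemble_surjective (hγ : ∀ s, (γ s).IsPiece (K.res s)) :
    Function.Surjective (assemble (K := K) (γ := γ) (Γ := Γ)) := by
  rintro ⟨l, φ⟩
  refine ⟨⟨insertedContraction φ hγ, insertedSkelIso φ hγ, partIso φ hγ⟩,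
    sigma_ext (fun z => ?_) (fun _ => rfl) fun _ => rfl⟩
  refine ((insertedSkelIso φ hγ).onP.symm_apply_eq).2 (Subtype.ext ?_)
  change φ.onD z.1 = φ.onD (l.1.symm (l.1 z)).1
  rw [Equiv.symm_apply_apply]

end Skel


/-! ### Counting the contractions with given skeleton -/

/-- The monomial of a family of pieces. -/
noncomputable def typeMon {S : Type*} [Fintype S] (T : S → Option Gen) : Gen →₀ ℕ :=
  ∑ s, (T s).elim 0 fun g => Finsupp.single g 1

theorem typeMon_comp {S S' : Type*} [Fintype S] [Fintype S'] (e : S ≃ S') (T : S' → Option Gen) :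
    typeMon (fun s => T (e s)) = typeMon T :=
  e.sum_comp fun s => (T s).elim 0 fun g => Finsupp.single g 1

theorem degree_typeMon {S : Type*} [Fintype S] (T : S → Option Gen) :
    (typeMon T).degree = Nat.card {s // T s ≠ none} := by
  classical
  rw [typeMon, map_sum, Nat.card_eq_fintype_card, Fintype.card_subtype, Finset.card_filter]
  refine Finset.sum_congr rfl fun s _ => ?_
  rcases T s with _ | g <;> simp

theorem finite_typeMon_eq {S : Type*} [Fintype S] (m : Gen →₀ ℕ) :
    {T : S → Option Gen | typeMon T = m}.Finite := by
  classical
  refine (Set.Finite.pi' (t := fun _ : S => insert none (some '' (m.support : Set Gen)))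
    fun _ => (m.support.finite_toSet.image _).insert _).subset ?_
  rintro T rfl s
  rcases h : T s with _ | g
  · exact Set.mem_insert _ _
  · refine Set.mem_insert_of_mem _ ⟨g, ?_, rfl⟩
    rw [Finset.mem_coe, Finsupp.mem_support_iff, typeMon, Finsupp.finsetSum_apply]
    refine (Finset.sum_pos' (fun _ _ => Nat.zero_le _) ⟨s, Finset.mem_univ _, ?_⟩).ne'
    rw [h]; simp

/-- The series `f(none) + ∑ f(g) g`. -/
noncomputable def pieceSeries (f : Option Gen → ℂ) : Formal :=
  MvPowerSeries.C (f none) + linearSeries fun g => f (some g)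

theorem coeff_linearSeries_single (c : Gen → ℂ) (g : Gen) :
    MvPowerSeries.coeff (Finsupp.single g 1) (linearSeries c) = c g := by
  classical
  change (∑ᶠ g' : Gen, if Finsupp.single g 1 = Finsupp.single g' 1 then c g' else 0) = _
  rw [finsum_eq_single _ g fun g' hg' => if_neg fun h => hg'
    (Finsupp.single_left_injective one_ne_zero h).symm, if_pos rfl]

theorem coeff_linearSeries_of_ne (c : Gen → ℂ) {m : Gen →₀ ℕ}
    (h : ∀ g, m ≠ Finsupp.single g 1) : MvPowerSeries.coeff m (linearSeries c) = 0 := by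
  classical
  change (∑ᶠ g' : Gen, if m = Finsupp.single g' 1 then c g' else 0) = _
  simp only [h, if_false, finsum_zero]

theorem coeff_pieceSeries (f : Option Gen → ℂ) (t : Option Gen) :
    MvPowerSeries.coeff (t.elim 0 fun g => Finsupp.single g 1) (pieceSeries f) = f t := by
  classical
  rw [pieceSeries, map_add, MvPowerSeries.coeff_C]
  rcases t with _ | g
  · rw [Option.elim_none, if_pos rfl, coeff_linearSeries_of_ne, add_zero]
    intro g h
    simpa using (DFunLike.congr_fun h g).symm
  · rw [Option.elim_some, coeff_linearSeries_single, if_neg (by simp), zero_add]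

theorem coeff_pieceSeries_of_ne (f : Option Gen → ℂ) {m : Gen →₀ ℕ}
    (h : ∀ t : Option Gen, m ≠ t.elim 0 fun g => Finsupp.single g 1) :
    MvPowerSeries.coeff m (pieceSeries f) = 0 := by
  classical
  rw [pieceSeries, map_add, MvPowerSeries.coeff_C, if_neg (show m ≠ 0 from h none),
    coeff_linearSeries_of_ne _ fun g => h (some g), add_zero]

theorem elim_single_injective : Function.Injective fun t : Option Gen =>
    (t.elim 0 fun g => Finsupp.single g 1 : Gen →₀ ℕ) := by
  rintro (_ | g) (_ | g') h
  · rfl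
  · simp [eq_comm] at h
  · simp at h
  · exact congrArg some (Finsupp.single_left_injective one_ne_zero h)

/-- Each factor has only terms of degree at most one, so expanding the product means choosing at
every slot a generator or nothing. -/
theorem coeff_prod_pieceSeries {S : Type*} [Fintype S] (f : S → Option Gen → ℂ) (m : Gen →₀ ℕ) :
    MvPowerSeries.coeff m (∏ s, pieceSeries (f s)) =
      ∑ T ∈ (finite_typeMon_eq m).toFinset, ∏ s, f s (T s) := by
  classical
  rw [MvPowerSeries.coeff_prod]
  symm
  let l : (S → Option Gen) → (S →₀ Gen →₀ ℕ) := fun T =>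
    Finsupp.equivFunOnFinite.symm fun s => (T s).elim 0 fun g => Finsupp.single g 1
  refine Finset.sum_of_injOn l ?_ ?_ ?_ ?_
  · intro T _ T' _ h
    funext s
    exact elim_single_injective (DFunLike.congr_fun h s)
  · intro T hT
    simp only [Set.Finite.coe_toFinset] at hT
    rw [Finset.mem_coe, Finset.mem_finsuppAntidiag]
    exact ⟨hT, Finset.subset_univ _⟩
  · intro x hx hx'
    by_contra hne
    have h1 : ∀ s, ∃ t : Option Gen, x s = t.elim 0 fun g => Finsupp.single g 1 := by
      intro s
      by_contra! h
      exact hne (Finset.prod_eq_zero (Finset.mem_univ s) (coeff_pieceSeries_of_ne _ h))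
    choose T hT using h1
    have hl : l T = x := Finsupp.ext fun s => (hT s).symm
    refine hx' ⟨T, ?_, hl⟩
    rw [Finset.mem_coe, Set.Finite.mem_toFinset]
    rw [Finset.mem_finsuppAntidiag, ← hl] at hx
    exact hx.1
  · intro T _
    exact Finset.prod_congr rfl fun s _ => (coeff_pieceSeries (f s) (T s)).symm

namespace FGraph.Contraction

variable {Γ : FGraph} (κ : Γ.Contraction)

/-- The product of the components of the subgraph, as a monomial. -/
noncomputable def mon : Gen →₀ ℕ :=
  have := Fintype.ofFinite (Γ.cut κ.edges).Comp
  typeMon κ.type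

theorem mon_eq_of_iso {K : Skel} [Fintype K.S] (Θ : Skel.Iso K κ.skel) {T : K.S → Option Gen}
    (h : ∀ s, κ.type (Θ.onS s) = T s) : κ.mon = typeMon T := by
  rw [← funext h]
  exact (@typeMon_comp _ (Γ.cut κ.edges).Comp _ (Fintype.ofFinite _) Θ.onS κ.type).symm

end FGraph.Contraction

namespace Skel

/-- The contractions of `Γ` with skeleton `K` and components of types `T`. -/
def Presentation (K : Skel) (T : K.S → Option Gen) (Γ : FGraph) : Type :=
  Σ κ : Γ.Contraction, {Θ : Iso K κ.skel // ∀ s, κ.type (Θ.onS s) = T s}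

instance (K : Skel) (T : K.S → Option Gen) (Γ : FGraph) : Finite (K.Presentation T Γ) :=
  inferInstanceAs (Finite (Σ _ : Γ.Contraction, _))

variable {K : Skel} [Fintype K.S] {T : K.S → Option Gen}

/-- The bijection `assemble`, counted by fibres: for a given contraction and skeleton isomorphism,
the ways to identify the model pieces with the components number ∏ |Aut| if the types agree and 0
otherwise. -/
theorem card_presentation (hT : ∀ s, Admissible (K.res s) (T s)) (Γ : FGraph) :
    Nat.card (K.Presentation T Γ) *
      ∏ s, Nat.card (FGraph.Iso (pieceGraph (K.res s) (T s)) (pieceGraph (K.res s) (T s))) =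
    Nat.card (Σ l : K.Gluing fun s => pieceGraph (K.res s) (T s), FGraph.Iso (insert l) Γ) := by
  classical
  have := Fintype.ofFinite Γ.Contraction
  have := fun κ : Γ.Contraction => Fintype.ofFinite (Iso K κ.skel)
  rw [← Nat.card_congr (Equiv.ofBijective _
    ⟨assemble_injective fun s => isPiece_pieceGraph (hT s),
      assemble_surjective fun s => isPiece_pieceGraph (hT s)⟩), Nat.card_sigma]
  rw [Presentation, Nat.card_sigma, Finset.sum_mul]
  refine Finset.sum_congr rfl fun κ _ => ?_
  rw [Nat.card_sigma, Nat.card_eq_fintype_card, Fintype.card_subtype, Finset.card_filter,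
    Finset.sum_mul]
  refine Finset.sum_congr rfl fun Θ _ => ?_
  have h1 : ∀ s, (κ.part (Θ.onS s)).IsPiece (K.res s) := fun s =>
    Θ.res_eq s ▸ κ.isPiece (Θ.onS s)
  have h2 : ∀ s, pieceType (κ.part (Θ.onS s)) (K.res s) = κ.type (Θ.onS s) := fun s =>
    congrArg (pieceType _) (Θ.res_eq s).symm
  rw [Nat.card_pi]
  simp only [fun s => card_iso_pieceGraph (hT s) (h1 s), h2]
  split_ifs with h
  · rw [one_mul]
    exact Finset.prod_congr rfl fun s _ => (if_pos (h s)).symm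
  · push Not at h
    obtain ⟨s, hs⟩ := h
    rw [zero_mul, Finset.prod_eq_zero (Finset.mem_univ s) (if_neg hs)]

open Classical in
/-- The number of structures on the generator `g` of residue `r`, divided by the number of
automorphisms. -/
noncomputable def resMass (r : Res) (n : FGraph → ℕ) (g : Gen) : ℂ :=
  if g.res = r then (n g.rep.graph : ℂ) / Nat.card (FGraph.Iso g.rep.graph g.rep.graph) else 0

theorem resMass_sum {ι : Type*} (r : Res) (s : Finset ι) (n : ι → FGraph → ℕ) (g : Gen) :
    resMass r (fun Γ => ∑ i ∈ s, n i Γ) g = ∑ i ∈ s, resMass r (n i) g := by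
  simp only [resMass]
  split_ifs
  · rw [Nat.cast_sum, Finset.sum_div]
  · rw [Finset.sum_const_zero]

theorem resMass_zero (r : Res) : (resMass r fun _ => 0) = 0 := by
  funext g
  simp [resMass]

/-- The class of the graph obtained by an insertion. -/
noncomputable def insertGen {r : Res} (hK : K.HasRes r) (hK' : K.IsOnePI)
    (hT : ∀ s, Admissible (K.res s) (T s))
    (l : K.Gluing fun s => pieceGraph (K.res s) (T s)) : Gen :=
  Gen.mk ⟨insert l, r, insert_isOnePI l hK' fun s => isPiece_pieceGraph (hT s), insert_hasRes l hK⟩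

-- Each gluing whose result is in the class `g` accounts for |Aut g| isomorphisms, so the
-- automorphisms of the assembled graph cancel.
open Classical in
theorem card_presentation_div {r : Res} (hK : K.HasRes r) (hK' : K.IsOnePI)
    (hT : ∀ s, Admissible (K.res s) (T s)) (g : Gen) :
    resMass r (fun Γ => Nat.card (K.Presentation T Γ)) g =
      Nat.card {l // insertGen hK hK' hT l = g} /
      ∏ s, (Nat.card (FGraph.Iso (pieceGraph (K.res s) (T s)) (pieceGraph (K.res s) (T s))) : ℂ) := by
  have := Fintype.ofFinite (K.Gluing fun s => pieceGraph (K.res s) (T s))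
  rw [resMass]
  split_ifs with hg
  · have hA : (∏ s, (Nat.card (FGraph.Iso (pieceGraph (K.res s) (T s))
        (pieceGraph (K.res s) (T s))) : ℂ)) ≠ 0 :=
      Finset.prod_ne_zero_iff.2 fun s _ => by exact_mod_cast (card_iso_pos _).ne'
    have hB : (Nat.card (FGraph.Iso g.rep.graph g.rep.graph) : ℂ) ≠ 0 := by
      exact_mod_cast (card_iso_pos _).ne'
    rw [div_eq_div_iff hB hA]
    have h1 := card_presentation hT g.rep.graph
    have h2 : ∀ l : K.Gluing fun s => pieceGraph (K.res s) (T s),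
        Nat.card (FGraph.Iso (insert l) g.rep.graph) =
          if insertGen hK hK' hT l = g then Nat.card (FGraph.Iso g.rep.graph g.rep.graph)
          else 0 := by
      intro l
      split_ifs with hl
      · obtain ⟨-, ⟨φ⟩⟩ := Gen.mk_eq_iff.1 hl
        rw [← card_iso_eq φ.symm]
        exact Nat.card_congr ⟨fun φ => φ.symm, fun φ => φ.symm, fun _ => rfl, fun _ => rfl⟩
      · rw [Nat.card_eq_zero]
        exact .inl ⟨fun φ => hl (Gen.mk_eq_iff.2 ⟨hg.symm, ⟨φ⟩⟩)⟩
    rw [Nat.card_sigma, Finset.sum_congr rfl fun l _ => h2 l, ← Finset.sum_filter,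
      Finset.sum_const, smul_eq_mul, ← Fintype.card_subtype, ← Nat.card_eq_fintype_card] at h1
    exact_mod_cast h1
  · have : IsEmpty {l // insertGen hK hK' hT l = g} :=
      ⟨fun l => hg (by rw [← l.2]; exact Gen.res_mk _)⟩
    simp

/-- Every gluing yields exactly one class, so the sum over classes is the number of all gluings, a
product of `perms`, divided by the automorphisms of the pieces. -/
theorem finsum_presentation {r : Res} (hK : K.HasRes r) (hK' : K.IsOnePI)
    (T : K.S → Option Gen) (hT : ∀ s, Admissible (K.res s) (T s)) :
    (Function.support (resMass r (fun Γ => Nat.card (K.Presentation T Γ)))).Finite ∧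
    ∑ᶠ g, resMass r (fun Γ => Nat.card (K.Presentation T Γ)) g =
      ∏ s, pieceWeight (K.res s) (T s) := by
  classical
  have := Fintype.ofFinite (K.Gluing fun s => pieceGraph (K.res s) (T s))
  simp only [funext (card_presentation_div hK hK' hT)]
  have hs : (Function.support fun g : Gen => (Nat.card {l // insertGen hK hK' hT l = g} : ℂ) /
      ∏ s, (Nat.card (FGraph.Iso (pieceGraph (K.res s) (T s)) (pieceGraph (K.res s) (T s))) : ℂ)) ⊆
      (Finset.univ.image (insertGen hK hK' hT) : Finset Gen) := by
    intro g hg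
    rw [Function.mem_support, Ne, div_eq_zero_iff, not_or] at hg
    have := hg.1
    rw [Nat.cast_eq_zero, ← Ne, Nat.card_ne_zero] at this
    obtain ⟨⟨⟨l, hl⟩⟩, -⟩ := this
    simp only [Finset.coe_image, Finset.coe_univ, Set.image_univ]
    exact ⟨l, hl⟩
  refine ⟨(Finset.finite_toSet _).subset hs, ?_⟩
  rw [finsum_eq_sum_of_support_subset _ hs, ← Finset.sum_div]
  have h1 : ∑ g ∈ Finset.univ.image (insertGen hK hK' hT),
      (Nat.card {l // insertGen hK hK' hT l = g} : ℂ) = ∏ s, ((K.res s).perms : ℂ) := by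
    have h2 := Finset.card_eq_sum_card_image (insertGen hK hK' hT) Finset.univ
    have h3 := card_gluing (K := K) (γ := fun s => pieceGraph (K.res s) (T s))
      fun s => (isPiece_pieceGraph (hT s)).hasRes
    rw [Nat.card_eq_fintype_card, ← Finset.card_univ, h2] at h3
    rw [← Nat.cast_prod, ← h3, Nat.cast_sum]
    refine Finset.sum_congr rfl fun g _ => ?_
    rw [Nat.card_eq_fintype_card, Fintype.card_subtype]
  rw [h1, ← Finset.prod_div_distrib]
  exact Finset.prod_congr rfl fun s _ => (if_pos (hT s)).symm

/-- The contractions of `Γ` with skeleton `K` and product of components `m`. -/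
def MonPresentation (K : Skel) (m : Gen →₀ ℕ) (Γ : FGraph) : Type :=
  Σ κ : {κ : Γ.Contraction // κ.mon = m}, Iso K κ.1.skel

instance (K : Skel) (m : Gen →₀ ℕ) (Γ : FGraph) : Finite (K.MonPresentation m Γ) :=
  inferInstanceAs (Finite (Σ _ : {κ : Γ.Contraction // κ.mon = m}, _))

theorem card_monPresentation (m : Gen →₀ ℕ) (Γ : FGraph) :
    Nat.card (K.MonPresentation m Γ) =
      ∑ T ∈ (finite_typeMon_eq (S := K.S) m).toFinset, Nat.card (K.Presentation T Γ) := by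
  classical
  have := (finite_typeMon_eq (S := K.S) m).fintype
  rw [← Finset.sum_coe_sort, ← Nat.card_sigma]
  refine Nat.card_congr ⟨fun x => ⟨⟨fun s => x.1.1.type (x.2.onS s), ?_⟩, x.1.1, x.2, fun _ => rfl⟩,
    fun x => ⟨⟨x.2.1, ?_⟩, x.2.2.1⟩, fun _ => rfl, ?_⟩
  · rw [Set.Finite.mem_toFinset]
    exact (x.1.1.mon_eq_of_iso x.2 fun _ => rfl).symm.trans x.1.2
  · have := x.1.2
    rw [Set.Finite.mem_toFinset] at this
    exact (x.2.1.mon_eq_of_iso x.2.2.1 x.2.2.2).trans this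
  · rintro ⟨⟨T, hT⟩, κ, Θ, hΘ⟩
    obtain rfl : (fun s => κ.type (Θ.onS s)) = T := funext hΘ
    rfl

theorem presentation_admissible {K : Skel} {T : K.S → Option Gen} {Γ : FGraph}
    (x : K.Presentation T Γ) (s : K.S) :
    Admissible (K.res s) (T s) := by
  have := (x.1.isPiece (x.2.1.onS s)).admissible
  have h : x.1.res (x.2.1.onS s) = K.res s := x.2.1.res_eq s
  rw [← x.2.2 s, ← h]
  exact this

theorem finsum_monPresentation {r : Res} (hK : K.HasRes r) (hK' : K.IsOnePI) (m : Gen →₀ ℕ) :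
    (Function.support (resMass r (fun Γ => Nat.card (K.MonPresentation m Γ)))).Finite ∧
    ∑ᶠ g, resMass r (fun Γ => Nat.card (K.MonPresentation m Γ)) g =
      MvPowerSeries.coeff m (∏ s, pieceSeries (pieceWeight (K.res s))) := by
  simp only [card_monPresentation, funext (resMass_sum r _ _)]
  have h1 : ∀ T : K.S → Option Gen,
      (Function.support (resMass r (fun Γ => Nat.card (K.Presentation T Γ)))).Finite ∧
      ∑ᶠ g, resMass r (fun Γ => Nat.card (K.Presentation T Γ)) g =
        ∏ s, pieceWeight (K.res s) (T s) := by
    intro T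
    by_cases hT : ∀ s, Admissible (K.res s) (T s)
    · exact finsum_presentation hK hK' T hT
    -- For a family of types that does not fit the slots, both sides vanish.
    · have h2 : ∀ Γ, Nat.card (K.Presentation T Γ) = 0 := fun Γ =>
        Nat.card_eq_zero.2 (.inl ⟨fun x => hT (presentation_admissible x)⟩)
      push Not at hT
      obtain ⟨s, hs⟩ := hT
      have h3 : pieceWeight (K.res s) (T s) = 0 := if_neg hs
      rw [Finset.prod_eq_zero (Finset.mem_univ s) h3]
      simp [h2, resMass_zero]
  constructor
  · refine (Set.Finite.biUnion (Finset.finite_toSet (finite_typeMon_eq (S := K.S) m).toFinset)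
      fun T _ => (h1 T).1).subset ?_
    intro g hg
    obtain ⟨T, hT, h⟩ := Finset.exists_ne_zero_of_sum_ne_zero hg
    exact Set.mem_biUnion hT h
  · rw [finsum_sum_comm _ _ fun T _ => (h1 T).1, coeff_prod_pieceSeries]
    exact Finset.sum_congr rfl fun T _ => (h1 T).2

end Skel


/-! ### Chains of half-lines -/

section Chain

variable {T : Type} {α β : T → T} {P : T → Prop}

/-- The number of steps to the end of the chain that starts at `x`. -/
noncomputable def foldLen (α β : T → T) (P : T → Prop) (x : T) : ℕ :=
  sInf {k | P (α ((β ∘ α)^[k] x))}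

theorem not_of_lt_foldLen {x : T} {j : ℕ} (hj : j < foldLen α β P x) :
    ¬ P (α ((β ∘ α)^[j] x)) := fun h => absurd (Nat.sInf_le h) (not_le.2 hj)

/-- The chain read from its other end is the same chain reversed, because both maps are involutions.
-/
theorem apply_iterate_fold (hα : ∀ x, α (α x) = x) (hβ : ∀ x, β (β x) = x) {x : T} {j : ℕ}
    (hj : j ≤ foldLen α β P x) :
    α ((β ∘ α)^[j] x) = (β ∘ α)^[foldLen α β P x - j] (fold α β P x) := by
  have := iterate_back hα hβ x (foldLen α β P x - j) j
  rw [Nat.sub_add_cancel hj] at this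
  exact this.symm

theorem not_iterate_of_le_foldLen (hβ : ∀ x, β (β x) = x) (hP : ∀ x, P x → β x = x)
    {x : T} {i : ℕ} (hi : 1 ≤ i) (hi' : i ≤ foldLen α β P x) : ¬ P ((β ∘ α)^[i] x) := by
  obtain ⟨i, rfl⟩ := Nat.exists_eq_add_of_le' hi
  intro h
  have h1 := hP _ h
  rw [Function.iterate_succ_apply', Function.comp_apply] at h h1
  rw [hβ] at h1
  rw [← h1] at h
  exact not_of_lt_foldLen (Nat.lt_of_succ_le hi') h

theorem foldLen_fold (hα : ∀ x, α (α x) = x) (hβ : ∀ x, β (β x) = x)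
    (hP : ∀ x, P x → β x = x) {x : T} (hx : P x) :
    foldLen α β P (fold α β P x) = foldLen α β P x := by
  have h : ∀ j ≤ foldLen α β P x,
      α ((β ∘ α)^[j] (fold α β P x)) = (β ∘ α)^[foldLen α β P x - j] x := by
    intro j hj
    have := apply_iterate_fold hα hβ (P := P) (Nat.sub_le (foldLen α β P x) j)
    rw [Nat.sub_sub_self hj] at this
    rw [← this, hα]
  apply le_antisymm
  · refine Nat.sInf_le ?_
    change P _
    rw [h _ le_rfl, Nat.sub_self]
    exact hx
  · refine le_csInf ⟨foldLen α β P x, ?_⟩ fun j hj => ?_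
    · change P _
      rw [h _ le_rfl, Nat.sub_self]
      exact hx
    · by_contra! hlt
      have hj' : P _ := hj
      rw [h j hlt.le] at hj'
      exact not_iterate_of_le_foldLen hβ hP (by omega) (Nat.sub_le _ _) hj'

theorem comp_injective (hα : ∀ x, α (α x) = x) (hβ : ∀ x, β (β x) = x) :
    Function.Injective (β ∘ α) :=
  (Function.LeftInverse.injective hβ).comp (Function.LeftInverse.injective hα)

/-- Cancel the smaller number of steps. If steps remained, the starting point of one chain, where
`P` holds, would be a later point of the other, where `P` fails. -/
theorem iterate_inj (hα : ∀ x, α (α x) = x) (hβ : ∀ x, β (β x) = x)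
    (hP : ∀ x, P x → β x = x) {x x' : T} (hx : P x) (hx' : P x') {j j' : ℕ}
    (hj : j ≤ foldLen α β P x) (hj' : j' ≤ foldLen α β P x')
    (h : (β ∘ α)^[j] x = (β ∘ α)^[j'] x') : x = x' ∧ j = j' := by
  have key : ∀ {x x' : T} {j j' : ℕ}, P x → j' ≤ foldLen α β P x' → j ≤ j' →
      (β ∘ α)^[j] x = (β ∘ α)^[j'] x' → x = x' ∧ j = j' := by
    intro x x' j j' hx hj' hle h
    obtain ⟨i, rfl⟩ := Nat.exists_eq_add_of_le hle
    rw [Function.iterate_add_apply] at h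
    have h1 := (comp_injective hα hβ).iterate j h
    rcases Nat.eq_zero_or_pos i with rfl | hi
    · exact ⟨h1, rfl⟩
    · rw [h1] at hx
      exact absurd hx (not_iterate_of_le_foldLen hβ hP hi (by omega))
  rcases le_total j j' with hle | hle
  · exact key hx hj' hle h
  · exact (key hx' hj hle h.symm).imp Eq.symm Eq.symm

theorem mate_iterate (hα : ∀ x, α (α x) = x) (hβ : ∀ x, β (β x) = x) {x : T} {j : ℕ}
    (hj : 1 ≤ j) (hj' : j ≤ foldLen α β P x) :
    β ((β ∘ α)^[j] x) = (β ∘ α)^[foldLen α β P x + 1 - j] (fold α β P x) := by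
  obtain ⟨j, rfl⟩ := Nat.exists_eq_add_of_le' hj
  rw [Function.iterate_succ_apply', Function.comp_apply, hβ, apply_iterate_fold (P := P) hα hβ (by omega)]
  congr 1
  omega

theorem iterate_succ_foldLen [Finite T] (hα : ∀ x, α (α x) = x) (hβ : ∀ x, β (β x) = x)
    (hP : ∀ x, P x → β x = x) {x : T} (hx : P x) :
    (β ∘ α)^[foldLen α β P x + 1] x = fold α β P x := by
  rw [Function.iterate_succ_apply', Function.comp_apply]
  exact hP _ (fold_mem hα hβ hP hx)

end Chain

namespace FGraph

theorem Iso.ext_of_onD {Γ Γ' : FGraph} {φ ψ : Iso Γ Γ'} (h : ∀ d, φ.onD d = ψ.onD d) : φ = ψ := by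
  refine Iso.ext_onD (fun v => ?_) h
  obtain ⟨d, rfl⟩ := Γ.exists_leg v
  rw [← φ.root_eq, ← ψ.root_eq, h]

namespace Contraction

variable {Γ : FGraph} (κ : Γ.Contraction)

theorem mate_eq {h h' : Γ.D} {e : Line} (hh : h ∉ κ.edges.carrier)
    (he : κ.res (κ.compOf h) = .edge e) (hne : h' ≠ h) (hh' : h' ∉ κ.edges.carrier)
    (hc : κ.compOf h' = κ.compOf h) : κ.mate h = h' := by
  have H : (h ∉ κ.edges.carrier ∧ ∃ e, κ.res (κ.compOf h) = .edge e) ∧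
      ∃ h', h' ≠ h ∧ h' ∉ κ.edges.carrier ∧ κ.compOf h' = κ.compOf h :=
    ⟨⟨hh, e, he⟩, h', hne, hh', hc⟩
  have h1 : κ.mate h = H.2.choose := by simp only [mate]; rw [dif_pos H]
  obtain ⟨a, b, c⟩ := H.2.choose_spec
  rw [h1]
  exact κ.third_leg hh b hh' he c hc a hne

theorem exists_edge_of_not_survives {h : Γ.D} (hh : h ∉ κ.edges.carrier) (hs : ¬ κ.Survives h) :
    ∃ e, κ.res (κ.compOf h) = .edge e := by
  rcases hr : κ.res (κ.compOf h) with v | e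
  · exact absurd ⟨hh, by rw [hr]; trivial⟩ hs
  · exact ⟨e, rfl⟩

theorem mate_spec {h : Γ.D} (hh : h ∉ κ.edges.carrier) (hs : ¬ κ.Survives h) :
    κ.mate h ≠ h ∧ κ.mate h ∉ κ.edges.carrier ∧ κ.compOf (κ.mate h) = κ.compOf h := by
  obtain ⟨e, he⟩ := κ.exists_edge_of_not_survives hh hs
  have h1 := κ.hasRes (κ.compOf h) e
  rw [he, Res.legs, if_pos rfl, Nat.card_eq_two_iff] at h1
  obtain ⟨x, y, hxy, -⟩ := h1
  have h2 : ∃ h', h' ≠ h ∧ h' ∉ κ.edges.carrier ∧ κ.compOf h' = κ.compOf h := by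
    have key : ∀ z : {z : ((Γ.cut κ.edges).component (κ.compOf h)).D //
        ((Γ.cut κ.edges).component (κ.compOf h)).link z = z ∧
        ((Γ.cut κ.edges).component (κ.compOf h)).line z = e},
        z.1.1 ∉ κ.edges.carrier ∧ κ.compOf z.1.1 = κ.compOf h := fun z =>
      ⟨(Γ.cut_link_eq_self_iff κ.edges z.1.1).1 (congrArg Subtype.val z.2.1), z.1.2⟩
    by_cases hx : x.1.1 = h
    · refine ⟨y.1.1, fun hy => hxy ?_, key y⟩
      exact Subtype.ext (Subtype.ext (hx.trans hy.symm))
    · exact ⟨x.1.1, hx, key x⟩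
  obtain ⟨h', a, b, c⟩ := h2
  rw [κ.mate_eq hh he a b c]
  exact ⟨a, b, c⟩

theorem mate_not_mem {h : Γ.D} (hh : h ∉ κ.edges.carrier) : κ.mate h ∉ κ.edges.carrier := by
  by_cases hs : κ.Survives h
  · rwa [κ.mate_of_survives hs]
  · exact (κ.mate_spec hh hs).2.1

theorem compOf_mate {h : Γ.D} (hh : h ∉ κ.edges.carrier) :
    κ.compOf (κ.mate h) = κ.compOf h := by
  by_cases hs : κ.Survives h
  · rw [κ.mate_of_survives hs]
  · exact (κ.mate_spec hh hs).2.2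

theorem eq_or_eq_mate {h h' : Γ.D} (hh : h ∉ κ.edges.carrier) (hs : ¬ κ.Survives h)
    (hh' : h' ∉ κ.edges.carrier) (hc : κ.compOf h' = κ.compOf h) : h' = h ∨ h' = κ.mate h := by
  obtain ⟨e, he⟩ := κ.exists_edge_of_not_survives hh hs
  by_cases hne : h' = h
  · exact .inl hne
  · exact .inr (κ.mate_eq hh he hne hh' hc).symm

theorem survives_iff_of_compOf {h h' : Γ.D} (hh : h ∉ κ.edges.carrier)
    (hh' : h' ∉ κ.edges.carrier) (hc : κ.compOf h' = κ.compOf h) :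
    κ.Survives h' ↔ κ.Survives h := by
  rw [Survives, Survives, hc]
  exact and_congr_left fun _ => iff_of_true hh' hh

/-- One step along a chain of components that are contracted to edges. -/
noncomputable abbrev step : Γ.D → Γ.D := κ.mate ∘ Γ.link

theorem step_apply (h : Γ.D) : κ.step h = κ.mate (Γ.link h) := rfl

/-- The number of such components between a surviving half-line and the next one. -/
noncomputable abbrev len (h : Γ.D) : ℕ := foldLen Γ.link κ.mate κ.Survives h

theorem step_not_mem {h : Γ.D} (hh : h ∉ κ.edges.carrier) (j : ℕ) :
    κ.step^[j] h ∉ κ.edges.carrier := by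
  induction j with
  | zero => exact hh
  | succ j ih =>
    rw [Function.iterate_succ_apply']
    exact κ.mate_not_mem (κ.edges.link_not_mem ih)

theorem line_step (h : Γ.D) (j : ℕ) : Γ.line (κ.step^[j] h) = Γ.line h := by
  induction j with
  | zero => rfl
  | succ j ih => rw [Function.iterate_succ_apply', step_apply, κ.line_mate, Γ.line_link, ih]

theorem comp_root_eq_of_mem {h : Γ.D} (hh : h ∈ κ.edges.carrier) :
    κ.compOf (Γ.link h) = κ.compOf h := by
  have := (Γ.cut κ.edges).comp_root_link h
  rw [cut_link_mem hh] at this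
  exact this

/-- In a connected graph with a surviving vertex, all half-lines outside the subgraph lie on chains
that start at surviving half-lines. -/
theorem exists_step_eq (hΓ : Γ.Connected) {x₀ : Γ.D} (hx₀ : κ.Survives x₀) {h : Γ.D}
    (hh : h ∉ κ.edges.carrier) : ∃ x j, κ.Survives x ∧ j ≤ κ.len x ∧ κ.step^[j] x = h := by
  let C : Set Γ.D := {y | ∃ x j, κ.Survives x ∧ κ.step^[j] x = y}
  have hinj : Function.Injective κ.step := comp_injective Γ.link_link κ.mate_mate
  have hC : ∀ y ∈ C, y ∉ κ.edges.carrier := by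
    rintro y ⟨x, j, hx, rfl⟩
    exact κ.step_not_mem hx.1 j
  -- `step` is injective on a finite set, hence periodic, so its inverse is one of its iterates.
  have hback : ∀ y ∈ C, Γ.link (κ.mate y) ∈ C := by
    rintro y ⟨x, j, hx, rfl⟩
    obtain ⟨n, hn, hper⟩ := hinj.mem_periodicPts (κ.step^[j] x)
    refine ⟨x, n - 1 + j, hx, ?_⟩
    rw [Function.iterate_add_apply]
    apply hinj
    rw [← Function.iterate_succ_apply' κ.step (n - 1), Nat.succ_eq_add_one, Nat.sub_add_cancel hn,
      step_apply, Γ.link_link, κ.mate_mate]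
    exact hper
  have hback' : ∀ (x : Γ.D) (j : ℕ), κ.Survives x → ∃ y ∈ C, κ.mate (κ.step^[j] x) = y := by
    intro x j hx
    refine ⟨_, ?_, rfl⟩
    rcases j with _ | j
    · exact ⟨x, 0, hx, (κ.mate_of_survives hx).symm⟩
    · have h1 : ∀ j, Γ.link (κ.step^[j] x) ∈ C := by
        intro j
        induction j with
        | zero =>
          have := hback x ⟨x, 0, hx, rfl⟩
          rwa [κ.mate_of_survives hx] at this
        | succ j ih =>
          have := hback _ ih
          have h2 : κ.mate (Γ.link (κ.step^[j] x)) = κ.step^[j + 1] x :=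
            (Function.iterate_succ_apply' κ.step j x).symm
          rwa [h2] at this
      rw [Function.iterate_succ_apply', step_apply, κ.mate_mate]
      exact h1 j
  have hmate : ∀ y ∈ C, κ.mate y ∈ C := by
    rintro y ⟨x, j, hx, rfl⟩
    obtain ⟨z, hz, hz'⟩ := hback' x j hx
    rwa [hz']
  have hlink : ∀ y ∈ C, Γ.link y ∈ C := by
    intro y hy
    have := hback _ (hmate y hy)
    rwa [κ.mate_mate] at this
  have hcomp : ∀ y ∈ C, ∀ z, z ∉ κ.edges.carrier → κ.compOf z = κ.compOf y → z ∈ C := by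
    intro y hy z hz hc
    by_cases hs : κ.Survives y
    · exact ⟨z, 0, (κ.survives_iff_of_compOf (hC y hy) hz hc).2 hs, rfl⟩
    · rcases κ.eq_or_eq_mate (hC y hy) hs hz hc with rfl | rfl
      · exact hy
      · exact hmate y hy
  -- The set `C` is closed under `link`, `mate` and passing to other ports of a component, so the
  -- vertices it touches are closed under edges and connectedness gives them all.
  let U : Γ.V → Prop := fun v => ∃ y ∈ C, κ.compOf y = (Γ.cut κ.edges).comp v
  have hU : ∀ k, U (Γ.root k) → U (Γ.root (Γ.link k)) := by
    rintro k ⟨y, hy, hc⟩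
    by_cases hk : k ∈ κ.edges.carrier
    · exact ⟨y, hy, hc.trans (κ.comp_root_eq_of_mem hk).symm⟩
    · exact ⟨Γ.link k, hlink k (hcomp y hy k hk hc.symm), rfl⟩
  have h1 : U (Γ.root h) := by
    refine (reach_iff.1 (hΓ.2 (Γ.root x₀) (Γ.root h)) U fun k _ => ⟨hU k, fun h1 => ?_⟩).1
      ⟨x₀, ⟨x₀, 0, hx₀, rfl⟩, rfl⟩
    have := hU _ h1
    rwa [Γ.link_link] at this
  obtain ⟨y, hy, hc⟩ := h1
  have h2 : ∃ j x, κ.Survives x ∧ κ.step^[j] x = h := by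
    obtain ⟨x, j, hx, hj⟩ := hcomp y hy h hh hc.symm
    exact ⟨j, x, hx, hj⟩
  classical
  -- Take the fewest steps possible. A walk longer than the chain passes through its end, itself a
  -- surviving half-line and a closer starting point.
  obtain ⟨x, hx, hj⟩ := Nat.find_spec h2
  refine ⟨x, Nat.find h2, hx, ?_, hj⟩
  by_contra! hlt
  obtain ⟨i, hi⟩ := Nat.exists_eq_add_of_le' (Nat.succ_le_of_lt hlt)
  refine Nat.find_min h2 (m := i) (by omega) ⟨fold Γ.link κ.mate κ.Survives x,
    fold_mem Γ.link_link κ.mate_mate (fun _ => κ.mate_of_survives) hx, ?_⟩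
  rw [hi, Function.iterate_add_apply] at hj
  rw [← hj]
  congr 1
  exact (iterate_succ_foldLen Γ.link_link κ.mate_mate (fun _ => κ.mate_of_survives) hx).symm

/-- In a 1PI graph, chains of components contracted to edges do not end in external lines. -/
theorem len_eq_zero_of_fold_eq (hΓ : Γ.IsOnePI) {x : Γ.D} (hx : κ.Survives x)
    (hfix : fold Γ.link κ.mate κ.Survives x = x) : κ.len x = 0 := by
  by_contra hn
  have hback : ∀ j ≤ κ.len x, Γ.link (κ.step^[j] x) = κ.step^[κ.len x - j] x := by
    intro j hj
    have := apply_iterate_fold (P := κ.Survives) Γ.link_link κ.mate_mate hj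
    rwa [hfix] at this
  have hns : ∀ i, 1 ≤ i → i ≤ κ.len x → ¬ κ.Survives (κ.step^[i] x) := fun i h1 h2 =>
    not_iterate_of_le_foldLen κ.mate_mate (fun _ => κ.mate_of_survives) h1 h2
  have hmem : ∀ i, κ.step^[i] x ∉ κ.edges.carrier := κ.step_not_mem hx.1
  have hsucc : ∀ i, κ.mate (Γ.link (κ.step^[i] x)) = κ.step^[i + 1] x := fun i =>
    (Function.iterate_succ_apply' κ.step i x).symm
  -- A chain that returns to its start is a palindrome. If its length is even, the middle half-line
  -- is external, and the first edge separates the beads from `x`, so it is a bridge. If it is odd,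
  -- `mate` fixes a port of a component contracted to an edge.
  rcases Nat.even_or_odd' (κ.len x) with ⟨a, ha | ha⟩
  · have hlx : Γ.link x ≠ x := by
      intro h
      have := hsucc 0
      rw [Function.iterate_zero_apply, h, κ.mate_of_survives hx] at this
      exact hns 1 le_rfl (by omega) (this ▸ hx)
    let U : Γ.V → Prop := fun v => ∃ i, 1 ≤ i ∧ i ≤ a ∧
      (Γ.cut κ.edges).comp v = κ.compOf (κ.step^[i] x)
    have hU : ∀ k, k ≠ x → k ≠ Γ.link x → U (Γ.root k) → U (Γ.root (Γ.link k)) := by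
      rintro k - h2 ⟨i, hi1, hi2, hc⟩
      by_cases hk : k ∈ κ.edges.carrier
      · exact ⟨i, hi1, hi2, (κ.comp_root_eq_of_mem hk).trans hc⟩
      rcases κ.eq_or_eq_mate (hmem i) (hns i hi1 (by omega)) hk hc with rfl | rfl
      · rcases hi2.lt_or_eq with hlt | rfl
        · refine ⟨i + 1, by omega, hlt, ?_⟩
          rw [← hsucc i]
          exact (κ.compOf_mate (κ.edges.link_not_mem (hmem i))).symm
        · refine ⟨i, hi1, le_rfl, ?_⟩
          rw [hback i (by omega), ha, show 2 * i - i = i by omega]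
          rfl
      · obtain ⟨i, rfl⟩ := Nat.exists_eq_add_of_le' hi1
        rw [← hsucc i, κ.mate_mate] at h2 ⊢
        rw [Γ.link_link]
        rcases Nat.eq_zero_or_pos i with rfl | hi
        · exact absurd rfl h2
        · exact ⟨i, hi, by omega, rfl⟩
    have h1 := (isOnePI_iff.1 hΓ).2 x hlx U (fun k h1 h2 => ⟨hU k h1 h2, fun h3 => by
      have := hU (Γ.link k) (fun h => h2 (by rw [← h, Γ.link_link]))
        (fun h => h1 (Γ.link_injective h)) h3
      rwa [Γ.link_link] at this⟩) (Γ.root x) (Γ.root (κ.step^[1] x))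
    obtain ⟨i, hi1, hi2, hc⟩ := h1.2 ⟨1, le_rfl, by omega, rfl⟩
    exact hns i hi1 (by omega) ((κ.survives_iff_of_compOf (hmem i) hx.1 hc).1 hx)
  · have h1 := hback a (by omega)
    rw [ha, show 2 * a + 1 - a = a + 1 by omega] at h1
    have h2 := hsucc a
    rw [h1] at h2
    exact (κ.mate_spec (hmem (a + 1)) (hns (a + 1) (by omega) (by omega))).1 h2

end Contraction

end FGraph


/-! ### Placing beads on the edges of a graph -/

namespace Skel

theorem Iso.ext_of_onP {K K' : Skel} {φ ψ : Iso K K'} (h : ∀ p, φ.onP p = ψ.onP p) : φ = ψ := by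
  refine Iso.ext_on (fun s => ?_) h
  obtain ⟨d, rfl⟩ := K.exists_port s
  rw [← φ.root_eq, ← ψ.root_eq, h]

/-- A bijection of the ports that preserves the structure comes from an isomorphism. -/
theorem exists_iso_of_onP {K K' : Skel} (f : K.P ≃ K'.P)
    (hroot : ∀ p q, K.root p = K.root q ↔ K'.root (f p) = K'.root (f q))
    (hres : ∀ p, K'.res (K'.root (f p)) = K.res (K.root p))
    (hline : ∀ p, K'.line (f p) = K.line p) (hlink : ∀ p, K'.link (f p) = f (K.link p)) :
    ∃ Θ : Iso K K', ∀ p, Θ.onP p = f p := by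
  choose port hport using K.exists_port
  have key : ∀ p, K'.root (f (port (K.root p))) = K'.root (f p) := fun p =>
    (hroot _ _).1 (hport _)
  refine ⟨⟨Equiv.ofBijective (fun s => K'.root (f (port s))) ⟨fun s t h => ?_, fun s => ?_⟩, f,
    fun s => ?_, hline, fun p => (key p).symm, hlink⟩, fun _ => rfl⟩
  · rw [← hport s, ← hport t]
    exact (hroot _ _).2 h
  · obtain ⟨p, rfl⟩ := K'.exists_port s
    obtain ⟨p, rfl⟩ := f.surjective p
    exact ⟨K.root p, key p⟩
  · refine (hres _).trans ?_
    rw [hport]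

end Skel

namespace FGraph

variable {Γ : FGraph} (k : Γ.Ed → ℕ)

open Classical in
/-- The number of beads on the edge of the half-line `h`. -/
noncomputable def beadNum (h : Γ.D) : ℕ :=
  if H : Γ.enc h < Γ.enc (Γ.link h) then k ⟨h, H⟩ else
    if H : Γ.enc (Γ.link h) < Γ.enc (Γ.link (Γ.link h)) then k ⟨Γ.link h, H⟩ else 0

theorem beadNum_ed (e : Γ.Ed) : beadNum k e.1 = k e := dif_pos e.2

theorem beadNum_link (h : Γ.D) : beadNum k (Γ.link h) = beadNum k h := by
  by_cases hh : Γ.link h = h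
  · rw [hh]
  rcases lt_or_lt_of_link_ne hh with h1 | h1
  · rw [beadNum, dif_neg (by rw [Γ.link_link]; exact h1.asymm), dif_pos (by simpa [Γ.link_link]),
      beadNum, dif_pos h1]
    congr 1
    exact Subtype.ext (Γ.link_link h)
  · rw [beadNum, dif_pos h1, beadNum, dif_neg, dif_pos h1]
    rw [Γ.link_link] at h1
    exact h1.asymm

theorem beadNum_of_link_eq {h : Γ.D} (hh : Γ.link h = h) : beadNum k h = 0 := by
  rw [beadNum, dif_neg (by rw [hh]; exact lt_irrefl _), dif_neg (by simp [hh])]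

theorem oriented_of_beadNum_pos {h : Γ.D} (hh : 0 < beadNum k h) :
    Γ.enc h < Γ.enc (Γ.link h) ∨ Γ.enc (Γ.link h) < Γ.enc (Γ.link (Γ.link h)) := by
  refine lt_or_lt_of_link_ne fun h1 => ?_
  rw [beadNum_of_link_eq k h1] at hh
  exact lt_irrefl _ hh

/-- The half-lines after placing `k e` beads on each edge `e`: the half-line `(h, j)` with `j ≥ 1`
is the one that leaves the `j`th bead on the edge of `h`, counted from `h`. -/
def Port : Type := {x : Γ.D × ℕ // x.2 ≤ beadNum k x.1}

instance : Finite (Port k) := by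
  refine Finite.of_injective (β := Σ h : Γ.D, Fin (beadNum k h + 1))
    (fun x => ⟨x.1.1, x.1.2, Nat.lt_succ_of_le x.2⟩) fun x y h => ?_
  obtain ⟨⟨h, j⟩, hj⟩ := x
  obtain ⟨⟨h', j'⟩, hj'⟩ := y
  simp only [Sigma.mk.injEq] at h
  obtain ⟨rfl, h2⟩ := h
  simp only [heq_eq_eq, Fin.mk.injEq] at h2
  subst h2
  rfl

namespace Port

variable {k}

/-- The half-line `(h, j)`. -/
def mk (h : Γ.D) (j : ℕ) (hj : j ≤ beadNum k h) : Port k := ⟨(h, j), hj⟩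

theorem mk_eq_mk {h h' : Γ.D} {j j' : ℕ} {hj : j ≤ beadNum k h} {hj' : j' ≤ beadNum k h'} :
    mk h j hj = mk h' j' hj' ↔ h = h' ∧ j = j' :=
  Subtype.ext_iff.trans Prod.ext_iff

/-- The other end of the edge. -/
noncomputable def link (p : Port k) : Port k :=
  mk (Γ.link p.1.1) (beadNum k p.1.1 - p.1.2) (by rw [beadNum_link]; exact Nat.sub_le _ _)

/-- The other half-line at the same bead. -/
noncomputable def mate (p : Port k) : Port k :=
  if h : 1 ≤ p.1.2 then
    mk (Γ.link p.1.1) (beadNum k p.1.1 + 1 - p.1.2) (by rw [beadNum_link]; omega)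
  else p

theorem mate_of_pos {p : Port k} (h : 1 ≤ p.1.2) : p.mate =
    mk (Γ.link p.1.1) (beadNum k p.1.1 + 1 - p.1.2) (by rw [beadNum_link]; omega) := dif_pos h

theorem mate_pos {p : Port k} (h : 1 ≤ p.1.2) : 1 ≤ p.mate.1.2 := by
  rw [mate_of_pos h]
  have := p.2
  change 1 ≤ beadNum k p.1.1 + 1 - p.1.2
  omega

theorem mate_mate (p : Port k) : p.mate.mate = p := by
  by_cases h : 1 ≤ p.1.2
  · rw [mate_of_pos (mate_pos h)]
    have h1 : p.mate.1 = (Γ.link p.1.1, beadNum k p.1.1 + 1 - p.1.2) := by rw [mate_of_pos h]; rfl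
    refine Subtype.ext (Prod.ext ?_ ?_)
    · change Γ.link p.mate.1.1 = _
      rw [h1, Γ.link_link]
    · change beadNum k p.mate.1.1 + 1 - p.mate.1.2 = _
      have := p.2
      rw [h1, beadNum_link]
      dsimp only
      omega
  · have : p.mate = p := dif_neg h
    rw [this, this]

/-- The half-line points in the chosen direction of its edge. -/
def Oriented (p : Port k) : Prop := Γ.enc p.1.1 < Γ.enc (Γ.link p.1.1)

theorem oriented_mate_iff {p : Port k} (h : 1 ≤ p.1.2) : p.mate.Oriented ↔ ¬ p.Oriented := by
  have h1 : p.mate.1.1 = Γ.link p.1.1 := by rw [mate_of_pos h]; rfl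
  rw [Oriented, Oriented, h1]
  have := oriented_of_beadNum_pos k (h.trans p.2)
  rw [Γ.link_link] at this ⊢
  exact ⟨fun h => h.asymm, fun h => this.resolve_left h⟩

open Classical in
/-- Of the two half-lines at a bead, the one that points in the chosen direction. -/
noncomputable def orient (p : Port k) : Port k := if p.Oriented then p else p.mate

theorem oriented_orient {p : Port k} (h : 1 ≤ p.1.2) : p.orient.Oriented := by
  rw [orient]
  split_ifs with h1
  · exact h1
  · exact (oriented_mate_iff h).2 h1

theorem orient_pos {p : Port k} (h : 1 ≤ p.1.2) : 1 ≤ p.orient.1.2 := by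
  rw [orient]
  split_ifs
  · exact h
  · exact mate_pos h

theorem orient_eq_iff {p q : Port k} (hp : 1 ≤ p.1.2) (hq : 1 ≤ q.1.2) :
    p.orient = q.orient ↔ q = p ∨ q = p.mate := by
  have hm : ∀ p : Port k, 1 ≤ p.1.2 → p.mate.orient = p.orient := by
    intro p hp
    by_cases h : p.Oriented
    · rw [orient, if_neg (by rw [oriented_mate_iff hp]; exact not_not.2 h), mate_mate, orient,
        if_pos h]
    · rw [orient, if_pos ((oriented_mate_iff hp).2 h), orient, if_neg h]
  constructor
  · intro h
    rw [orient, orient] at h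
    split_ifs at h with h1 h2 h2
    · exact .inl h.symm
    · right; rw [h, mate_mate]
    · exact .inr h.symm
    · left; rw [← mate_mate q, ← h, mate_mate]
  · rintro (rfl | rfl)
    · rfl
    · exact (hm p hp).symm

/-- The vertex or bead at which a half-line is rooted. -/
noncomputable def root (p : Port k) : Γ.V ⊕ (Σ e : Γ.Ed, Fin (k e)) :=
  if h : 1 ≤ p.1.2 then
    .inr ⟨⟨p.orient.1.1, oriented_orient h⟩, p.orient.1.2 - 1, by
      have h1 := p.orient.2
      have h2 := orient_pos h
      have h3 := beadNum_ed k ⟨p.orient.1.1, oriented_orient h⟩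
      dsimp only at h3
      omega⟩
  else .inl (Γ.root p.1.1)

theorem root_of_zero {p : Port k} (h : p.1.2 = 0) : p.root = .inl (Γ.root p.1.1) :=
  dif_neg (by omega)

theorem root_of_pos {p : Port k} (h : 1 ≤ p.1.2) : ∃ b, p.root = .inr b ∧
    b.1.1 = p.orient.1.1 ∧ b.2.1 + 1 = p.orient.1.2 := by
  refine ⟨_, dif_pos h, rfl, ?_⟩
  have := orient_pos h
  dsimp only
  omega

theorem root_eq_inr_iff {p : Port k} (e : Γ.Ed) (i : Fin (k e)) :
    p.root = .inr ⟨e, i⟩ ↔ 1 ≤ p.1.2 ∧ p.orient.1 = (e.1, i.1 + 1) := by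
  by_cases h : 1 ≤ p.1.2
  · obtain ⟨⟨e', i'⟩, hb, h1, h2⟩ := root_of_pos h
    rw [hb, Sum.inr.injEq, Prod.ext_iff, ← h1, ← h2]
    constructor
    · intro he
      cases he
      exact ⟨h, rfl, rfl⟩
    · rintro ⟨-, h3, h4⟩
      obtain rfl : e' = e := Subtype.ext h3
      obtain rfl : i' = i := Fin.ext (by simpa using h4)
      rfl
  · rw [root_of_zero (by omega)]
    simp [h]

theorem root_eq_root_of_pos {p q : Port k} (hp : 1 ≤ p.1.2) (hq : 1 ≤ q.1.2) :
    p.root = q.root ↔ q = p ∨ q = p.mate := by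
  rw [← orient_eq_iff hp hq]
  obtain ⟨⟨e, i⟩, hb, h1, h2⟩ := root_of_pos hp
  have h3 : p.orient.1 = (e.1, i.1 + 1) := Prod.ext h1.symm h2.symm
  rw [hb, eq_comm, root_eq_inr_iff, ← h3]
  exact ⟨fun h => (Subtype.ext h.2).symm, fun h => ⟨hq, by rw [h]⟩⟩

theorem line_mate (p : Port k) : Γ.line p.mate.1.1 = Γ.line p.1.1 := by
  by_cases h : 1 ≤ p.1.2
  · rw [mate_of_pos h]; exact Γ.line_link _
  · have : p.mate = p := dif_neg h
    rw [this]

theorem mate_ne {p : Port k} (h : 1 ≤ p.1.2) : p.mate ≠ p := fun h1 => by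
  have := oriented_mate_iff h
  rw [h1] at this
  exact (iff_not_self this)

end Port

/-- The skeleton obtained from `Γ` by placing `k e` beads on each edge `e`. -/
noncomputable def beadSkel (k : Γ.Ed → ℕ) : Skel where
  S := Γ.V ⊕ (Σ e : Γ.Ed, Fin (k e))
  P := Port k
  finS := inferInstance
  finP := inferInstance
  res := Sum.elim (fun v => .vertex (Γ.vert v)) fun b => .edge (Γ.line b.1.1)
  line p := Γ.line p.1.1
  root := Port.root
  legs_eq := by
    rintro (v | ⟨e, i⟩) l
    · rw [Sum.elim_inl, Res.legs, ← Γ.legs_eq v l]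
      refine (Nat.card_congr (Equiv.ofBijective
        (fun h => ⟨Port.mk h.1 0 (Nat.zero_le _),
          (Port.root_of_zero rfl).trans (congrArg Sum.inl h.2.1), h.2.2⟩)
        ⟨fun h h' hh => ?_, ?_⟩)).symm
      · exact Subtype.ext (Port.mk_eq_mk.1 (congrArg Subtype.val hh)).1
      · rintro ⟨⟨⟨h, j⟩, hj⟩, h1, h2⟩
        have h3 : j = 0 := by
          by_contra h3
          obtain ⟨b, hb, -⟩ := Port.root_of_pos (p := ⟨(h, j), hj⟩) (Nat.one_le_iff_ne_zero.2 h3)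
          rw [hb] at h1
          cases h1
        subst h3
        have h4 := (Port.root_of_zero (p := Port.mk h 0 hj) rfl).symm.trans h1
        exact ⟨⟨h, Sum.inl.inj h4, h2⟩, rfl⟩
    · rw [Sum.elim_inr, Res.legs]
      let p : Port k := Port.mk e.1 (i.1 + 1) (by rw [beadNum_ed]; exact i.2)
      have hp : 1 ≤ p.1.2 := Nat.succ_pos _
      have hpr : p.root = .inr ⟨e, i⟩ := by
        rw [Port.root_eq_inr_iff]
        refine ⟨hp, ?_⟩
        rw [Port.orient, if_pos (show p.Oriented from e.2)]
        rfl
      have key : ∀ q : Port k, q.root = .inr ⟨e, i⟩ ↔ q = p ∨ q = p.mate := by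
        intro q
        constructor
        · intro hq
          have hq' := (Port.root_eq_inr_iff e i).1 hq
          exact (Port.root_eq_root_of_pos hp hq'.1).1 (hpr.trans hq.symm)
        · rintro (rfl | rfl)
          · exact hpr
          · exact ((Port.root_eq_root_of_pos hp (Port.mate_pos hp)).2 (.inr rfl)).symm.trans hpr
      split_ifs with hl
      · rw [Nat.card_eq_two_iff]
        refine ⟨⟨p, hpr, hl.symm⟩, ⟨p.mate, (key _).2 (.inr rfl), (Port.line_mate p).trans hl.symm⟩,
          fun h => Port.mate_ne hp (congrArg Subtype.val h).symm, ?_⟩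
        rw [Set.eq_univ_iff_forall]
        rintro ⟨q, hq, hq'⟩
        rcases (key q).1 hq with rfl | rfl
        · exact .inl rfl
        · exact .inr rfl
      · rw [Nat.card_eq_zero]
        refine .inl ⟨?_⟩
        rintro ⟨q, hq, hq'⟩
        rcases (key q).1 hq with rfl | rfl
        · exact hl hq'.symm
        · exact hl (hq'.symm.trans (Port.line_mate p))
  link := Port.link
  link_link p := by
    refine Subtype.ext (Prod.ext (Γ.link_link _) ?_)
    change beadNum k (Γ.link p.1.1) - (beadNum k p.1.1 - p.1.2) = p.1.2
    rw [beadNum_link]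
    exact Nat.sub_sub_self p.2
  line_link p := Γ.line_link _

theorem port_link_eq_self_iff (p : Port k) : p.link = p ↔ p.1.2 = 0 ∧ Γ.link p.1.1 = p.1.1 := by
  constructor
  · intro h
    have h1 : Γ.link p.1.1 = p.1.1 := congrArg (fun q => q.1.1) h
    have := p.2
    rw [beadNum_of_link_eq k h1] at this
    exact ⟨Nat.le_zero.1 this, h1⟩
  · rintro ⟨h1, h2⟩
    refine Subtype.ext (Prod.ext h2 ?_)
    change beadNum k p.1.1 - p.1.2 = p.1.2
    rw [beadNum_of_link_eq k h2, h1]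

theorem beadSkel_hasRes {r : Res} (h : Γ.HasRes r) : (beadSkel k).HasRes r := by
  intro i
  rw [← h i]
  refine (Nat.card_congr (Equiv.ofBijective
    (fun h => ⟨Port.mk h.1 0 (Nat.zero_le _), (port_link_eq_self_iff k _).2 ⟨rfl, h.2.1⟩, h.2.2⟩)
      ⟨fun h h' hh => ?_, ?_⟩)).symm
  · exact Subtype.ext (Port.mk_eq_mk.1 (congrArg Subtype.val hh)).1
  · rintro ⟨⟨⟨h, j⟩, hj⟩, h1, h2⟩
    obtain ⟨h3, h4⟩ := (port_link_eq_self_iff k _).1 h1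
    dsimp only at h3 h4
    subst h3
    exact ⟨⟨h, h4, h2⟩, rfl⟩

/-- Cutting one segment of a subdivided edge leaves each bead attached to an end of its edge, and
the other edges of `Γ` still connect all vertices. -/
theorem beadSkel_isOnePI (h : Γ.IsOnePI) : (beadSkel k).IsOnePI := by
  rw [isOnePI_iff] at h
  obtain ⟨⟨d, hd⟩, H⟩ := h
  refine ⟨⟨Port.mk d 0 (Nat.zero_le _), fun h1 => hd ((port_link_eq_self_iff k _).1 h1).2⟩, ?_⟩
  rintro p hp U hU
  obtain ⟨⟨h₀, j₀⟩, hj₀⟩ := p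
  have hlink : ∀ (h : Γ.D) (j : ℕ) (hj : j ≤ beadNum k h),
      (beadSkel k).link (Port.mk h j hj) = Port.mk (Γ.link h) (beadNum k h - j)
        (by rw [beadNum_link]; exact Nat.sub_le _ _) := fun _ _ _ => rfl
  -- Bead `j + 1` counted from `h` is bead `beadNum k h - j` counted from the other end.
  have hroot : ∀ (h : Γ.D) (j : ℕ) (hj : j < beadNum k h),
      (beadSkel k).root (Port.mk (Γ.link h) (beadNum k h - j)
        (by rw [beadNum_link]; exact Nat.sub_le _ _)) = (beadSkel k).root (Port.mk h (j + 1) hj) := by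
    intro h j hj
    have h1 : 1 ≤ (Port.mk h (j + 1) hj : Port k).1.2 := Nat.succ_pos _
    have h2 : (Port.mk (Γ.link h) (beadNum k h - j)
        (by rw [beadNum_link]; exact Nat.sub_le _ _) : Port k) = (Port.mk h (j + 1) hj).mate := by
      rw [Port.mate_of_pos h1]
      refine Port.mk_eq_mk.2 ⟨rfl, ?_⟩
      change _ = beadNum k h + 1 - (j + 1)
      omega
    rw [h2]
    exact ((Port.root_eq_root_of_pos h1 (Port.mate_pos h1)).2 (.inr rfl)).symm
  -- one step along the chain of `h`
  have hstep : ∀ (h : Γ.D) (j : ℕ) (hj : j < beadNum k h),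
      (Port.mk h j hj.le : Port k) ≠ ⟨(h₀, j₀), hj₀⟩ →
      (Port.mk h j hj.le : Port k) ≠ (beadSkel k).link ⟨(h₀, j₀), hj₀⟩ →
      (U ((beadSkel k).root (Port.mk h j hj.le)) ↔ U ((beadSkel k).root (Port.mk h (j + 1) hj))) := by
    intro h j hj h1 h2
    rw [← hroot h j hj, ← hlink]
    exact hU _ h1 h2
  have hchain : ∀ (h : Γ.D) (j : ℕ) (hj : j ≤ beadNum k h),
      (∀ i (hi : i < j), (Port.mk h i (hi.le.trans hj) : Port k) ≠ ⟨(h₀, j₀), hj₀⟩ ∧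
        (Port.mk h i (hi.le.trans hj) : Port k) ≠ (beadSkel k).link ⟨(h₀, j₀), hj₀⟩) →
      (U (.inl (Γ.root h)) ↔ U ((beadSkel k).root (Port.mk h j hj))) := by
    intro h j
    induction j with
    | zero =>
      intro hj _
      have : (beadSkel k).root (Port.mk h 0 hj) = .inl (Γ.root h) :=
        Port.root_of_zero (p := Port.mk h 0 hj) rfl
      rw [this]
    | succ j ih =>
      intro hj hi
      refine (ih (Nat.le_of_succ_le hj) fun i hij => hi i (by omega)).trans ?_
      exact hstep h j hj (hi j (by omega)).1 (hi j (by omega)).2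
  have hp' : ¬ (j₀ = 0 ∧ Γ.link h₀ = h₀) := fun h => hp ((port_link_eq_self_iff k _).2 h)
  have hlink₀ : (beadSkel k).link ⟨(h₀, j₀), hj₀⟩ = Port.mk (Γ.link h₀) (beadNum k h₀ - j₀)
        (by rw [beadNum_link]; exact Nat.sub_le _ _) := rfl
  have hl₀ : Γ.link h₀ ≠ h₀ := by
    intro h1
    have := hj₀
    rw [beadNum_of_link_eq k h1] at this
    exact hp' ⟨Nat.le_zero.1 this, h1⟩
  -- the chains that are not cut
  have hfar : ∀ h, h ≠ h₀ → h ≠ Γ.link h₀ → ∀ j (hj : j ≤ beadNum k h),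
      (U (.inl (Γ.root h)) ↔ U ((beadSkel k).root (Port.mk h j hj))) := by
    intro h h1 h2 j hj
    refine hchain h j hj fun i hi => ⟨fun h3 => h1 ?_, fun h3 => h2 ?_⟩
    · exact congrArg (fun q : Port k => q.1.1) h3
    · exact congrArg (fun q : Port k => q.1.1) h3
  have hnear₀ : ∀ j (hj : j ≤ j₀),
      (U (.inl (Γ.root h₀)) ↔ U ((beadSkel k).root (Port.mk h₀ j (hj.trans hj₀)))) := by
    intro j hj
    refine hchain h₀ j _ fun i hi => ⟨fun h3 => ?_, fun h3 => ?_⟩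
    · have : i = j₀ := congrArg (fun q : Port k => q.1.2) h3
      omega
    · exact hl₀ (congrArg (fun q : Port k => q.1.1) h3).symm
  have hnear₁ : ∀ j (hj : j ≤ beadNum k h₀ - j₀),
      (U (.inl (Γ.root (Γ.link h₀))) ↔ U ((beadSkel k).root (Port.mk (Γ.link h₀) j
        (by rw [beadNum_link]; omega)))) := by
    intro j hj
    refine hchain (Γ.link h₀) j _ fun i hi => ⟨fun h3 => ?_, fun h3 => ?_⟩
    · exact hl₀ (congrArg (fun q : Port k => q.1.1) h3)
    · have : i = beadNum k h₀ - j₀ := congrArg (fun q : Port k => q.1.2) h3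
      omega
  have hV : ∀ v w, U (.inl v) ↔ U (.inl w) := by
    refine H h₀ hl₀ (fun v => U (.inl v)) fun h h1 h2 => ?_
    refine (hfar h h1 h2 _ le_rfl).trans ((hU _ ?_ ?_).trans ?_)
    · exact fun h3 => h1 (congrArg (fun q : Port k => q.1.1) h3)
    · exact fun h3 => h2 (congrArg (fun q : Port k => q.1.1) h3)
    · have : (beadSkel k).root ((beadSkel k).link (Port.mk h (beadNum k h) le_rfl)) =
          .inl (Γ.root (Γ.link h)) := Port.root_of_zero (Nat.sub_self _)
      rw [this]
  -- A bead on the cut edge is linked to `h₀` or to `Γ.link h₀`, according to the side of the cut on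
  -- which it lies.
  have hall : ∀ s, ∃ v, U s ↔ U (.inl v) := by
    intro s
    obtain ⟨⟨⟨h, j⟩, hj⟩, rfl⟩ := (beadSkel k).exists_port s
    by_cases h1 : h = h₀
    · subst h1
      by_cases h2 : j ≤ j₀
      · exact ⟨_, (hnear₀ j h2).symm⟩
      · obtain ⟨j, rfl⟩ := Nat.exists_eq_add_of_le' (show 1 ≤ j by omega)
        have h3 := hroot h j hj
        exact ⟨Γ.root (Γ.link h), Iff.trans (iff_of_eq (congrArg U h3.symm))
          (hnear₁ (beadNum k h - j) (by omega)).symm⟩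
    · by_cases h2 : h = Γ.link h₀
      · subst h2
        by_cases h3 : j ≤ beadNum k h₀ - j₀
        · exact ⟨_, (hnear₁ j h3).symm⟩
        · obtain ⟨j, rfl⟩ := Nat.exists_eq_add_of_le' (show 1 ≤ j by omega)
          have hj' : j + 1 ≤ beadNum k (Γ.link h₀) := hj
          rw [beadNum_link] at hj'
          have h4 := hroot (Γ.link h₀) j hj
          refine ⟨Γ.root h₀, Iff.trans ?_ (hnear₀ (beadNum k (Γ.link h₀) - j)
            (by rw [beadNum_link]; omega)).symm⟩
          refine Iff.trans (iff_of_eq (congrArg U h4.symm)) (iff_of_eq (congrArg U ?_))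
          congr 1
          exact Port.mk_eq_mk.2 ⟨Γ.link_link _, rfl⟩
      · exact ⟨_, (hfar h h1 h2 j hj).symm⟩
  intro s t
  obtain ⟨v, hv⟩ := hall s
  obtain ⟨w, hw⟩ := hall t
  exact hv.trans ((hV v w).trans hw.symm)

end FGraph


/-! ### Isomorphisms onto a quotient -/

theorem Res.eq_vertex_toVertex : ∀ (r : Res) (h : r.IsVertex), r = .vertex (r.toVertex h)
  | .vertex _, _ => rfl
  | .edge _, h => h.elim

namespace FGraph

variable {X Γ : FGraph} {κ : X.Contraction}

section Forward

variable {k : Γ.Ed → ℕ} (Θ : Skel.Iso (beadSkel k) κ.skel)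

/-- The half-line of `X` that corresponds to a half-line of the skeleton. -/
def Port.image (p : Port k) : X.D := (Θ.onP p).1

theorem Port.image_not_mem (p : Port k) : p.image Θ ∉ κ.edges.carrier := (Θ.onP p).2

theorem Port.image_injective : Function.Injective (Port.image Θ) :=
  Subtype.val_injective.comp Θ.onP.injective

theorem Port.compOf_image (p : Port k) : κ.compOf (p.image Θ) = Θ.onS p.root := Θ.root_eq p

theorem Port.res_image (p : Port k) :
    κ.res (κ.compOf (p.image Θ)) = (beadSkel k).res p.root := by
  rw [Port.compOf_image]
  exact Θ.res_eq _

theorem Port.survives_image_iff (p : Port k) : κ.Survives (p.image Θ) ↔ p.1.2 = 0 := by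
  rw [Contraction.Survives, Port.res_image]
  refine (and_iff_right (p.image_not_mem Θ)).trans ?_
  by_cases h : 1 ≤ p.1.2
  · obtain ⟨b, hb, -⟩ := Port.root_of_pos h
    rw [hb]
    exact iff_of_false id (by omega)
  · rw [Port.root_of_zero (by omega)]
    exact iff_of_true trivial (by omega)

theorem Port.link_image (p : Port k) : X.link (p.image Θ) = p.link.image Θ :=
  congrArg Subtype.val (Θ.link_eq p)

theorem Port.mate_image {p : Port k} (h : 1 ≤ p.1.2) :
    κ.mate (p.image Θ) = p.mate.image Θ := by
  obtain ⟨e, he⟩ := κ.exists_edge_of_not_survives (p.image_not_mem Θ)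
    (by rw [Port.survives_image_iff]; omega)
  refine κ.mate_eq (p.image_not_mem Θ) he (fun h1 => Port.mate_ne h (Port.image_injective Θ h1))
    (p.mate.image_not_mem Θ) ?_
  rw [Port.compOf_image, Port.compOf_image,
    ← (Port.root_eq_root_of_pos h (Port.mate_pos h)).2 (.inr rfl)]

/-- Crossing a segment and then a component contracted to an edge is the passage from one bead to
the next. Bead numbers are thereby determined by `κ` alone. -/
theorem Port.step_image (h : Γ.D) {j : ℕ} (hj : j ≤ beadNum k h) :
    κ.step^[j] ((Port.mk h 0 (Nat.zero_le _)).image Θ) = (Port.mk h j hj).image Θ := by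
  induction j with
  | zero => rfl
  | succ j ih =>
    have h1 : 1 ≤ (Port.mk h j (Nat.le_of_succ_le hj)).link.1.2 := by
      change 1 ≤ beadNum k h - j
      omega
    rw [Function.iterate_succ_apply', ih (by omega), Contraction.step_apply, Port.link_image,
      Port.mate_image Θ h1, Port.mate_of_pos h1]
    congr 1
    refine Port.mk_eq_mk.2 ⟨Γ.link_link h, ?_⟩
    change beadNum k (Γ.link h) + 1 - (beadNum k h - j) = j + 1
    rw [beadNum_link]
    omega

theorem Port.len_image (h : Γ.D) :
    κ.len ((Port.mk h 0 (Nat.zero_le (beadNum k h))).image Θ) = beadNum k h := by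
  have key : ∀ j (hj : j ≤ beadNum k h),
      κ.Survives (X.link (κ.step^[j] ((Port.mk h 0 (Nat.zero_le _)).image Θ))) ↔
        beadNum k h - j = 0 := fun j hj => by
    rw [Port.step_image Θ h hj, Port.link_image, Port.survives_image_iff]
    rfl
  refine le_antisymm (Nat.sInf_le ((key _ le_rfl).2 (Nat.sub_self _))) ?_
  refine le_csInf ⟨_, (key _ le_rfl).2 (Nat.sub_self _)⟩ fun j hj => ?_
  by_contra! hlt
  have := (key j hlt.le).1 hj
  omega

theorem Port.fold_image (h : Γ.D) :
    fold X.link κ.mate κ.Survives ((Port.mk h 0 (Nat.zero_le (beadNum k h))).image Θ) =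
      (Port.mk (Γ.link h) 0 (Nat.zero_le _)).image Θ := by
  change X.link (κ.step^[κ.len _] _) = _
  rw [Port.len_image, Port.step_image Θ h le_rfl, Port.link_image]
  congr 1
  exact Port.mk_eq_mk.2 ⟨rfl, Nat.sub_self _⟩

/-- A presentation of the skeleton by beads on `Γ` identifies `Γ` with the quotient. -/
noncomputable def quotientIso : FGraph.Iso Γ κ.quotient where
  onV := Equiv.ofBijective (fun v => ⟨Θ.onS (.inl v), by
      have h1 : κ.res (Θ.onS (.inl v)) = .vertex (Γ.vert v) := Θ.res_eq (.inl v)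
      rw [h1]
      trivial⟩) ⟨fun v w h => Sum.inl.inj (Θ.onS.injective (congrArg Subtype.val h)), by
    rintro ⟨c, hc⟩
    obtain ⟨s, rfl⟩ := Θ.onS.surjective c
    rcases s with v | b
    · exact ⟨v, rfl⟩
    · have h1 : κ.res (Θ.onS (.inr b)) = .edge (Γ.line b.1.1) := Θ.res_eq (.inr b)
      rw [h1] at hc
      exact hc.elim⟩
  onD := Equiv.ofBijective (fun h => ⟨(Port.mk h 0 (Nat.zero_le _)).image Θ,
      (Port.survives_image_iff Θ _).2 rfl⟩)
    ⟨fun h h' hh => by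
      have h1 : Port.image Θ (Port.mk h 0 (Nat.zero_le _)) =
        Port.image Θ (Port.mk h' 0 (Nat.zero_le _)) :=
        congrArg (fun z : κ.quotient.D => z.1) hh
      exact (Port.mk_eq_mk.1 (Port.image_injective Θ h1)).1, by
      rintro ⟨d, hd⟩
      obtain ⟨p, hp⟩ := Θ.onP.surjective ⟨d, hd.1⟩
      have hp' : Port.image Θ p = d := congrArg Subtype.val hp
      subst hp'
      have h1 := (Port.survives_image_iff Θ p).1 hd
      refine ⟨p.1.1, Subtype.ext (congrArg (Port.image Θ) ?_)⟩
      exact Subtype.ext (Prod.ext rfl h1.symm)⟩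
  vert_eq v := by
    have h1 : κ.res (Θ.onS (.inl v)) = .vertex (Γ.vert v) := Θ.res_eq (.inl v)
    have h2 := Res.eq_vertex_toVertex (κ.res (Θ.onS (.inl v))) (by rw [h1]; trivial)
    exact Res.vertex.inj (h2.symm.trans h1)
  line_eq h := Θ.line_eq _
  root_eq h := Subtype.ext ((Port.compOf_image Θ _).trans (congrArg Θ.onS (Port.root_of_zero rfl)))
  link_eq h := Subtype.ext (Port.fold_image Θ h)

theorem quotientIso_onD (h : Γ.D) :
    ((quotientIso Θ).onD h).1 = (Port.mk h 0 (Nat.zero_le (beadNum k h))).image Θ := rfl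

end Forward

/-! ### Bead presentations are determined by, and recovered from, the identification with the
quotient -/

theorem quotientIso_injective : Function.Injective
    (fun x : Σ k : Γ.Ed → ℕ, Skel.Iso (beadSkel k) κ.skel => quotientIso x.2) := by
  rintro ⟨k, Θ⟩ ⟨k', Θ'⟩ h
  have h0 : ∀ d, (Port.mk d 0 (Nat.zero_le (beadNum k d))).image Θ =
      (Port.mk d 0 (Nat.zero_le (beadNum k' d))).image Θ' := fun d => by
    rw [← quotientIso_onD, ← quotientIso_onD]
    exact congrArg (fun φ : FGraph.Iso Γ κ.quotient => (φ.onD d).1) h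
  obtain rfl : k = k' := by
    funext e
    rw [← beadNum_ed k, ← beadNum_ed k', ← Port.len_image Θ, ← Port.len_image Θ', h0]
  congr 1
  refine Skel.Iso.ext_of_onP ?_
  rintro ⟨⟨d, j⟩, hj⟩
  refine Subtype.ext ?_
  change (Port.mk d j hj).image Θ = (Port.mk d j hj).image Θ'
  rw [← Port.step_image Θ d hj, ← Port.step_image Θ' d hj, h0]

/-- Place on each edge as many beads as its chain has contracted components. Chains from different
starting points are disjoint and, since some half-line survives, they exhaust all half-lines outside
the subgraph. -/
theorem quotientIso_surjective (hX : X.IsOnePI) (hΓ : Nonempty Γ.D) : Function.Surjective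
    (fun x : Σ k : Γ.Ed → ℕ, Skel.Iso (beadSkel k) κ.skel => quotientIso x.2) := by
  intro θ
  have hfix : ∀ d, κ.Survives d → κ.mate d = d := fun _ => κ.mate_of_survives
  let x : Γ.D → X.D := fun h => (θ.onD h).1
  have hx : ∀ h, κ.Survives (x h) := fun h => (θ.onD h).2
  have hxinj : Function.Injective x := Subtype.val_injective.comp θ.onD.injective
  have hfold : ∀ h, fold X.link κ.mate κ.Survives (x h) = x (Γ.link h) := fun h =>
    congrArg Subtype.val (θ.link_eq h)
  let k : Γ.Ed → ℕ := fun e => κ.len (x e.1)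
  have hlen' : ∀ h, κ.len (x (Γ.link h)) = κ.len (x h) := fun h => by
    rw [← hfold]
    exact foldLen_fold X.link_link κ.mate_mate hfix (hx h)
  have hlen : ∀ h, beadNum k h = κ.len (x h) := by
    intro h
    by_cases hh : Γ.link h = h
    -- External lines carry no beads; here the 1PI property of `X` enters.
    · rw [beadNum_of_link_eq k hh, κ.len_eq_zero_of_fold_eq hX (hx h) (by rw [hfold, hh])]
    rcases lt_or_lt_of_link_ne hh with h1 | h1
    · exact beadNum_ed k ⟨h, h1⟩
    · rw [← beadNum_link]
      exact (beadNum_ed k ⟨Γ.link h, h1⟩).trans (hlen' h)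
  let f : Port k → κ.skel.P := fun p => ⟨κ.step^[p.1.2] (x p.1.1), κ.step_not_mem (hx _).1 _⟩
  have hle : ∀ p : Port k, p.1.2 ≤ κ.len (x p.1.1) := fun p => (hlen p.1.1) ▸ p.2
  have hf : Function.Bijective f := by
    constructor
    · intro p q h
      obtain ⟨h1, h2⟩ := iterate_inj X.link_link κ.mate_mate hfix (hx p.1.1) (hx q.1.1)
        (hle p) (hle q) (congrArg Subtype.val h)
      exact Subtype.ext (Prod.ext (hxinj h1) h2)
    · rintro ⟨d, hd⟩
      obtain ⟨h₀⟩ := hΓ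
      obtain ⟨y, j, hy, hj, rfl⟩ := κ.exists_step_eq hX.1 (hx h₀) hd
      obtain ⟨h, hh⟩ := θ.onD.surjective ⟨y, hy⟩
      obtain rfl : x h = y := congrArg Subtype.val hh
      exact ⟨Port.mk h j (by rw [hlen]; exact hj), rfl⟩
  have hsurv : ∀ p : Port k, κ.Survives (f p).1 ↔ p.1.2 = 0 := by
    intro p
    by_cases h : p.1.2 = 0
    · refine iff_of_true ?_ h
      change κ.Survives (κ.step^[p.1.2] (x p.1.1))
      rw [h]
      exact hx _
    · exact iff_of_false (not_iterate_of_le_foldLen κ.mate_mate hfix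
        (Nat.one_le_iff_ne_zero.2 h) (hle p)) h
  have hmate : ∀ p : Port k, 1 ≤ p.1.2 → κ.mate (f p).1 = (f p.mate).1 := by
    intro p hp
    rw [Port.mate_of_pos hp]
    refine (mate_iterate (P := κ.Survives) X.link_link κ.mate_mate hp (hle p)).trans ?_
    rw [hfold]
    exact congrArg (fun n => κ.step^[n + 1 - p.1.2] (x (Γ.link p.1.1))) (hlen p.1.1).symm
  have hcomp0 : ∀ p : Port k, p.1.2 = 0 → κ.compOf (f p).1 = (θ.onV (Γ.root p.1.1)).1 := by
    intro p hp
    have h1 : (f p).1 = x p.1.1 := by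
      change κ.step^[p.1.2] (x p.1.1) = _
      rw [hp]
      rfl
    rw [h1]
    exact congrArg Subtype.val (θ.root_eq p.1.1)
  have hroot : ∀ p q : Port k, p.root = q.root ↔ κ.compOf (f p).1 = κ.compOf (f q).1 := by
    have hmixed : ∀ p q : Port k, p.1.2 = 0 → 1 ≤ q.1.2 →
        κ.compOf (f p).1 ≠ κ.compOf (f q).1 := fun p q hp hq h => by
      have := (κ.survives_iff_of_compOf (f q).2 (f p).2 h).1 ((hsurv p).2 hp)
      rw [hsurv] at this
      omega
    have hmixed' : ∀ p q : Port k, p.1.2 = 0 → 1 ≤ q.1.2 → p.root ≠ q.root := fun p q hp hq h => by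
      obtain ⟨b, hb, -⟩ := Port.root_of_pos hq
      rw [Port.root_of_zero hp, hb] at h
      cases h
    intro p q
    rcases Nat.eq_zero_or_pos p.1.2 with hp | hp <;> rcases Nat.eq_zero_or_pos q.1.2 with hq | hq
    · rw [Port.root_of_zero hp, Port.root_of_zero hq, Sum.inl.injEq, hcomp0 p hp, hcomp0 q hq]
      exact ⟨fun h => by rw [h], fun h => θ.onV.injective (Subtype.ext h)⟩
    · exact iff_of_false (hmixed' p q hp hq) (hmixed p q hp hq)
    · exact iff_of_false (hmixed' q p hq hp).symm (hmixed q p hq hp).symm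
    · rw [Port.root_eq_root_of_pos hp hq]
      constructor
      · rintro (rfl | rfl)
        · rfl
        · rw [← hmate p hp, κ.compOf_mate (f p).2]
      · intro h
        rcases κ.eq_or_eq_mate (f p).2 (by rw [hsurv]; omega) (f q).2 h.symm with h1 | h1
        · exact .inl (hf.1 (Subtype.ext h1))
        · rw [hmate p hp] at h1
          exact .inr (hf.1 (Subtype.ext h1))
  have hline : ∀ p : Port k, X.line (f p).1 = Γ.line p.1.1 := fun p =>
    (κ.line_step _ _).trans (θ.line_eq _)
  have hres : ∀ p : Port k, κ.res (κ.compOf (f p).1) = (beadSkel k).res p.root := by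
    intro p
    rcases Nat.eq_zero_or_pos p.1.2 with hp | hp
    · rw [hcomp0 p hp, Port.root_of_zero hp, Res.eq_vertex_toVertex _ (θ.onV (Γ.root p.1.1)).2]
      exact congrArg Res.vertex (θ.vert_eq _)
    · obtain ⟨b, hb, hb', -⟩ := Port.root_of_pos hp
      obtain ⟨e, he⟩ := κ.exists_edge_of_not_survives (f p).2 (by rw [hsurv]; omega)
      rw [he, hb, ← κ.line_eq_of_edge (f p).2 he, hline]
      change _ = Res.edge (Γ.line b.1.1)
      rw [hb', Port.orient]
      split_ifs
      · rfl
      · rw [Port.line_mate]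
  obtain ⟨Θ, hΘ⟩ := Skel.exists_iso_of_onP (K := beadSkel k) (K' := κ.skel)
    (Equiv.ofBijective f hf) hroot hres hline fun p => by
      refine Subtype.ext ?_
      refine (apply_iterate_fold (P := κ.Survives) X.link_link κ.mate_mate (hle p)).trans ?_
      rw [hfold]
      exact congrArg (fun n => κ.step^[n - p.1.2] (x (Γ.link p.1.1))) (hlen p.1.1).symm
  refine ⟨⟨k, Θ⟩, Iso.ext_of_onD fun h => Subtype.ext ?_⟩
  exact (quotientIso_onD Θ h).trans (congrArg Subtype.val (hΘ (Port.mk h 0 (Nat.zero_le _))))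

/-- The ways of identifying `Γ` with the quotient correspond to the ways of presenting the skeleton
by beads on `Γ`. -/
noncomputable def beadsEquiv (κ : X.Contraction) (hX : X.IsOnePI) (hΓ : Nonempty Γ.D) :
    (Σ k : Γ.Ed → ℕ, Skel.Iso (beadSkel k) κ.skel) ≃ FGraph.Iso Γ κ.quotient :=
  Equiv.ofBijective _ ⟨quotientIso_injective, quotientIso_surjective hX hΓ⟩

end FGraph


/-! ### Powers of formal series -/

/-- Polynomial functions. -/
def IsPoly (φ : ℂ → ℂ) : Prop := ∃ p : Polynomial ℂ, ∀ a, φ a = p.eval a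

theorem choose_eq_eval (a : ℂ) (k : ℕ) :
    Ring.choose a k = (k.factorial : ℂ)⁻¹ * (descPochhammer ℂ k).eval a := by
  rw [Ring.choose_eq_smul, smul_eq_mul, ← descPochhammer_map (Int.castRingHom ℂ),
    ← Polynomial.aeval_eq_smeval, Polynomial.aeval_def, Polynomial.eval_map]
  rfl

namespace IsPoly

theorem const (c : ℂ) : IsPoly fun _ => c := ⟨Polynomial.C c, fun _ => by simp⟩

theorem mul {φ ψ : ℂ → ℂ} : IsPoly φ → IsPoly ψ → IsPoly fun a => φ a * ψ a
  | ⟨p, hp⟩, ⟨q, hq⟩ => ⟨p * q, fun a => by simp [hp, hq]⟩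

theorem sum {ι : Type*} {s : Finset ι} {φ : ι → ℂ → ℂ} (h : ∀ i, IsPoly (φ i)) :
    IsPoly fun a => ∑ i ∈ s, φ i a := by
  choose p hp using h
  exact ⟨∑ i ∈ s, p i, fun a => by simp [hp, Polynomial.eval_finsetSum]⟩

theorem choose (k : ℕ) : IsPoly fun a => Ring.choose a k := by
  refine ⟨Polynomial.C ((k.factorial : ℂ)⁻¹) * descPochhammer ℂ k, fun a => ?_⟩
  rw [Polynomial.eval_mul, Polynomial.eval_C]
  exact choose_eq_eval a k

/-- This reduces every identity between complex powers to natural exponents, where `formalPow` is an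
ordinary power. -/
theorem eq {φ ψ : ℂ → ℂ} (hφ : IsPoly φ) (hψ : IsPoly ψ) (h : ∀ n : ℕ, φ n = ψ n) (a : ℂ) :
    φ a = ψ a := by
  obtain ⟨p, hp⟩ := hφ
  obtain ⟨q, hq⟩ := hψ
  rw [hp, hq, Polynomial.eq_of_infinite_eval_eq p q]
  refine (Set.infinite_range_of_injective (Nat.cast_injective (R := ℂ))).mono ?_
  rintro _ ⟨n, rfl⟩
  exact (hp n).symm.trans ((h n).trans (hq n))

end IsPoly

section FormalPow

variable {f : Formal}

theorem coeff_formalPow (f : Formal) (a : ℂ) (m : Gen →₀ ℕ) :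
    MvPowerSeries.coeff m (formalPow f a) =
      ∑ k ∈ Finset.range (m.degree + 1), Ring.choose a k * MvPowerSeries.coeff m ((f - 1) ^ k) := rfl

theorem coeff_sub_one_pow (hf : MvPowerSeries.constantCoeff f = 1) {m : Gen →₀ ℕ} {k : ℕ}
    (h : m.degree < k) : MvPowerSeries.coeff m ((f - 1) ^ k) = 0 :=
  MvPowerSeries.coeff_eq_zero_of_constantCoeff_nilpotent (m := 1) (by simp [hf]) (by omega)

theorem coeff_formalPow_of_le (hf : MvPowerSeries.constantCoeff f = 1) (a : ℂ) {m : Gen →₀ ℕ}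
    {n : ℕ} (hn : m.degree ≤ n) : MvPowerSeries.coeff m (formalPow f a) =
    ∑ k ∈ Finset.range (n + 1), Ring.choose a k * MvPowerSeries.coeff m ((f - 1) ^ k) := by
  rw [coeff_formalPow]
  refine Finset.sum_subset (Finset.range_subset_range.2 (by omega)) fun k _ hk => ?_
  rw [coeff_sub_one_pow hf (by simpa using hk), mul_zero]

theorem isPoly_coeff_formalPow (f : Formal) (m : Gen →₀ ℕ) :
    IsPoly fun a => MvPowerSeries.coeff m (formalPow f a) := by
  simp only [coeff_formalPow]
  exact IsPoly.sum fun k => (IsPoly.choose k).mul (.const (MvPowerSeries.coeff m ((f - 1) ^ k)))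

theorem formalPow_natCast (hf : MvPowerSeries.constantCoeff f = 1) (n : ℕ) :
    formalPow f n = f ^ n := by
  ext m
  rw [coeff_formalPow_of_le hf _ (le_max_left m.degree n)]
  conv_rhs => rw [← sub_add_cancel f 1, add_pow]
  simp only [one_pow, mul_one, map_sum, Ring.choose_natCast]
  rw [← Finset.sum_subset (Finset.range_subset_range.2
    (Nat.succ_le_succ (le_max_right m.degree n)))]
  · refine Finset.sum_congr rfl fun k _ => ?_
    rw [← map_natCast (MvPowerSeries.C (σ := Gen) (R := ℂ)), MvPowerSeries.coeff_mul_C, mul_comm]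
  · intro k _ hk
    rw [Nat.choose_eq_zero_of_lt (by simpa using hk), Nat.cast_zero, zero_mul]

theorem formalPow_zero (hf : MvPowerSeries.constantCoeff f = 1) : formalPow f 0 = 1 := by
  have := formalPow_natCast hf 0
  rwa [Nat.cast_zero, pow_zero] at this

theorem formalPow_one (hf : MvPowerSeries.constantCoeff f = 1) : formalPow f 1 = f := by
  have := formalPow_natCast hf 1
  rwa [Nat.cast_one, pow_one] at this

/-- Polynomial interpolation in one exponent at a time, starting from the law for natural exponents.
-/
theorem formalPow_add (hf : MvPowerSeries.constantCoeff f = 1) (a b : ℂ) :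
    formalPow f (a + b) = formalPow f a * formalPow f b := by
  have hl : ∀ (c : ℂ) m, IsPoly fun a => MvPowerSeries.coeff m (formalPow f (a + c)) := by
    intro c m
    obtain ⟨p, hp⟩ := isPoly_coeff_formalPow f m
    exact ⟨p.comp (Polynomial.X + Polynomial.C c), fun a => by simp [hp]⟩
  have hr : ∀ (c : ℂ) m, IsPoly fun a => MvPowerSeries.coeff m (formalPow f a * formalPow f c) := by
    classical
    intro c m
    simp only [MvPowerSeries.coeff_mul]
    exact IsPoly.sum fun p => (isPoly_coeff_formalPow f _).mul (.const _)
  have key : ∀ (n : ℕ) (a : ℂ), formalPow f (a + n) = formalPow f a * formalPow f n := by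
    intro n a
    ext m
    refine (hl n m).eq (hr n m) (fun k => ?_) a
    rw [← Nat.cast_add, formalPow_natCast hf, formalPow_natCast hf, formalPow_natCast hf, pow_add]
  ext m
  have hl' := hl a m
  have hr' := hr a m
  simp only [add_comm _ a] at hl'
  simp only [mul_comm _ (formalPow f a)] at hr'
  exact hl'.eq hr' (fun n => by rw [key]) b

theorem constantCoeff_formalPow (f : Formal) (a : ℂ) :
    MvPowerSeries.constantCoeff (formalPow f a) = 1 := by
  rw [← MvPowerSeries.coeff_zero_eq_constantCoeff_apply, coeff_formalPow]
  simp

theorem formalPow_nsmul (hf : MvPowerSeries.constantCoeff f = 1) (a : ℂ) (n : ℕ) :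
    formalPow f (n * a) = formalPow f a ^ n := by
  induction n with
  | zero => rw [Nat.cast_zero, zero_mul, formalPow_zero hf, pow_zero]
  | succ n ih => rw [Nat.cast_succ, add_mul, one_mul, formalPow_add hf, ih, pow_succ]

/-- The binomial coefficients of -1 are the signs (-1) ^ k, so the inverse is a geometric series;
its `k`th term will count chains of `k` self-energy graphs. -/
theorem coeff_formalPow_neg_one (hf : MvPowerSeries.constantCoeff f = 1) {m : Gen →₀ ℕ}
    {n : ℕ} (hn : m.degree ≤ n) : MvPowerSeries.coeff m (formalPow f (-1)) =
      MvPowerSeries.coeff m (∑ k ∈ Finset.range (n + 1), (1 - f) ^ k) := by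
  rw [coeff_formalPow_of_le hf _ hn, map_sum]
  refine Finset.sum_congr rfl fun k _ => ?_
  have h1 : Ring.choose (-1 : ℂ) k = (-1) ^ k := by
    have h3 : ∀ k : ℕ, (descPochhammer ℂ k).eval (-1) = (-1) ^ k * k.factorial := by
      intro k
      induction k with
      | zero => simp
      | succ k ih =>
        rw [descPochhammer_succ_right, Polynomial.eval_mul, ih, Nat.factorial_succ]
        simp only [Polynomial.eval_sub, Polynomial.eval_X, Polynomial.eval_natCast]
        push_cast
        ring
    rw [choose_eq_eval, h3, mul_comm, mul_assoc, mul_inv_cancel₀ (by exact_mod_cast k.factorial_ne_zero), mul_one]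
  have h2 : (1 - f) ^ k = MvPowerSeries.C ((-1 : ℂ) ^ k) * (f - 1) ^ k := by
    rw [map_pow, ← mul_pow, map_neg, map_one]
    congr 1
    ring
  rw [h1, h2, MvPowerSeries.coeff_C_mul]

end FormalPow

/-! ### Products of powers of the Green's functions -/

theorem constantCoeff_green (r : Res) : MvPowerSeries.constantCoeff (green r) = 1 := by
  rw [← MvPowerSeries.coeff_zero_eq_constantCoeff_apply, green, map_add,
    coeff_linearSeries_of_ne]
  · simp
  · intro g h
    simpa using (DFunLike.congr_fun h g).symm

/-- The product of powers of the `Y_v`. -/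
noncomputable def Ypow (n : Vertex → ℤ) : Formal :=
  (∏ w, formalPow (green (.vertex w)) (n w)) *
    ∏ i, formalPow (green (.edge i)) (-((∑ w : Vertex, (w.legs i : ℂ) * n w) / 2))

theorem Ypow_zero : Ypow 0 = 1 := by
  simp [Ypow, formalPow_zero (constantCoeff_green _)]

theorem Ypow_add (n n' : Vertex → ℤ) : Ypow (n + n') = Ypow n * Ypow n' := by
  simp only [Ypow, Pi.add_apply, Int.cast_add, formalPow_add (constantCoeff_green _), mul_add,
    Finset.sum_add_distrib, add_div, neg_add, Finset.prod_mul_distrib]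
  ring

theorem Y_eq_Ypow (v : Vertex) : Y v = Ypow (Pi.single v 1) := by
  rw [Y, Ypow]
  congr 1
  · rw [Finset.prod_eq_single v, Pi.single_eq_same, Int.cast_one,
      formalPow_one (constantCoeff_green _)]
    · intro w _ hw
      rw [Pi.single_eq_of_ne hw, Int.cast_zero, formalPow_zero (constantCoeff_green _)]
    · simp
  · refine Finset.prod_congr rfl fun i _ => ?_
    rw [Finset.sum_eq_single v]
    · simp
    · intro w _ hw
      rw [Pi.single_eq_of_ne hw, Int.cast_zero, mul_zero]
    · simp

theorem Ypow_nsmul (k : ℕ) (n : Vertex → ℤ) : Ypow (k • n) = Ypow n ^ k := by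
  induction k with
  | zero => rw [zero_smul, Ypow_zero, pow_zero]
  | succ k ih => rw [succ_nsmul, Ypow_add, ih, pow_succ]

theorem Y_pow (v : Vertex) (k : ℕ) : Y v ^ k = Ypow (k • Pi.single v 1) := by
  rw [Ypow_nsmul, Y_eq_Ypow]

theorem constantCoeff_Ypow (n : Vertex → ℤ) : MvPowerSeries.constantCoeff (Ypow n) = 1 := by
  rw [Ypow, map_mul, map_prod, map_prod]
  simp [constantCoeff_formalPow]

theorem prod_comp_card {ι κ M : Type*} [Fintype ι] [Fintype κ] [CommMonoid M] (g : ι → κ)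
    (f : κ → M) : ∏ i, f (g i) = ∏ k, f k ^ Nat.card {i // g i = k} := by
  classical
  rw [← Finset.prod_fiberwise (s := Finset.univ) (g := g)]
  refine Finset.prod_congr rfl fun k _ => ?_
  rw [Finset.prod_congr rfl (g := fun _ => f k) fun i hi => by rw [(Finset.mem_filter.1 hi).2],
    Finset.prod_const, Nat.card_eq_fintype_card, Fintype.card_subtype]

/-- The Feynman rules of a graph for full vertices and full propagators. -/
noncomputable def dressed (Γ : FGraph) : Formal :=
  have := Fintype.ofFinite Γ.V
  have := Fintype.ofFinite Γ.Ed
  (∏ v, green (.vertex (Γ.vert v))) * ∏ e : Γ.Ed, formalPow (green (.edge (Γ.line e.1))) (-1)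

theorem dressed_eq (Γ : FGraph) : dressed Γ =
    (∏ w, formalPow (green (.vertex w)) (Γ.numV w)) *
      ∏ i, formalPow (green (.edge i)) (-(Nat.card {e : Γ.Ed // Γ.line e.1 = i})) := by
  refine (congrArg₂ (· * ·)
    (@prod_comp_card _ _ _ (Fintype.ofFinite Γ.V) _ _ Γ.vert fun w => green (.vertex w))
    (@prod_comp_card _ _ _ (Fintype.ofFinite Γ.Ed) _ _ (fun e : Γ.Ed => Γ.line e.1)
      fun i => formalPow (green (.edge i)) (-1))).trans ?_
  simp only [← formalPow_natCast (constantCoeff_green _),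
    ← formalPow_nsmul (constantCoeff_green _), mul_neg, mul_one]
  rfl

/-- Compare exponents by the half-line count. For a vertex residue, the factor `green r` restores
the vertex subtracted in the degree, and the lines of `r` cancel the external lines. For an edge
residue, the two external lines shift the exponent of that edge by one, which `green r` makes good.
-/
theorem green_mul_Ypow {Γ : FGraph} {r : Res} (h : Γ.HasRes r) :
    green r * Ypow (Γ.degree r) = dressed Γ := by
  have hdeg : ∀ i, (∑ w : Vertex, (w.legs i : ℂ) * (Γ.degree r w : ℤ)) / 2 =
      Nat.card {e : Γ.Ed // Γ.line e.1 = i} +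
        (r.legs i - ∑ w : Vertex, (w.legs i : ℂ) * if r = .vertex w then 1 else 0) / 2 := by
    intro i
    have h1 := Γ.two_mul_edges i
    rw [h i] at h1
    have h2 : (2 * (Nat.card {e : Γ.Ed // Γ.line e.1 = i} : ℂ) + r.legs i) =
      ∑ w : Vertex, (Γ.numV w : ℂ) * w.legs i := by exact_mod_cast h1
    have h3 : ∑ w : Vertex, (w.legs i : ℂ) * (Γ.degree r w : ℤ) =
        ∑ w : Vertex, (Γ.numV w : ℂ) * w.legs i -
          ∑ w : Vertex, (w.legs i : ℂ) * if r = .vertex w then 1 else 0 := by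
      rw [← Finset.sum_sub_distrib]
      refine Finset.sum_congr rfl fun w _ => ?_
      rw [degree]
      push_cast
      ring
    rw [h3, ← h2]
    ring
  rw [dressed_eq, Ypow]
  simp only [hdeg]
  rcases r with v | e
  · have h1 : ∀ i, ∑ w : Vertex, (w.legs i : ℂ) *
        (if Res.vertex v = .vertex w then 1 else 0) = v.legs i := by
      intro i
      simp
    have h2 : green (.vertex v) * ∏ w, formalPow (green (.vertex w)) (Γ.degree (.vertex v) w) =
        ∏ w, formalPow (green (.vertex w)) (Γ.numV w) := by
      have h3 : ∀ w, formalPow (green (.vertex w)) (Γ.numV w) =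
          formalPow (green (.vertex w)) (Γ.degree (.vertex v) w) *
            formalPow (green (.vertex w)) (if v = w then 1 else 0) := by
        intro w
        rw [← formalPow_add (constantCoeff_green _), degree]
        congr 1
        by_cases hw : v = w <;> simp [hw]
      simp only [h3, Finset.prod_mul_distrib]
      rw [mul_comm, Finset.prod_eq_single (a := v)
        (f := fun w => formalPow (green (.vertex w)) (if v = w then 1 else 0))]
      · rw [if_pos rfl, formalPow_one (constantCoeff_green _)]
      · intro w _ hw
        rw [if_neg hw.symm, formalPow_zero (constantCoeff_green _)]
      · simp
    rw [← mul_assoc, h2]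
    congr 1
    refine Finset.prod_congr rfl fun i _ => ?_
    rw [h1, Res.legs, sub_self, zero_div, add_zero]
  · have h1 : ∀ w, Γ.degree (.edge e) w = Γ.numV w := fun w => by simp [degree]
    have h2 : green (.edge e) * ∏ i, formalPow (green (.edge i))
        (-(Nat.card {e : Γ.Ed // Γ.line e.1 = i} + ((Res.edge e).legs i -
          ∑ w : Vertex, (w.legs i : ℂ) * if Res.edge e = .vertex w then 1 else 0) / 2)) =
        ∏ i, formalPow (green (.edge i)) (-(Nat.card {e : Γ.Ed // Γ.line e.1 = i})) := by
      have h3 : ∀ i, formalPow (green (.edge i)) (-(Nat.card {e : Γ.Ed // Γ.line e.1 = i})) =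
          formalPow (green (.edge i)) (-(Nat.card {e : Γ.Ed // Γ.line e.1 = i} +
            ((Res.edge e).legs i - ∑ w : Vertex, (w.legs i : ℂ) *
              if Res.edge e = .vertex w then 1 else 0) / 2)) *
            formalPow (green (.edge i)) (if i = e then 1 else 0) := by
        intro i
        rw [← formalPow_add (constantCoeff_green _)]
        congr 1
        by_cases hi : i = e <;> simp [hi, Res.legs]
      simp only [h3, Finset.prod_mul_distrib]
      rw [mul_comm, Finset.prod_eq_single (a := e)
        (f := fun i => formalPow (green (.edge i)) (if i = e then 1 else 0))]
      · rw [if_pos rfl, formalPow_one (constantCoeff_green _)]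
      · intro i _ hi
        rw [if_neg hi, formalPow_zero (constantCoeff_green _)]
      · simp
    rw [← h2]
    simp only [h1, Int.cast_natCast]
    ring


/-! ### Counting the contractions with given quotient -/

theorem linearSeries_neg (c : Gen → ℂ) : (linearSeries fun g => -c g) = -linearSeries c := by
  ext m
  by_cases h : ∃ g, m = Finsupp.single g 1
  · obtain ⟨g, rfl⟩ := h
    rw [map_neg, coeff_linearSeries_single, coeff_linearSeries_single]
  · push Not at h
    rw [map_neg, coeff_linearSeries_of_ne _ h, coeff_linearSeries_of_ne _ h, neg_zero]

theorem pieceSeries_vertex (v : Vertex) : pieceSeries (pieceWeight (.vertex v)) =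
    green (.vertex v) := by
  rw [pieceSeries, pieceWeight_none_vertex, green, map_one]
  congr 2
  funext g
  rw [pieceWeight_some, Res.sign, one_mul]

theorem pieceSeries_edge (e : Line) : pieceSeries (pieceWeight (.edge e)) =
    1 - green (.edge e) := by
  rw [pieceSeries, pieceWeight_none_edge, green, map_zero, zero_add, sub_add_cancel_left,
    ← linearSeries_neg]
  congr 1
  funext g
  rw [pieceWeight_some, Res.sign]
  split_ifs
  · ring
  · exact neg_zero.symm

/-- The series `f` and `g` agree up to degree `n`. -/
def AgreeTo (n : ℕ) (f g : Formal) : Prop :=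
  ∀ m : Gen →₀ ℕ, m.degree ≤ n → MvPowerSeries.coeff m f = MvPowerSeries.coeff m g

theorem AgreeTo.mul {n : ℕ} {f f' g g' : Formal} (h : AgreeTo n f f') (h' : AgreeTo n g g') :
    AgreeTo n (f * g) (f' * g') := by
  classical
  intro m hm
  rw [MvPowerSeries.coeff_mul, MvPowerSeries.coeff_mul]
  refine Finset.sum_congr rfl fun p hp => ?_
  have h1 : p.1.degree + p.2.degree = m.degree := by
    rw [← map_add, Finset.HasAntidiagonal.mem_antidiagonal.1 hp]
  rw [h _ (by omega), h' _ (by omega)]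

theorem AgreeTo.prod {n : ℕ} {ι : Type*} {s : Finset ι} {f f' : ι → Formal}
    (h : ∀ i, AgreeTo n (f i) (f' i)) : AgreeTo n (∏ i ∈ s, f i) (∏ i ∈ s, f' i) := by
  classical
  induction s using Finset.induction_on with
  | empty => exact fun _ _ => rfl
  | insert i s hi ih => rw [Finset.prod_insert hi, Finset.prod_insert hi]; exact (h i).mul ih

namespace FGraph

variable {X Γ : FGraph}

/-- Every bead carries a genuine graph and so a factor of the monomial. This makes the sum over
chain lengths finite for fixed `m`. -/
theorem le_degree_mon {κ : X.Contraction} {k : Γ.Ed → ℕ} (Θ : Skel.Iso (beadSkel k) κ.skel)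
    (e : Γ.Ed) : k e ≤ κ.mon.degree := by
  have : Fintype (beadSkel k).S := Fintype.ofFinite _
  rw [κ.mon_eq_of_iso Θ fun _ => rfl, degree_typeMon]
  have key : ∀ i : Fin (k e), κ.type (Θ.onS (.inr ⟨e, i⟩)) ≠ none := by
    intro i h
    have h1 := (κ.isPiece (Θ.onS (.inr ⟨e, i⟩))).admissible
    have h2 : κ.res (Θ.onS (.inr ⟨e, i⟩)) = .edge (Γ.line e.1) := Θ.res_eq (.inr ⟨e, i⟩)
    change Admissible _ (κ.type (Θ.onS (.inr ⟨e, i⟩))) at h1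
    rw [h, h2] at h1
    exact h1
  have := Nat.card_le_card_of_injective
    (fun i : Fin (k e) => (⟨.inr ⟨e, i⟩, key i⟩ : {s : (beadSkel k).S // κ.type (Θ.onS s) ≠ none}))
    fun i j h => eq_of_heq (Sigma.mk.inj (Sum.inr.inj (congrArg Subtype.val h))).2
  simpa using this

/-- The contractions of `X` with components `m`, with an identification of the quotient with
`Γ`. -/
def QuotientPresentation (Γ : FGraph) (m : Gen →₀ ℕ) (X : FGraph) : Type :=
  Σ κ : {κ : X.Contraction // κ.mon = m}, FGraph.Iso Γ κ.1.quotient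

open Classical in
theorem card_quotientPresentation [Fintype Γ.Ed] (hX : X.IsOnePI) (hΓ : Nonempty Γ.D)
    (m : Gen →₀ ℕ) : Nat.card (QuotientPresentation Γ m X) =
      ∑ k ∈ Fintype.piFinset fun _ : Γ.Ed => Finset.range (m.degree + 1),
        Nat.card ((beadSkel k).MonPresentation m X) := by
  rw [← Finset.sum_coe_sort, ← Nat.card_sigma]
  refine Nat.card_congr ((Equiv.sigmaCongrRight fun κ : {κ : X.Contraction // κ.mon = m} =>
    (beadsEquiv κ.1 hX hΓ).symm).trans ⟨fun x => ⟨⟨x.2.1, ?_⟩, x.1, x.2.2⟩,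
    fun y => ⟨y.2.1, y.1.1, y.2.2⟩, fun _ => rfl, fun _ => rfl⟩)
  rw [Fintype.mem_piFinset]
  intro e
  have := le_degree_mon x.2.2 e
  rw [x.1.2] at this
  exact Finset.mem_range_succ_iff.2 this

end FGraph

theorem resMass_congr {r : Res} {n n' : FGraph → ℕ} (h : ∀ Γ, Γ.IsOnePI → n Γ = n' Γ) :
    Skel.resMass r n = Skel.resMass r n' := by
  funext g
  rw [Skel.resMass, Skel.resMass, h _ g.rep.onePI]

/-- For given chain lengths the count is a coefficient of ∏ G^v ∏ (1 - G^e) ^ kₑ. Summing over the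
lengths gives truncated geometric series, which agree with the inverses of the G^e up to the degree
of `m`. -/
theorem finsum_quotientPresentation {Γ : FGraph} {r : Res} (hr : Γ.HasRes r) (hΓ : Γ.IsOnePI)
    (m : Gen →₀ ℕ) :
    (Function.support (Skel.resMass r fun X => Nat.card (QuotientPresentation Γ m X))).Finite ∧
    ∑ᶠ g, Skel.resMass r (fun X => Nat.card (QuotientPresentation Γ m X)) g =
      MvPowerSeries.coeff m (dressed Γ) := by
  classical
  let : Fintype Γ.V := Fintype.ofFinite Γ.V
  let : Fintype Γ.Ed := Fintype.ofFinite Γ.Ed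
  let : ∀ k : Γ.Ed → ℕ, Fintype (beadSkel k).S := fun k =>
    inferInstanceAs (Fintype (Γ.V ⊕ Σ e : Γ.Ed, Fin (k e)))
  have hD : Nonempty Γ.D := ⟨hΓ.exists_edge.choose⟩
  have h1 := fun k : Γ.Ed → ℕ => Skel.finsum_monPresentation (beadSkel_hasRes k hr)
    (beadSkel_isOnePI k hΓ) m
  have hprod : ∀ k : Γ.Ed → ℕ, ∏ s, pieceSeries (pieceWeight ((beadSkel k).res s)) =
      (∏ v, green (.vertex (Γ.vert v))) *
        ∏ e : Γ.Ed, (1 - green (.edge (Γ.line e.1))) ^ k e := by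
    intro k
    refine (Fintype.prod_sum_type (α₁ := Γ.V) (α₂ := Σ e : Γ.Ed, Fin (k e)) _).trans ?_
    congr 1
    · exact Finset.prod_congr rfl fun v _ => pieceSeries_vertex _
    · refine (Fintype.prod_sigma _).trans (Finset.prod_congr rfl fun e _ => ?_)
      refine (Finset.prod_congr rfl fun i _ => pieceSeries_edge (Γ.line e.1)).trans ?_
      rw [Finset.prod_const, Finset.card_univ, Fintype.card_fin]
  rw [resMass_congr fun X hX => card_quotientPresentation hX hD m]
  rw [funext (Skel.resMass_sum r _ _)]
  constructor
  · refine (Set.Finite.biUnion (Finset.finite_toSet (Fintype.piFinset fun _ : Γ.Ed =>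
      Finset.range (m.degree + 1))) fun k _ => (h1 k).1).subset fun g hg => ?_
    obtain ⟨k, hk, h⟩ := Finset.exists_ne_zero_of_sum_ne_zero hg
    exact Set.mem_biUnion hk h
  · rw [finsum_sum_comm _ _ fun k _ => (h1 k).1]
    simp only [(h1 _).2, hprod]
    rw [← map_sum, ← Finset.mul_sum, ← Finset.prod_univ_sum (fun _ => Finset.range (m.degree + 1))
      fun (e : Γ.Ed) j => (1 - green (.edge (Γ.line e.1))) ^ j]
    -- The vertex factors are equal; only the edge factors are truncated.
    refine (AgreeTo.mul (fun _ _ => rfl) (AgreeTo.prod fun e m' hm' => ?_) m le_rfl)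
    exact (coeff_formalPow_neg_one (constantCoeff_green _) hm').symm


/-! ### Degrees -/

/-- The multidegree of a monomial. -/
noncomputable def multideg : (Gen →₀ ℕ) →+ (Vertex → ℤ) where
  toFun := monDeg
  map_zero' := by funext w; simp [monDeg]
  map_add' m m' := by
    funext w
    rw [Pi.add_apply, monDeg, Finsupp.sum_add_index'] <;> intros <;> simp [monDeg, add_mul]

theorem multideg_apply (m : Gen →₀ ℕ) (w : Vertex) : multideg m w = monDeg m w := rfl

theorem multideg_single (g : Gen) (k : ℕ) : multideg (Finsupp.single g k) = k • g.deg := by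
  funext w
  rw [multideg_apply, monDeg, Finsupp.sum_single_index (by simp)]
  simp

theorem multideg_typeMon {S : Type*} [Fintype S] (T : S → Option Gen) :
    multideg (typeMon T) = ∑ s, (T s).elim 0 Gen.deg := by
  rw [typeMon, map_sum]
  refine Finset.sum_congr rfl fun s _ => ?_
  rcases T s with _ | g
  · exact map_zero _
  · exact (multideg_single g 1).trans (one_smul _ _)

/-- The subtype of `Unit` is an indicator in the form of a cardinality, so that the sum over
components can be compared with the vertices of the quotient by a bijection. -/
theorem numV_of_isPiece {Γ : FGraph} {r : Res} (h : Γ.IsPiece r) (w : Vertex) :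
    (Γ.numV w : ℤ) = (pieceType Γ r).elim 0 Gen.deg w + Nat.card {_u : Unit // r = .vertex w} := by
  have hone : (Nat.card {_u : Unit // r = .vertex w} : ℤ) = if r = .vertex w then 1 else 0 := by
    split_ifs with h1
    · simp [h1]
    · simp [h1]
  rw [hone]
  rcases h with ⟨h1, h2⟩ | ⟨v, rfl, hv⟩
  · have : pieceType Γ r = some (Gen.mk ⟨Γ, r, h1, h2⟩) := dif_pos ⟨h1, h2⟩
    rw [this, Option.elim_some, Gen.deg_mk, degree]
    ring
  · have : pieceType Γ (.vertex v) = none := dif_neg fun h => hv.not_isOnePI h.1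
    rw [this, Option.elim_none, Pi.zero_apply, zero_add, numV]
    split_ifs with h1
    · obtain rfl := Res.vertex.inj h1
      rw [← Nat.cast_one, ← hv.1]
      exact congrArg _ (Nat.card_congr (Equiv.subtypeUnivEquiv hv.2.1))
    · rw [Nat.cast_eq_zero, Nat.card_eq_zero]
      exact .inl ⟨fun x => h1 (congrArg Res.vertex ((hv.2.1 x.1).symm.trans x.2))⟩

namespace FGraph.Contraction

variable {Γ : FGraph} (κ : Γ.Contraction)

theorem numV_eq (w : Vertex) :
    (Γ.numV w : ℤ) = multideg κ.mon w + κ.quotient.numV w := by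
  let _ : Fintype (Γ.cut κ.edges).Comp := Fintype.ofFinite _
  have h1 : Γ.numV w = ∑ c, (κ.part c).numV w := by
    simp only [numV]
    rw [← Nat.card_sigma]
    exact Nat.card_congr ⟨fun v => ⟨(Γ.cut κ.edges).comp v.1, ⟨v.1, rfl⟩, v.2⟩,
      fun x => ⟨x.2.1.1, x.2.2⟩, fun _ => rfl, by rintro ⟨_, ⟨v, rfl⟩, hv⟩; rfl⟩
  have h2 : κ.quotient.numV w = ∑ c, Nat.card {_u : Unit // κ.res c = .vertex w} := by
    rw [← Nat.card_sigma, numV]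
    refine Nat.card_congr ⟨fun x => ⟨x.1.1, ⟨(), ?_⟩⟩, fun x => ⟨⟨x.1, ?_⟩, ?_⟩,
      fun _ => rfl, fun _ => rfl⟩
    · rw [Res.eq_vertex_toVertex _ x.1.2]
      exact congrArg Res.vertex x.2
    · rw [x.2.2]
      trivial
    · exact Res.vertex.inj ((Res.eq_vertex_toVertex _ _).symm.trans x.2.2)
  have h3 : κ.mon = typeMon κ.type := rfl
  rw [h1, h2, h3, multideg_typeMon, Finset.sum_apply, Nat.cast_sum, Nat.cast_sum,
    ← Finset.sum_add_distrib]
  exact Finset.sum_congr rfl fun c _ => numV_of_isPiece (κ.isPiece c) w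

/-- The residues subtracted in the degrees of the components are the vertices they become in the
quotient. This is the homogeneity of the coproduct. -/
theorem degree_eq (r : Res) :
    Γ.degree r = multideg κ.mon + κ.quotient.degree r := by
  funext w
  rw [Pi.add_apply, degree, degree, κ.numV_eq]
  ring

/-! ### Components as elements of the algebra -/

theorem type_eq_none_iff (c : (Γ.cut κ.edges).Comp) :
    κ.type c = none ↔ ¬ ∃ h ∈ κ.edges.carrier, κ.compOf h = c := by
  constructor
  · rintro h ⟨d, hd, rfl⟩
    have : κ.type (κ.compOf d) = some _ := dif_pos ⟨κ.onePI d hd, κ.hasRes _⟩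
    rw [this] at h
    cases h
  · intro h
    refine dif_neg fun h1 => h ?_
    obtain ⟨d, hd⟩ := h1.1.exists_edge
    refine ⟨d.1, ?_, d.2⟩
    by_contra hmem
    exact hd (Subtype.ext (cut_link_not_mem hmem))

theorem graphElt_part (c : (Γ.cut κ.edges).Comp) (h : ∃ h ∈ κ.edges.carrier, κ.compOf h = c) :
    graphElt (κ.part c) (κ.res c) =
      MvPolynomial.monomial ((κ.type c).elim 0 fun g => Finsupp.single g 1) 1 := by
  obtain ⟨d, hd, rfl⟩ := h
  have H : (κ.part (κ.compOf d)).IsOnePI ∧ (κ.part (κ.compOf d)).HasRes (κ.res (κ.compOf d)) :=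
    ⟨κ.onePI d hd, κ.hasRes _⟩
  have h1 : κ.type (κ.compOf d) = some (Gen.mk ⟨_, _, H.1, H.2⟩) := dif_pos H
  rw [h1]
  exact dif_pos H

theorem subgraphElt_eq : κ.subgraphElt = MvPolynomial.monomial κ.mon 1 := by
  classical
  let _ : Fintype (Γ.cut κ.edges).Comp := Fintype.ofFinite _
  have h3 : κ.mon = typeMon κ.type := rfl
  rw [h3, typeMon, MvPolynomial.monomial_sum_one]
  refine (finprod_subtype_eq_finprod_cond (f := fun c => graphElt (κ.part c) (κ.res c))
    (fun c => ∃ h ∈ κ.edges.carrier, κ.compOf h = c)).trans ?_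
  rw [finprod_eq_prod_of_fintype]
  refine Finset.prod_congr rfl fun c _ => ?_
  rw [finprod_eq_if]
  split_ifs with h
  · exact κ.graphElt_part c h
  · rw [(κ.type_eq_none_iff c).2 h]
    rfl

theorem mon_eq_zero_iff : κ.mon = 0 ↔ κ.edges.carrier = ∅ := by
  let _ : Fintype (Γ.cut κ.edges).Comp := Fintype.ofFinite _
  have h3 : κ.mon = typeMon κ.type := rfl
  rw [h3, ← Finsupp.degree_eq_zero_iff, degree_typeMon, Nat.card_eq_zero,
    or_iff_left (by simpa using Subtype.finite), Set.eq_empty_iff_forall_notMem]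
  constructor
  · intro h d hd
    exact h.false ⟨κ.compOf d, fun h1 => (κ.type_eq_none_iff _).1 h1 ⟨d, hd, rfl⟩⟩
  · refine fun h => ⟨fun x => x.2 ((κ.type_eq_none_iff _).2 ?_)⟩
    rintro ⟨d, hd, -⟩
    exact h d hd

/-- If everything is contracted, the quotient has no internal edges. -/
theorem not_isOnePI_quotient (h : κ.edges.carrier = {h | Γ.link h ≠ h}) :
    ¬ κ.quotient.IsOnePI := by
  intro h1
  obtain ⟨⟨d, hd⟩, hne⟩ := h1.exists_edge
  refine hne (Subtype.ext ?_)
  have h2 : Γ.link d = d := by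
    by_contra h3
    exact hd.1 (h ▸ h3)
  have h3 : foldLen Γ.link κ.mate κ.Survives d = 0 :=
    Nat.le_zero.1 (Nat.sInf_le (show κ.Survives _ by
      rw [Function.iterate_zero_apply, h2]; exact hd))
  change Γ.link (κ.step^[foldLen Γ.link κ.mate κ.Survives d] d) = d
  rw [h3, Function.iterate_zero_apply, h2]

end FGraph.Contraction

/-! ### Coefficients of elements of the tensor square -/

/-- The coefficient of a pair of monomials. -/
noncomputable def tcoeff (m m' : Gen →₀ ℕ) : HCK ⊗[ℂ] HCK →ₗ[ℂ] ℂ where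
  toFun z := ((MvPolynomial.algebraTensorAlgEquiv ℂ HCK z).coeff m').coeff m
  map_add' z z' := by simp
  map_smul' c z := by
    rw [← algebraMap_smul HCK c z, map_smul, MvPolynomial.coeff_smul, smul_eq_mul,
      MvPolynomial.algebraMap_eq, MvPolynomial.coeff_C_mul]
    rfl

theorem tcoeff_tmul (m m' : Gen →₀ ℕ) (x y : HCK) :
    tcoeff m m' (x ⊗ₜ y) = x.coeff m * y.coeff m' := by
  change ((MvPolynomial.algebraTensorAlgEquiv ℂ HCK (x ⊗ₜ y)).coeff m').coeff m = _
  rw [MvPolynomial.algebraTensorAlgEquiv_tmul, MvPolynomial.coeff_smul, MvPolynomial.coeff_map,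
    smul_eq_mul, MvPolynomial.algebraMap_eq, mul_comm, MvPolynomial.coeff_C_mul, mul_comm]

theorem tcoeff_ext {z z' : HCK ⊗[ℂ] HCK} (h : ∀ m m', tcoeff m m' z = tcoeff m m' z') : z = z' :=
  (MvPolynomial.algebraTensorAlgEquiv ℂ HCK).injective
    (MvPolynomial.ext _ _ fun m' => MvPolynomial.ext _ _ fun m => h m m')

open Classical in
theorem tcoeff_mul (m m' : Gen →₀ ℕ) (z z' : HCK ⊗[ℂ] HCK) :
    tcoeff m m' (z * z') = ∑ p ∈ Finset.HasAntidiagonal.antidiagonal m',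
      ∑ q ∈ Finset.HasAntidiagonal.antidiagonal m, tcoeff q.1 p.1 z * tcoeff q.2 p.2 z' := by
  change ((MvPolynomial.algebraTensorAlgEquiv ℂ HCK (z * z')).coeff m').coeff m = _
  rw [map_mul, MvPolynomial.coeff_mul, MvPolynomial.coeff_sum]
  refine Finset.sum_congr rfl fun p _ => ?_
  rw [MvPolynomial.coeff_mul]
  rfl

/-- All terms of `z` have total multidegree `n`. -/
def TensorHom (n : Vertex → ℤ) (z : HCK ⊗[ℂ] HCK) : Prop :=
  ∀ m m', tcoeff m m' z ≠ 0 → multideg m + multideg m' = n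

namespace TensorHom

theorem add {n : Vertex → ℤ} {z z' : HCK ⊗[ℂ] HCK} (h : TensorHom n z) (h' : TensorHom n z') :
    TensorHom n (z + z') := fun m m' hm => by
  by_cases h1 : tcoeff m m' z = 0
  · rw [map_add, h1, zero_add] at hm
    exact h' m m' hm
  · exact h m m' h1

theorem sum {ι : Type*} {s : Finset ι} {n : Vertex → ℤ} {z : ι → HCK ⊗[ℂ] HCK}
    (h : ∀ i, TensorHom n (z i)) : TensorHom n (∑ i ∈ s, z i) := fun m m' hm => by
  rw [map_sum] at hm
  obtain ⟨i, -, hi⟩ := Finset.exists_ne_zero_of_sum_ne_zero hm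
  exact h i m m' hi

theorem mul {n n' : Vertex → ℤ} {z z' : HCK ⊗[ℂ] HCK} (h : TensorHom n z)
    (h' : TensorHom n' z') : TensorHom (n + n') (z * z') := fun m m' hm => by
  classical
  rw [tcoeff_mul] at hm
  obtain ⟨p, hp, hp'⟩ := Finset.exists_ne_zero_of_sum_ne_zero hm
  obtain ⟨q, hq, hq'⟩ := Finset.exists_ne_zero_of_sum_ne_zero hp'
  rw [Finset.HasAntidiagonal.mem_antidiagonal] at hp hq
  rw [← h _ _ (left_ne_zero_of_mul hq'), ← h' _ _ (right_ne_zero_of_mul hq'), ← hp, ← hq,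
    map_add, map_add]
  abel

theorem one : TensorHom 0 1 := fun m m' hm => by
  classical
  rw [Algebra.TensorProduct.one_def, tcoeff_tmul, MvPolynomial.coeff_one,
    MvPolynomial.coeff_one] at hm
  have h1 := left_ne_zero_of_mul hm
  have h2 := right_ne_zero_of_mul hm
  rw [ne_eq, ite_eq_right_iff, Classical.not_imp] at h1 h2
  rw [← h1.1, ← h2.1, map_zero, add_zero]

end TensorHom

theorem graphElt_eq {Γ : FGraph} {r : Res} (h : Γ.IsOnePI ∧ Γ.HasRes r) :
    graphElt Γ r = MvPolynomial.X (Gen.mk ⟨Γ, r, h.1, h.2⟩) := dif_pos h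

theorem graphElt_eq_zero {Γ : FGraph} {r : Res} (h : ¬ (Γ.IsOnePI ∧ Γ.HasRes r)) :
    graphElt Γ r = 0 := dif_neg h

theorem comul_X (g : Gen) [Fintype {κ : g.rep.graph.Contraction // κ.IsProper}] :
    comul (MvPolynomial.X g) = MvPolynomial.X g ⊗ₜ 1 + 1 ⊗ₜ MvPolynomial.X g +
      ∑ κ : {κ : g.rep.graph.Contraction // κ.IsProper},
        MvPolynomial.monomial κ.1.mon 1 ⊗ₜ graphElt κ.1.quotient g.res := by
  rw [comul, MvPolynomial.aeval_X, finsum_eq_sum_of_fintype]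
  simp only [FGraph.Contraction.subgraphElt_eq]

theorem tensorHom_comul_X (g : Gen) : TensorHom g.deg (comul (MvPolynomial.X g)) := by
  classical
  have := Fintype.ofFinite {κ : g.rep.graph.Contraction // κ.IsProper}
  have hg : multideg (Finsupp.single g 1) = g.deg := by rw [multideg_single, one_smul]
  rw [comul_X]
  refine (TensorHom.add ?_ ?_).add (.sum fun κ => ?_)
  · intro m m' hm
    rw [tcoeff_tmul, MvPolynomial.coeff_X, MvPolynomial.coeff_one] at hm
    have h1 := left_ne_zero_of_mul hm
    have h2 := right_ne_zero_of_mul hm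
    rw [ne_eq, ite_eq_right_iff, Classical.not_imp] at h1 h2
    rw [← h1.1, ← h2.1, map_zero, add_zero, hg]
  · intro m m' hm
    rw [tcoeff_tmul, MvPolynomial.coeff_X, MvPolynomial.coeff_one] at hm
    have h1 := left_ne_zero_of_mul hm
    have h2 := right_ne_zero_of_mul hm
    rw [ne_eq, ite_eq_right_iff, Classical.not_imp] at h1 h2
    rw [← h1.1, ← h2.1, map_zero, zero_add, hg]
  · intro m m' hm
    rw [tcoeff_tmul, MvPolynomial.coeff_monomial] at hm
    have h1 := left_ne_zero_of_mul hm
    have h2 := right_ne_zero_of_mul hm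
    rw [ne_eq, ite_eq_right_iff, Classical.not_imp] at h1
    by_cases H : κ.1.quotient.IsOnePI ∧ κ.1.quotient.HasRes g.res
    · rw [graphElt_eq H, MvPolynomial.coeff_X, ne_eq, ite_eq_right_iff, Classical.not_imp] at h2
      rw [← h1.1, ← h2.1, multideg_single, one_smul]
      have h3 : Gen.deg (Gen.mk ⟨κ.1.quotient, g.res, H.1, H.2⟩) = κ.1.quotient.degree g.res :=
        funext fun w => Gen.deg_mk _ w
      rw [h3]
      exact (κ.1.degree_eq g.res).symm
    · rw [graphElt_eq_zero H] at h2
      exact absurd (MvPolynomial.coeff_zero _) h2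

theorem tensorHom_comul_monomial (m : Gen →₀ ℕ) :
    TensorHom (multideg m) (comul (MvPolynomial.monomial m 1)) := by
  induction m using Finsupp.induction_linear with
  | zero => rw [map_zero]; exact (map_one comul).symm ▸ TensorHom.one
  | add m m' h h' =>
    rw [map_add, show MvPolynomial.monomial (m + m') (1 : ℂ) =
      MvPolynomial.monomial m 1 * MvPolynomial.monomial m' 1 by
        rw [MvPolynomial.monomial_mul, one_mul], map_mul]
    exact h.mul h'
  | single g k =>
    rw [← MvPolynomial.X_pow_eq_monomial, map_pow, multideg_single]
    induction k with
    | zero => rw [pow_zero, zero_smul]; exact TensorHom.one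
    | succ k ih => rw [pow_succ, succ_nsmul]; exact ih.mul (tensorHom_comul_X g)


/-! ### Coefficients of the coproduct of a graph -/

section

variable (g g' : Gen)

theorem coeff_graphElt_zero (Γ : FGraph) (r : Res) : (graphElt Γ r).coeff 0 = 0 := by
  classical
  by_cases H : Γ.IsOnePI ∧ Γ.HasRes r
  · rw [graphElt_eq H, MvPolynomial.coeff_X, if_neg (by simp)]
  · rw [graphElt_eq_zero H, MvPolynomial.coeff_zero]

theorem coeff_graphElt_of_ne (Γ : FGraph) (r : Res) {m : Gen →₀ ℕ}
    (h : ∀ g, m ≠ Finsupp.single g 1) : (graphElt Γ r).coeff m = 0 := by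
  classical
  by_cases H : Γ.IsOnePI ∧ Γ.HasRes r
  · rw [graphElt_eq H, MvPolynomial.coeff_X, if_neg (h _).symm]
  · rw [graphElt_eq_zero H, MvPolynomial.coeff_zero]

-- Multiplying by the order of the automorphism group replaces equality of classes by a number of
-- isomorphisms, the quantity counted above.
open Classical in
theorem coeff_graphElt_single (Γ : FGraph) (r : Res) :
    (graphElt Γ r).coeff (Finsupp.single g 1) * Nat.card (FGraph.Iso g.rep.graph g.rep.graph) =
      if r = g.res then (Nat.card (FGraph.Iso g.rep.graph Γ) : ℂ) else 0 := by
  by_cases H : Γ.IsOnePI ∧ Γ.HasRes r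
  · rw [graphElt_eq H, MvPolynomial.coeff_X]
    by_cases h : Gen.mk ⟨Γ, r, H.1, H.2⟩ = g
    · obtain ⟨h1, ⟨φ⟩⟩ := Gen.mk_eq_iff.1 h
      have h1 : r = g.res := h1
      rw [h, if_pos rfl, if_pos h1, one_mul, card_iso_eq φ.symm]
    · rw [if_neg fun h' => h (Finsupp.single_left_injective one_ne_zero h'), zero_mul]
      split_ifs with h1
      · have : IsEmpty (FGraph.Iso g.rep.graph Γ) :=
          ⟨fun φ => h (Gen.mk_eq_iff.2 ⟨h1, ⟨φ.symm⟩⟩)⟩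
        rw [Nat.card_of_isEmpty, Nat.cast_zero]
      · rfl
  · rw [graphElt_eq_zero H, MvPolynomial.coeff_zero, zero_mul]
    split_ifs with h1
    · have : IsEmpty (FGraph.Iso g.rep.graph Γ) :=
        ⟨fun φ => H ⟨g.rep.onePI.of_iso φ, h1 ▸ g.hasRes.of_iso φ⟩⟩
      rw [Nat.card_of_isEmpty, Nat.cast_zero]
    · rfl

open Classical in
theorem tcoeff_comul_X [Fintype {κ : g.rep.graph.Contraction // κ.IsProper}] (m m' : Gen →₀ ℕ) :
    tcoeff m m' (comul (MvPolynomial.X g)) =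
      (if Finsupp.single g 1 = m then 1 else 0) * (if 0 = m' then 1 else 0) +
      (if 0 = m then 1 else 0) * (if Finsupp.single g 1 = m' then 1 else 0) +
      ∑ κ : {κ : g.rep.graph.Contraction // κ.IsProper},
        (if κ.1.mon = m then 1 else 0) * (graphElt κ.1.quotient g.res).coeff m' := by
  rw [comul_X, map_add, map_add, map_sum, tcoeff_tmul, tcoeff_tmul]
  simp only [tcoeff_tmul, MvPolynomial.coeff_X, MvPolynomial.coeff_one,
    MvPolynomial.coeff_monomial]

open Classical in
theorem tcoeff_comul_X_zero_right (m : Gen →₀ ℕ) :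
    tcoeff m 0 (comul (MvPolynomial.X g)) = if m = Finsupp.single g 1 then 1 else 0 := by
  have := Fintype.ofFinite {κ : g.rep.graph.Contraction // κ.IsProper}
  rw [tcoeff_comul_X, if_pos rfl, if_neg (c := Finsupp.single g 1 = 0) (by simp)]
  simp only [coeff_graphElt_zero, mul_zero, Finset.sum_const_zero, add_zero, mul_one]
  exact if_congr eq_comm rfl rfl

open Classical in
theorem tcoeff_comul_X_zero_left :
    tcoeff 0 (Finsupp.single g' 1) (comul (MvPolynomial.X g)) = if g = g' then 1 else 0 := by
  have := Fintype.ofFinite {κ : g.rep.graph.Contraction // κ.IsProper}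
  rw [tcoeff_comul_X, if_pos rfl, if_neg (c := Finsupp.single g 1 = 0) (by simp),
    Finset.sum_eq_zero]
  · rw [zero_mul, zero_add, add_zero, one_mul]
    exact if_congr (Finsupp.single_left_injective one_ne_zero).eq_iff rfl rfl
  · intro κ _
    rw [if_neg fun h => κ.2.1 (κ.1.mon_eq_zero_iff.1 h), zero_mul]

theorem tcoeff_comul_X_of_ne (m : Gen →₀ ℕ) {m' : Gen →₀ ℕ} (h0 : m' ≠ 0)
    (h : ∀ g, m' ≠ Finsupp.single g 1) : tcoeff m m' (comul (MvPolynomial.X g)) = 0 := by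
  classical
  have := Fintype.ofFinite {κ : g.rep.graph.Contraction // κ.IsProper}
  rw [tcoeff_comul_X, if_neg h0.symm, if_neg (h g).symm]
  simp [coeff_graphElt_of_ne _ _ h]

-- The restriction to proper subgraphs may be dropped: the empty one has monomial 1, excluded by `m
-- ≠ 0`, and contracting all internal edges leaves a quotient without edges, which is not isomorphic
-- to a 1PI graph.
open Classical in
theorem tcoeff_comul_X_single {m : Gen →₀ ℕ} (hm : m ≠ 0) :
    tcoeff m (Finsupp.single g' 1) (comul (MvPolynomial.X g)) *
      Nat.card (FGraph.Iso g'.rep.graph g'.rep.graph) =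
      if g.res = g'.res then
        (Nat.card (QuotientPresentation g'.rep.graph m g.rep.graph) : ℂ) else 0 := by
  have := Fintype.ofFinite g.rep.graph.Contraction
  rw [tcoeff_comul_X, if_neg hm.symm, if_neg (c := 0 = Finsupp.single g' 1) (by simp [eq_comm]),
    mul_zero, zero_mul, zero_add, zero_add, Finset.sum_mul]
  simp only [mul_assoc, coeff_graphElt_single]
  split_ifs with hr
  · rw [QuotientPresentation, Nat.card_sigma, Nat.cast_sum]
    have h1 : ∀ (p : g.rep.graph.Contraction → Prop) [DecidablePred p] [Fintype {κ // p κ}]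
        (f : g.rep.graph.Contraction → ℂ), ∑ κ : {κ // p κ}, f κ.1 = ∑ κ, if p κ then f κ else 0 := by
      intro p _ _ f
      rw [← Finset.sum_filter]
      exact (Finset.sum_subtype _ (fun x => by simp) f).symm
    refine Eq.trans (h1 (fun κ => κ.IsProper) fun κ => (if κ.mon = m then 1 else 0) *
      (Nat.card (FGraph.Iso g'.rep.graph κ.quotient) : ℂ)) ?_
    refine Eq.trans ?_ (h1 (fun κ => κ.mon = m) fun κ =>
      (Nat.card (FGraph.Iso g'.rep.graph κ.quotient) : ℂ)).symm
    refine Finset.sum_congr rfl fun κ _ => ?_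
    by_cases hκ : κ.mon = m
    · rw [if_pos hκ, if_pos hκ, one_mul]
      split_ifs with hp
      · rfl
      · have : IsEmpty (FGraph.Iso g'.rep.graph κ.quotient) := by
          refine ⟨fun φ => hp ⟨fun h => hm ?_, fun h => κ.not_isOnePI_quotient h
            (g'.rep.onePI.of_iso φ)⟩⟩
          rw [← hκ, κ.mon_eq_zero_iff, h]
        rw [Nat.card_of_isEmpty, Nat.cast_zero]
    · rw [if_neg hκ, if_neg hκ, zero_mul, ite_self]
  · simp

end

/-! ### Finiteness of the multigraded parts -/

theorem neg_degree_le_multideg (m : Gen →₀ ℕ) (w : Vertex) : -(m.degree : ℤ) ≤ multideg m w := by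
  rw [multideg_apply, monDeg, Finsupp.sum, Finsupp.degree_apply,
    Nat.cast_sum, ← Finset.sum_neg_distrib]
  refine Finset.sum_le_sum fun g _ => ?_
  nlinarith [g.neg_one_le_deg w, (m g).cast_nonneg (α := ℤ)]

theorem degree_le_monLoops (m : Gen →₀ ℕ) : (m.degree : ℤ) ≤ monLoops m := by
  rw [monLoops, Finsupp.sum, Finsupp.degree_apply, Nat.cast_sum]
  refine Finset.sum_le_sum fun g _ => ?_
  nlinarith [g.loops_pos, (m g).cast_nonneg (α := ℤ)]

/-- Twice the loop order and the degree in the mass vertex, in terms of the multidegree. -/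
def loopMass : (Vertex → ℤ) →+ ℤ × ℤ where
  toFun n := (∑ w : Vertex, ((w.valence : ℤ) - 2) * n w, n .mass)
  map_zero' := by simp
  map_add' n n' := by simp [mul_add, Finset.sum_add_distrib]

theorem loopMass_apply (n : Vertex → ℤ) :
    loopMass n = (n .quarkGluon + n .ghostGluon + n .gluon3 + 2 * n .gluon4, n .mass) := by
  refine Prod.ext ?_ rfl
  change ∑ w : Vertex, ((w.valence : ℤ) - 2) * n w = _
  rw [sum_vertex]
  simp only [Vertex.valence, sum_line, Vertex.legs]
  norm_num

theorem loopMass_multideg (m : Gen →₀ ℕ) :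
    loopMass (multideg m) = (2 * monLoops m, monDeg m .mass) := by
  refine Prod.ext ?_ rfl
  change ∑ w : Vertex, ((w.valence : ℤ) - 2) * monDeg m w = 2 * monLoops m
  simp only [monDeg, monLoops, Finsupp.sum, Finset.mul_sum]
  rw [Finset.sum_comm]
  refine Finset.sum_congr rfl fun g _ => ?_
  rw [mul_left_comm, g.two_mul_loops, Finset.mul_sum]
  exact Finset.sum_congr rfl fun w _ => mul_left_comm _ _ _

/-- The multidegree fixes the loop order, which bounds the number `L` of factors. As the other
factors have degrees at least -1, each single factor has degrees between -1 and `n w + L`, leaving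
finitely many graphs. -/
theorem finite_multideg (n : Vertex → ℤ) : {m : Gen →₀ ℕ | multideg m = n}.Finite := by
  classical
  obtain ⟨L, hL⟩ : ∃ L : ℕ, ∀ m : Gen →₀ ℕ, multideg m = n → m.degree ≤ L := by
    refine ⟨(loopMass n).1.toNat, fun m hm => ?_⟩
    have h1 := degree_le_monLoops m
    have h2 : (loopMass n).1 = 2 * monLoops m := by rw [← hm, loopMass_multideg]
    omega
  have hS : {g : Gen | ∃ d ∈ Set.Icc (fun _ => -1) (fun w => n w + L), g.deg = d}.Finite := by
    refine ((Set.finite_Icc (fun _ : Vertex => (-1 : ℤ)) (fun w => n w + L)).biUnion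
      fun d _ => Gen.finite_of_deg d).subset ?_
    rintro g ⟨d, hd, hg⟩
    exact Set.mem_biUnion hd hg
  refine (Set.finite_Iic (∑ g ∈ hS.toFinset, Finsupp.single g L)).subset fun m hm => ?_
  have hm : multideg m = n := hm
  rw [Set.mem_Iic]
  intro g
  by_cases hg : m g = 0
  · rw [hg]; exact Nat.zero_le _
  have h1 : g ∈ hS.toFinset := by
    rw [Set.Finite.mem_toFinset]
    refine ⟨_, ⟨fun w => g.neg_one_le_deg w, fun w => ?_⟩, rfl⟩
    have hle : Finsupp.single g 1 ≤ m := by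
      rw [Finsupp.single_le_iff]
      omega
    have h2 : m = Finsupp.single g 1 + (m - Finsupp.single g 1) := (add_tsub_cancel_of_le hle).symm
    have h3 : multideg m w = g.deg w + multideg (m - Finsupp.single g 1) w := by
      conv_lhs => rw [h2, map_add, multideg_single, one_smul]
      rfl
    have h4 := neg_degree_le_multideg (m - Finsupp.single g 1) w
    have h5 := hL m hm
    have h6 : m.degree = 1 + (m - Finsupp.single g 1).degree := by
      conv_lhs => rw [h2, map_add, Finsupp.degree_single]
    rw [hm] at h3
    change g.deg w ≤ n w + L
    omega
  rw [Finsupp.finsetSum_apply, Finset.sum_eq_single g (fun g' _ hne => by simp [hne])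
    (fun h => absurd h1 h), Finsupp.single_eq_same]
  exact (Finsupp.le_degree g m).trans (hL m hm)

/-- The loop order bounds all degrees from below and a positive combination of the first four from
above; the mass degree is prescribed separately. The constants of the box are generous. -/
theorem finite_loopMass (c : ℤ × ℤ) : {m : Gen →₀ ℕ | loopMass (multideg m) = c}.Finite := by
  refine ((Set.finite_Icc (fun _ : Vertex => -(|c.1| + |c.2|)) (fun _ => 5 * (|c.1| + |c.2|))).biUnion
    fun n _ => finite_multideg n).subset fun m hm => ?_
  have hm : loopMass (multideg m) = c := hm
  refine Set.mem_biUnion (x := multideg m) ?_ rfl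
  have h1 := degree_le_monLoops m
  have h2 : c.1 = 2 * monLoops m := by rw [← hm, loopMass_multideg]
  have h3 := neg_degree_le_multideg m
  rw [loopMass_apply] at hm
  have h4 := congrArg Prod.fst hm
  have h5 := congrArg Prod.snd hm
  dsimp only at h4 h5
  have h6 := le_abs_self c.1
  have h7 := le_abs_self c.2
  have h8 := neg_abs_le c.2
  have k1 := h3 .quarkGluon
  have k2 := h3 .ghostGluon
  have k3 := h3 .gluon3
  have k4 := h3 .gluon4
  constructor <;> intro w <;> cases w <;> dsimp only <;> omega


/-! ### The coproduct of formal series -/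

/-- The terms of `f` with monomials in `s`, as an element of the algebra. -/
noncomputable def trunc (s : Finset (Gen →₀ ℕ)) (f : Formal) : HCK :=
  ∑ m ∈ s, MvPolynomial.monomial m (MvPowerSeries.coeff m f)

open Classical in
theorem coeff_trunc (s : Finset (Gen →₀ ℕ)) (f : Formal) (m : Gen →₀ ℕ) :
    (trunc s f).coeff m = if m ∈ s then MvPowerSeries.coeff m f else 0 := by
  rw [trunc, MvPolynomial.coeff_sum]
  simp only [MvPolynomial.coeff_monomial, Finset.sum_ite_eq']

theorem tcoeff_comul (m m' : Gen →₀ ℕ) (P : HCK) : tcoeff m m' (comul P) =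
    ∑ x ∈ P.support, P.coeff x * tcoeff m m' (comul (MvPolynomial.monomial x 1)) := by
  conv_lhs => rw [P.as_sum, map_sum, map_sum]
  refine Finset.sum_congr rfl fun x _ => ?_
  rw [← mul_one (P.coeff x), ← smul_eq_mul, ← MvPolynomial.smul_monomial, map_smul, map_smul,
    smul_eq_mul, smul_eq_mul, mul_one]

/-- By homogeneity only finitely many coefficients, those of one multidegree, influence a given
coefficient of the coproduct. This is what extends the coproduct to formal series. -/
theorem tcoeff_comul_congr {m m' : Gen →₀ ℕ} {P P' : HCK}
    (h : ∀ x, multideg x = multideg m + multideg m' → P.coeff x = P'.coeff x) :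
    tcoeff m m' (comul P) = tcoeff m m' (comul P') := by
  rw [← sub_eq_zero, ← map_sub, ← map_sub, tcoeff_comul]
  refine Finset.sum_eq_zero fun x _ => ?_
  by_cases hx : multideg x = multideg m + multideg m'
  · rw [MvPolynomial.coeff_sub, h x hx, sub_self, zero_mul]
  · rw [by_contra fun h1 => hx (tensorHom_comul_monomial x m m' h1).symm, mul_zero]

/-- The monomials of multidegree `n`. -/
noncomputable def fiber (n : Vertex → ℤ) : Finset (Gen →₀ ℕ) := (finite_multideg n).toFinset

theorem mem_fiber {n : Vertex → ℤ} {m : Gen →₀ ℕ} : m ∈ fiber n ↔ multideg m = n :=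
  Set.Finite.mem_toFinset _

/-- The coefficients of the coproduct of a formal series. -/
noncomputable def hat (f : Formal) (m m' : Gen →₀ ℕ) : ℂ :=
  tcoeff m m' (comul (trunc (fiber (multideg m + multideg m')) f))

theorem hat_eq {f : Formal} {m m' : Gen →₀ ℕ} {P : HCK}
    (h : ∀ x, multideg x = multideg m + multideg m' → P.coeff x = MvPowerSeries.coeff x f) :
    hat f m m' = tcoeff m m' (comul P) := by
  classical
  refine tcoeff_comul_congr fun x hx => ?_
  rw [coeff_trunc, if_pos (mem_fiber.2 hx), h x hx]

theorem hat_one (m m' : Gen →₀ ℕ) : hat 1 m m' = tcoeff m m' 1 := by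
  classical
  rw [hat_eq (P := 1) fun x _ => by rw [MvPolynomial.coeff_one, MvPowerSeries.coeff_one]
                                    exact if_congr eq_comm rfl rfl, map_one]

-- Both series are replaced by truncations to a finite set `U` that contains every monomial relevant
-- to the coefficient; there the coproduct is multiplicative.
open Classical in
theorem hat_mul (f g : Formal) (m m' : Gen →₀ ℕ) :
    hat (f * g) m m' = ∑ p ∈ Finset.HasAntidiagonal.antidiagonal m',
      ∑ q ∈ Finset.HasAntidiagonal.antidiagonal m, hat f q.1 p.1 * hat g q.2 p.2 := by
  let U : Finset (Gen →₀ ℕ) :=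
    ((fiber (multideg m + multideg m')).biUnion fun z =>
      (Finset.HasAntidiagonal.antidiagonal z).biUnion fun p => {p.1, p.2}) ∪
    (Finset.HasAntidiagonal.antidiagonal m').biUnion fun p =>
      (Finset.HasAntidiagonal.antidiagonal m).biUnion fun q =>
        fiber (multideg q.1 + multideg p.1) ∪ fiber (multideg q.2 + multideg p.2)
  have h1 : hat (f * g) m m' = tcoeff m m' (comul (trunc U f * trunc U g)) := by
    refine hat_eq fun x hx => ?_
    rw [MvPolynomial.coeff_mul, MvPowerSeries.coeff_mul]
    refine Finset.sum_congr rfl fun p hp => ?_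
    have hU : ∀ y ∈ ({p.1, p.2} : Finset (Gen →₀ ℕ)), y ∈ U := fun y hy =>
      Finset.mem_union_left _ (Finset.mem_biUnion.2 ⟨x, mem_fiber.2 hx,
        Finset.mem_biUnion.2 ⟨p, hp, hy⟩⟩)
    rw [coeff_trunc, coeff_trunc, if_pos (hU _ (by simp)), if_pos (hU _ (by simp))]
  rw [h1, map_mul, tcoeff_mul]
  refine Finset.sum_congr rfl fun p hp => Finset.sum_congr rfl fun q hq => ?_
  have hU : ∀ y ∈ fiber (multideg q.1 + multideg p.1) ∪ fiber (multideg q.2 + multideg p.2),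
      y ∈ U := fun y hy => Finset.mem_union_right _
    (Finset.mem_biUnion.2 ⟨p, hp, Finset.mem_biUnion.2 ⟨q, hq, hy⟩⟩)
  congr 1
  · refine (hat_eq fun x hx => ?_).symm
    rw [coeff_trunc, if_pos (hU _ (Finset.mem_union_left _ (mem_fiber.2 hx)))]
  · refine (hat_eq fun x hx => ?_).symm
    rw [coeff_trunc, if_pos (hU _ (Finset.mem_union_right _ (mem_fiber.2 hx)))]

/-- The coproduct of `f` is `∑ f Ypow(d) ⊗ f_d`, where `f_d` is the part of `f` of
multidegree `d`. -/
def GroupLike (f : Formal) : Prop := ∀ m m', hat f m m' =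
  MvPowerSeries.coeff m' f * MvPowerSeries.coeff m (f * Ypow (multideg m'))

/-! ### Stability of the coproduct formula under products and powers -/

namespace GroupLike

theorem one : GroupLike 1 := by
  classical
  intro m m'
  rw [hat_one, one_mul, MvPowerSeries.coeff_one, Algebra.TensorProduct.one_def, tcoeff_tmul,
    MvPolynomial.coeff_one, MvPolynomial.coeff_one, mul_comm]
  by_cases h : m' = 0
  · subst h
    simp only [if_true]
    rw [map_zero, Ypow_zero, MvPowerSeries.coeff_one]
    congr 1
    exact if_congr eq_comm rfl rfl
  · rw [if_neg h, if_neg (Ne.symm h), zero_mul, zero_mul]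

/-- When `m'` is split between the factors, `Ypow` of its degree splits accordingly. -/
theorem mul {f g : Formal} (hf : GroupLike f) (hg : GroupLike g) : GroupLike (f * g) := by
  classical
  intro m m'
  rw [hat_mul, MvPowerSeries.coeff_mul, Finset.sum_mul]
  refine Finset.sum_congr rfl fun p hp => ?_
  have h1 : f * g * Ypow (multideg m') =
      (f * Ypow (multideg p.1)) * (g * Ypow (multideg p.2)) := by
    rw [← Finset.HasAntidiagonal.mem_antidiagonal.1 hp, map_add, Ypow_add]
    ring
  rw [h1, MvPowerSeries.coeff_mul, Finset.mul_sum]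
  refine Finset.sum_congr rfl fun q _ => ?_
  rw [hf, hg]
  ring

theorem pow {f : Formal} (hf : GroupLike f) (n : ℕ) : GroupLike (f ^ n) := by
  induction n with
  | zero => rw [pow_zero]; exact one
  | succ n ih => rw [pow_succ]; exact ih.mul hf

theorem prod {ι : Type*} {s : Finset ι} {f : ι → Formal} (h : ∀ i, GroupLike (f i)) :
    GroupLike (∏ i ∈ s, f i) := by
  classical
  induction s using Finset.induction_on with
  | empty => exact one
  | insert i s hi ih => rw [Finset.prod_insert hi]; exact (h i).mul ih

/-- For fixed monomials both sides are polynomials in the exponent, and they agree at all natural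
numbers by `pow`. -/
theorem formalPow {f : Formal} (hf : GroupLike f) (h1 : MvPowerSeries.constantCoeff f = 1)
    (a : ℂ) : GroupLike (formalPow f a) := by
  classical
  intro m m'
  have hl : IsPoly fun a => hat (QCD.formalPow f a) m m' := by
    have : ∀ a, hat (QCD.formalPow f a) m m' = ∑ x ∈ fiber (multideg m + multideg m'),
        MvPowerSeries.coeff x (QCD.formalPow f a) *
          tcoeff m m' (comul (MvPolynomial.monomial x 1)) := by
      intro a
      rw [hat, trunc, map_sum, map_sum]
      refine Finset.sum_congr rfl fun x _ => ?_
      rw [← mul_one (MvPowerSeries.coeff x _), ← smul_eq_mul, ← MvPolynomial.smul_monomial,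
        map_smul, map_smul, smul_eq_mul, smul_eq_mul, mul_one]
    simp only [this]
    exact IsPoly.sum fun x => (isPoly_coeff_formalPow f x).mul (.const _)
  have hr : IsPoly fun a => MvPowerSeries.coeff m' (QCD.formalPow f a) *
      MvPowerSeries.coeff m (QCD.formalPow f a * Ypow (multideg m')) := by
    simp only [MvPowerSeries.coeff_mul]
    exact (isPoly_coeff_formalPow f m').mul
      (IsPoly.sum fun p => (isPoly_coeff_formalPow f _).mul (.const _))
  refine hl.eq hr (fun n => ?_) a
  rw [formalPow_natCast h1]
  exact hf.pow n m m'

end GroupLike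

theorem coeff_green (r : Res) (m : Gen →₀ ℕ) : MvPowerSeries.coeff m (green r) =
    MvPowerSeries.coeff m 1 +
      ∑ᶠ g : Gen, (if g.res = r then r.sign * weight g else 0) *
        tcoeff m 0 (comul (MvPolynomial.X g)) := by
  classical
  rw [green, map_add]
  congr 1
  simp only [tcoeff_comul_X_zero_right, mul_ite, mul_one, mul_zero]
  refine finsum_congr fun g => ?_
  exact if_congr Iff.rfl (by congr) rfl

theorem hat_green (r : Res) (m m' : Gen →₀ ℕ) : hat (green r) m m' =
    tcoeff m m' 1 + ∑ᶠ g : Gen, (if g.res = r then r.sign * weight g else 0) *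
      tcoeff m m' (comul (MvPolynomial.X g)) := by
  classical
  set c : Gen → ℂ := fun g => if g.res = r then r.sign * weight g else 0 with hc
  have hfin := Gen.finite_of_deg (multideg m + multideg m')
  have h1 : hat (green r) m m' = tcoeff m m'
      (comul (1 + ∑ g ∈ hfin.toFinset, c g • MvPolynomial.X g)) := by
    refine hat_eq fun x hx => ?_
    rw [MvPolynomial.coeff_add, MvPolynomial.coeff_sum, green, map_add, MvPolynomial.coeff_one,
      MvPowerSeries.coeff_one]
    congr 1
    · exact if_congr eq_comm rfl rfl
    · simp only [MvPolynomial.coeff_smul, MvPolynomial.coeff_X, smul_eq_mul]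
      by_cases hg : ∃ g, x = Finsupp.single g 1
      · obtain ⟨g, rfl⟩ := hg
        rw [coeff_linearSeries_single, Finset.sum_eq_single g, if_pos rfl, mul_one]
        · intro g' _ hne
          rw [if_neg fun h => hne (Finsupp.single_left_injective one_ne_zero h), mul_zero]
        · intro h
          refine absurd ?_ h
          rw [Set.Finite.mem_toFinset]
          rw [multideg_single, one_smul] at hx
          exact hx
      · push Not at hg
        rw [coeff_linearSeries_of_ne _ hg]
        exact Finset.sum_eq_zero fun g _ => by rw [if_neg (hg g).symm, mul_zero]
  rw [h1, map_add, map_add, map_one, map_sum, map_sum]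
  congr 1
  rw [finsum_eq_sum_of_support_subset (s := hfin.toFinset)]
  · exact Finset.sum_congr rfl fun g _ => by rw [map_smul, map_smul, smul_eq_mul]
  · intro g hg
    rw [Set.Finite.coe_toFinset]
    exact (tensorHom_comul_X g m m' (right_ne_zero_of_mul hg)).symm

/-- The right factor of a term of Δ(Γ) is 1 or a single graph. The value 1 comes only from Γ ⊗ 1 and
the constant term of G^r; for a graph of residue `r` with `m ≠ 0` the claim is the count of
contractions with given quotient. -/
theorem groupLike_green (r : Res) : GroupLike (green r) := by
  classical
  intro m m'
  have h1 : tcoeff m m' 1 = (if 0 = m then 1 else 0) * (if 0 = m' then 1 else 0) := by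
    rw [Algebra.TensorProduct.one_def, tcoeff_tmul, MvPolynomial.coeff_one,
      MvPolynomial.coeff_one]
  rw [hat_green]
  by_cases h0 : m' = 0
  · subst h0
    rw [h1, if_pos rfl, mul_one, map_zero, Ypow_zero, mul_one,
      MvPowerSeries.coeff_zero_eq_constantCoeff_apply, constantCoeff_green, one_mul, coeff_green,
      MvPowerSeries.coeff_one]
    congr 1
    exact if_congr eq_comm rfl rfl
  rw [h1, if_neg (Ne.symm h0), mul_zero, zero_add]
  have h2 : MvPowerSeries.coeff m' (green r) = MvPowerSeries.coeff m' (linearSeries fun g =>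
      if g.res = r then r.sign * weight g else 0) := by
    rw [green, map_add, MvPowerSeries.coeff_one, if_neg h0, zero_add]
  rw [h2]
  by_cases hg : ∃ g, m' = Finsupp.single g 1
  swap
  · push Not at hg
    rw [coeff_linearSeries_of_ne _ hg, zero_mul]
    simp [tcoeff_comul_X_of_ne _ m h0 hg]
  obtain ⟨g', rfl⟩ := hg
  rw [coeff_linearSeries_single, multideg_single, one_smul]
  by_cases hm : m = 0
  · subst hm
    rw [MvPowerSeries.coeff_zero_eq_constantCoeff_apply, map_mul, constantCoeff_green,
      constantCoeff_Ypow, mul_one, mul_one]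
    simp only [tcoeff_comul_X_zero_left]
    rw [finsum_eq_single _ g' fun g hg => by rw [if_neg hg, mul_zero], if_pos rfl, mul_one]
  have hpos : (Nat.card (FGraph.Iso g'.rep.graph g'.rep.graph) : ℂ) ≠ 0 :=
    Nat.cast_ne_zero.2 (card_iso_pos _).ne'
  by_cases hr : g'.res = r
  -- The `perms` in the weights of `g` and `g'` agree, so the automorphism numbers trade places and
  -- the weight of `g'` can be factored out.
  · have h3 : ∀ g, (if g.res = r then r.sign * weight g else 0) *
        tcoeff m (Finsupp.single g' 1) (comul (MvPolynomial.X g)) =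
        r.sign * weight g' * Skel.resMass r
          (fun X => Nat.card (QuotientPresentation g'.rep.graph m X)) g := by
      intro g
      by_cases hgr : g.res = r
      · have h4 := tcoeff_comul_X_single g g' hm
        rw [if_pos (hgr.trans hr.symm), ← eq_div_iff hpos] at h4
        rw [if_pos hgr, h4, Skel.resMass, if_pos hgr, weight_eq, weight_eq, hgr, hr]
        ring
      · rw [if_neg hgr, Skel.resMass, if_neg hgr, mul_zero, zero_mul]
    have h5 := finsum_quotientPresentation (hr ▸ g'.hasRes : g'.rep.graph.HasRes r) g'.rep.onePI m
    have h6 : g'.deg = g'.rep.graph.degree r := by rw [← hr]; rfl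
    rw [finsum_congr h3, ← mul_finsum, h5.2, if_pos hr, h6,
      green_mul_Ypow (hr ▸ g'.hasRes : g'.rep.graph.HasRes r)]
  · rw [if_neg hr, zero_mul]
    refine (finsum_congr fun g => ?_).trans finsum_zero
    by_cases hgr : g.res = r
    · have h4 := tcoeff_comul_X_single g g' hm
      rw [if_neg fun h => hr (h.symm.trans hgr)] at h4
      rw [(mul_eq_zero.1 h4).resolve_right hpos, mul_zero]
    · rw [if_neg hgr, zero_mul]

theorem groupLike_Ypow (n : Vertex → ℤ) : GroupLike (Ypow n) :=
  (GroupLike.prod fun _ => (groupLike_green _).formalPow (constantCoeff_green _) _).mul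
    (GroupLike.prod fun _ => (groupLike_green _).formalPow (constantCoeff_green _) _)


/-! ### Homogeneous components -/

section Comp

variable {A : Type*} [AddCommGroup A] (d : (Gen →₀ ℕ) →+ A) (hd : ∀ a, {m | d m = a}.Finite)

/-- The component of `f` of degree `a`. -/
noncomputable def comp (a : A) (f : Formal) : HCK := trunc (hd a).toFinset f

theorem coeff_comp (a : A) (f : Formal) (m : Gen →₀ ℕ) [Decidable (d m = a)] :
    (comp d hd a f).coeff m = if d m = a then MvPowerSeries.coeff m f else 0 := by
  classical
  rw [comp, coeff_trunc]
  exact if_congr (Set.Finite.mem_toFinset _) rfl rfl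

theorem comp_add (a : A) (f g : Formal) : comp d hd a (f + g) = comp d hd a f + comp d hd a g := by
  classical
  ext m
  rw [MvPolynomial.coeff_add, coeff_comp, coeff_comp, coeff_comp]
  split_ifs <;> simp

theorem comp_sub (a : A) (f g : Formal) : comp d hd a (f - g) = comp d hd a f - comp d hd a g := by
  classical
  ext m
  rw [MvPolynomial.coeff_sub, coeff_comp, coeff_comp, coeff_comp]
  split_ifs <;> simp

open Classical in
theorem comp_mul (a : A) (f g : Formal) : comp d hd a (f * g) =
    ∑ b ∈ ((hd a).toFinset.biUnion fun z =>
      (Finset.HasAntidiagonal.antidiagonal z)).image (fun p => d p.1),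
        comp d hd b f * comp d hd (a - b) g := by
  ext m
  rw [coeff_comp, MvPolynomial.coeff_sum]
  simp only [MvPolynomial.coeff_mul, coeff_comp]
  rw [Finset.sum_comm]
  have h1 : ∀ p ∈ Finset.HasAntidiagonal.antidiagonal m, d p.1 + d p.2 = d m := fun p hp => by
    rw [← Finset.HasAntidiagonal.mem_antidiagonal.1 hp, map_add]
  split_ifs with h
  · rw [MvPowerSeries.coeff_mul]
    refine Finset.sum_congr rfl fun p hp => ?_
    rw [Finset.sum_eq_single (d p.1), if_pos rfl, if_pos]
    · rw [← h, ← h1 p hp, add_sub_cancel_left]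
    · intro b _ hb
      rw [if_neg (Ne.symm hb), zero_mul]
    · intro hb
      exact absurd (Finset.mem_image_of_mem _ (Finset.mem_biUnion.2
        ⟨m, (Set.Finite.mem_toFinset _).2 h, hp⟩)) hb
  · refine (Finset.sum_eq_zero fun p hp => Finset.sum_eq_zero fun b _ => ?_).symm
    by_cases hb : d p.1 = b
    · rw [if_neg (c := d p.2 = a - b), mul_zero]
      rw [← hb]
      intro h2
      exact h (by rw [← h1 p hp, h2, add_sub_cancel])
    · rw [if_neg hb, zero_mul]

variable {C : Type*} [AddCommGroup C] (μ : A →+ C) (hμ : ∀ c, {m | μ.comp d m = c}.Finite)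

theorem comp_eq_sum (c : C) (f : Formal) [DecidableEq A] : comp (μ.comp d) hμ c f =
    ∑ a ∈ (hμ c).toFinset.image d, comp d hd a f := by
  classical
  ext m
  rw [coeff_comp, MvPolynomial.coeff_sum]
  simp only [coeff_comp]
  rw [Finset.sum_ite_eq (M := ℂ)]
  refine if_congr ⟨fun h => Finset.mem_image_of_mem _ ((Set.Finite.mem_toFinset _).2 h),
    fun h => ?_⟩ rfl rfl
  obtain ⟨x, hx, hxm⟩ := Finset.mem_image.1 h
  rw [Set.Finite.mem_toFinset] at hx
  have hx : μ (d x) = c := hx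
  rw [← hx, hxm]
  rfl

open Classical in
/-- The part of degree `c` of the formal sum `∑ F(a) ⊗ g_a`. -/
noncomputable def tensorComp (c : C) (F : A → Formal) (g : Formal) : HCK ⊗[ℂ] HCK :=
  ∑ a ∈ ((hμ c).toFinset.biUnion fun z =>
      (Finset.HasAntidiagonal.antidiagonal z)).image (fun p => d p.2),
    comp (μ.comp d) hμ (c - μ a) (F a) ⊗ₜ comp d hd a g

open Classical in
theorem tcoeff_tensorComp (c : C) (F : A → Formal) (g : Formal) (m m' : Gen →₀ ℕ) :
    tcoeff m m' (tensorComp d hd μ hμ c F g) = if μ (d m) + μ (d m') = c then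
      MvPowerSeries.coeff m (F (d m')) * MvPowerSeries.coeff m' g else 0 := by
  rw [tensorComp, map_sum]
  simp only [tcoeff_tmul, coeff_comp]
  rw [Finset.sum_eq_single (d m')]
  · rw [if_pos rfl, ← ite_zero_mul]
    congr 1
    exact if_congr eq_sub_iff_add_eq rfl rfl
  · intro b _ hb
    rw [if_neg (Ne.symm hb), mul_zero]
  · intro h
    rw [if_neg, zero_mul]
    intro h1
    refine h (Finset.mem_image.2 ⟨(m, m'), Finset.mem_biUnion.2 ⟨m + m', ?_, ?_⟩, rfl⟩)
    · rw [Set.Finite.mem_toFinset]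
      change μ (d (m + m')) = c
      rw [map_add, map_add]
      exact eq_sub_iff_add_eq.1 h1
    · exact Finset.HasAntidiagonal.mem_antidiagonal.2 rfl

theorem tensorComp_mem {T : Submodule ℂ (HCK ⊗[ℂ] HCK)} {c : C} {F : A → Formal} {g : Formal}
    (h : ∀ a, comp (μ.comp d) hμ (c - μ a) (F a) ⊗ₜ comp d hd a g ∈ T) :
    tensorComp d hd μ hμ c F g ∈ T := Submodule.sum_mem _ fun a _ => h a

end Comp

/-! ### The coproduct of a homogeneous component -/

section CoproductOfComp

variable {C : Type*} [AddCommGroup C] (μ : (Vertex → ℤ) →+ C)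
  (hμ : ∀ c, {m | μ.comp multideg m = c}.Finite)

open Classical in
theorem tcoeff_comul_comp (c : C) (f : Formal) (m m' : Gen →₀ ℕ) :
    tcoeff m m' (comul (comp (μ.comp multideg) hμ c f)) =
      if μ (multideg m) + μ (multideg m') = c then hat f m m' else 0 := by
  split_ifs with h
  · refine (hat_eq fun x hx => ?_).symm
    rw [coeff_comp, if_pos]
    change μ (multideg x) = c
    rw [hx, map_add, h]
  · rw [tcoeff_comul_congr (P' := 0), map_zero, map_zero]
    intro x hx
    rw [coeff_comp, if_neg, MvPolynomial.coeff_zero]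
    change ¬ μ (multideg x) = c
    rwa [hx, map_add]

theorem comul_comp {f : Formal} (hf : GroupLike f) (c : C) :
    comul (comp (μ.comp multideg) hμ c f) =
      tensorComp multideg finite_multideg μ hμ c (fun a => f * Ypow a) f := by
  classical
  refine tcoeff_ext fun m m' => ?_
  rw [tcoeff_comul_comp, tcoeff_tensorComp]
  refine if_congr Iff.rfl ?_ rfl
  rw [hf, mul_comm]

end CoproductOfComp

/-- The component of multidegree `n`. -/
noncomputable abbrev degComp (n : Vertex → ℤ) (f : Formal) : HCK := comp multideg finite_multideg n f

/-- The component with `loopMass` equal to `c`. -/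
noncomputable abbrev loopComp (c : ℤ × ℤ) (f : Formal) : HCK :=
  comp (loopMass.comp multideg) finite_loopMass c f

theorem coe_degComp (n : Vertex → ℤ) (f : Formal) :
    (degComp n f : Formal) = multidegPart n f := by
  classical
  ext m
  rw [MvPolynomial.coeff_coe, coeff_comp]
  refine (if_congr ?_ rfl rfl : _ = if ∀ v, monDeg m v = n v then _ else _).trans (by congr)
  exact funext_iff

theorem coe_loopComp (l : ℕ) (s : ℤ) (f : Formal) :
    (loopComp (2 * l, s) f : Formal) = loopMassPart l s f := by
  classical
  ext m
  rw [MvPolynomial.coeff_coe, coeff_comp]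
  refine (if_congr ?_ rfl rfl : _ =
    if monLoops m = l ∧ monDeg m .mass = s then _ else _).trans (by congr)
  change loopMass (multideg m) = _ ↔ _
  rw [loopMass_multideg, Prod.mk.injEq]
  constructor
  · rintro ⟨h1, h2⟩
    exact ⟨by omega, h2⟩
  · rintro ⟨h1, h2⟩
    exact ⟨by omega, h2⟩

/-- The first entry of `loopMass` is twice the loop order of a monomial, so odd or negative values
carry nothing. The components used to generate J are therefore all the nonzero ones. -/
theorem exists_of_loopComp_ne_zero {c : ℤ × ℤ} {f : Formal} (h : loopComp c f ≠ 0) :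
    ∃ (l : ℕ) (s : ℤ), c = (2 * (l : ℤ), s) := by
  classical
  obtain ⟨m, hm⟩ := MvPolynomial.ne_zero_iff.1 h
  rw [coeff_comp, ne_eq, ite_eq_right_iff, Classical.not_imp] at hm
  have h1 : loopMass (multideg m) = c := hm.1
  rw [loopMass_multideg] at h1
  have h2 := degree_le_monLoops m
  refine ⟨(monLoops m).toNat, monDeg m .mass, ?_⟩
  rw [← h1]
  congr 2
  omega

/-! ### Series with components in `H` -/

/-- All components of `f` lie in `H`. -/
def IsH (f : Formal) : Prop := ∀ n, degComp n f ∈ H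

namespace IsH

theorem loopComp_mem {f : Formal} (hf : IsH f) (c : ℤ × ℤ) : loopComp c f ∈ H := by
  classical
  rw [loopComp, comp_eq_sum multideg finite_multideg]
  exact sum_mem fun n _ => hf n

theorem one : IsH 1 := fun n => by
  classical
  refine sum_mem fun m _ => ?_
  rw [MvPowerSeries.coeff_one]
  split_ifs with h
  · rw [h]
    exact one_mem H
  · rw [map_zero]
    exact zero_mem H

theorem mul {f g : Formal} (hf : IsH f) (hg : IsH g) : IsH (f * g) := fun n => by
  rw [degComp, comp_mul]
  exact sum_mem fun b _ => mul_mem (hf _) (hg _)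

theorem sub {f g : Formal} (hf : IsH f) (hg : IsH g) : IsH (f - g) := fun n => by
  rw [degComp, comp_sub]
  exact sub_mem (hf _) (hg _)

theorem pow {f : Formal} (hf : IsH f) (k : ℕ) : IsH (f ^ k) := by
  induction k with
  | zero => rw [pow_zero]; exact one
  | succ k ih => rw [pow_succ]; exact ih.mul hf

theorem prod {ι : Type*} {s : Finset ι} {f : ι → Formal} (h : ∀ i, IsH (f i)) :
    IsH (∏ i ∈ s, f i) := by
  classical
  induction s using Finset.induction_on with
  | empty => exact one
  | insert i s hi ih => rw [Finset.prod_insert hi]; exact (h i).mul ih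

/-- A fixed multidegree contains finitely many monomials, so one truncation of the binomial series
serves for the whole component. -/
theorem formalPow {f : Formal} (hf : IsH f) (h1 : MvPowerSeries.constantCoeff f = 1) (a : ℂ) :
    IsH (formalPow f a) := fun n => by
  classical
  have key : degComp n (QCD.formalPow f a) =
      ∑ k ∈ Finset.range ((fiber n).sup Finsupp.degree + 1),
        Ring.choose a k • degComp n ((f - 1) ^ k) := by
    ext m
    rw [coeff_comp, MvPolynomial.coeff_sum]
    simp only [MvPolynomial.coeff_smul, coeff_comp, smul_eq_mul, mul_ite, mul_zero]
    split_ifs with h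
    · exact coeff_formalPow_of_le h1 a (Finset.le_sup (f := Finsupp.degree) (mem_fiber.2 h))
    · rw [Finset.sum_const_zero]
  rw [key]
  exact sum_mem fun k _ => Subalgebra.smul_mem _ ((hf.sub one).pow k n) _

end IsH

theorem isH_green (r : Res) : IsH (green r) := fun n =>
  Algebra.subset_adjoin ⟨r, n, coe_degComp n _⟩

theorem isH_Ypow (n : Vertex → ℤ) : IsH (Ypow n) :=
  (IsH.prod fun _ => (isH_green _).formalPow (constantCoeff_green _) _).mul
    (IsH.prod fun _ => (isH_green _).formalPow (constantCoeff_green _) _)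

/-! ### The coproduct on `H` -/

/-- The inclusion of `H ⊗ H`. -/
noncomputable abbrev inclTensor : H ⊗[ℂ] H →ₐ[ℂ] HCK ⊗[ℂ] HCK :=
  Algebra.TensorProduct.map H.val H.val

/-- Flatness over the field ℂ lets the coproduct and the coideal condition be checked inside the
tensor square of all graphs. -/
theorem inclTensor_injective : Function.Injective inclTensor :=
  TensorProduct.map_injective_of_flat_flat H.val.toLinearMap H.val.toLinearMap
    Subtype.val_injective Subtype.val_injective

theorem tmul_mem_range {x y : HCK} (hx : x ∈ H) (hy : y ∈ H) :
    x ⊗ₜ[ℂ] y ∈ inclTensor.range :=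
  ⟨(⟨x, hx⟩ : H) ⊗ₜ (⟨y, hy⟩ : H), Algebra.TensorProduct.map_tmul _ _ _ _⟩

/-- For a generator, `comul_comp` gives a finite sum of terms whose left factors are components of
`green r * Ypow a` and whose right factors are components of `green r`; all of these lie in `H`. -/
theorem comul_mem_range (x : H) : comul (x : HCK) ∈ inclTensor.range := by
  suffices h : H ≤ inclTensor.range.comap comul from h x.2
  refine Algebra.adjoin_le ?_
  rintro x ⟨r, n, hx⟩
  rw [← coe_degComp, MvPolynomial.coe_inj] at hx
  subst hx
  have h1 : comul (degComp n (green r)) = _ :=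
    comul_comp (AddMonoidHom.id _) finite_multideg (groupLike_green r) n
  change comul (degComp n (green r)) ∈ inclTensor.range
  rw [h1]
  refine tensorComp_mem (T := Subalgebra.toSubmodule inclTensor.range) _ _ _ _ fun a => ?_
  exact tmul_mem_range (((isH_green r).mul (isH_Ypow a)) _) (isH_green r a)

/-- The coproduct of `H`. -/
noncomputable def comulH : H →ₐ[ℂ] H ⊗[ℂ] H :=
  ((AlgEquiv.ofInjective inclTensor inclTensor_injective).symm : _ →ₐ[ℂ] H ⊗[ℂ] H).comp
    ((comul.comp H.val).codRestrict inclTensor.range comul_mem_range)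

theorem inclTensor_comulH (x : H) : inclTensor (comulH x) = comul x :=
  congrArg Subtype.val ((AlgEquiv.ofInjective inclTensor inclTensor_injective).apply_symm_apply
    ((comul.comp H.val).codRestrict inclTensor.range comul_mem_range x))


/-! ### Series with components in `J` -/

/-- The ideal `J`, as a subspace of the algebra of graphs. -/
noncomputable def JK : Submodule ℂ HCK := (J.restrictScalars ℂ).map H.val.toLinearMap

theorem coe_mem_JK {x : H} (hx : x ∈ J) : (x : HCK) ∈ JK := ⟨x, hx, rfl⟩

theorem mul_mem_JK {x y : HCK} (hx : x ∈ H) (hy : y ∈ JK) : x * y ∈ JK := by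
  obtain ⟨y, hy, rfl⟩ := hy
  have hy : y ∈ J := hy
  exact coe_mem_JK (J.mul_mem_left ⟨x, hx⟩ hy)

/-- All components of `f` of given loop order and degree in the mass vertex lie in `J`. -/
def IsJ (f : Formal) : Prop := ∀ c, loopComp c f ∈ JK

namespace IsJ

theorem zero : IsJ 0 := fun c => by
  have h := comp_sub (loopMass.comp multideg) finite_loopMass c 0 0
  rw [sub_self, sub_self] at h
  rw [loopComp, h]
  exact zero_mem JK

theorem add {f g : Formal} (hf : IsJ f) (hg : IsJ g) : IsJ (f + g) := fun c => by
  rw [loopComp, comp_add]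
  exact add_mem (hf c) (hg c)

theorem mul {f g : Formal} (hf : IsH f) (hg : IsJ g) : IsJ (f * g) := fun c => by
  rw [loopComp, comp_mul]
  exact Submodule.sum_mem _ fun b _ => mul_mem_JK (hf.loopComp_mem b) (hg _)

end IsJ

/-- The difference of the two sides of a Slavnov–Taylor identity. -/
noncomputable def slavnovTaylor (j k : Vertex) : Formal :=
  Y k ^ (j.valence - 2) - Y j ^ (k.valence - 2)

theorem isH_Y_pow (v : Vertex) (k : ℕ) : IsH (Y v ^ k) := by
  rw [Y_pow]
  exact isH_Ypow _

theorem isH_slavnovTaylor (j k : Vertex) : IsH (slavnovTaylor j k) :=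
  (isH_Y_pow _ _).sub (isH_Y_pow _ _)

theorem loopComp_slavnovTaylor_mem {j k : Vertex} (hj : j ≠ .mass) (hk : k ≠ .mass) (l : ℕ)
    (s : ℤ) : (⟨_, (isH_slavnovTaylor j k).loopComp_mem (2 * l, s)⟩ : H) ∈ J :=
  Ideal.subset_span ⟨j, k, hj, hk, l, s, coe_loopComp l s _⟩

theorem isJ_slavnovTaylor {j k : Vertex} (hj : j ≠ .mass) (hk : k ≠ .mass) :
    IsJ (slavnovTaylor j k) := fun c => by
  by_cases h : loopComp c (slavnovTaylor j k) = 0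
  · rw [h]
    exact zero_mem JK
  · obtain ⟨l, s, rfl⟩ := exists_of_loopComp_ne_zero h
    exact coe_mem_JK (loopComp_slavnovTaylor_mem hj hk l s)

/-- The exponents `n` for which the components of `Ypow n - 1` lie in `J`. -/
noncomputable def trivialExponents : AddSubgroup (Vertex → ℤ) where
  carrier := {n | IsJ (Ypow n - 1)}
  zero_mem' := by
    change IsJ _
    rw [Ypow_zero, sub_self]
    exact IsJ.zero
  add_mem' {n n'} hn hn' := by
    change IsJ _
    rw [Ypow_add, show Ypow n * Ypow n' - 1 = Ypow n * (Ypow n' - 1) + (Ypow n - 1) by ring]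
    exact (IsJ.mul (isH_Ypow n) hn').add hn
  neg_mem' {n} hn := by
    change IsJ _
    have h : Ypow (-n) * Ypow n = 1 := by rw [← Ypow_add, neg_add_cancel, Ypow_zero]
    rw [show Ypow (-n) - 1 = (-1 * Ypow (-n)) * (Ypow n - 1) by linear_combination h]
    refine IsJ.mul (IsH.mul ?_ (isH_Ypow _)) hn
    rw [← zero_sub]
    exact (by simpa using IsH.one.sub IsH.one : IsH 0).sub IsH.one

theorem mem_trivialExponents {n : Vertex → ℤ} : n ∈ trivialExponents ↔ IsJ (Ypow n - 1) := Iff.rfl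

/-- Dividing the identity by one of its sides preserves membership in J, because `Ypow` is
invertible with components in `H`. -/
theorem sub_mem_trivialExponents {j k : Vertex} (hj : j ≠ .mass) (hk : k ≠ .mass) :
    (j.valence - 2) • Pi.single k 1 - (k.valence - 2) • Pi.single j 1 ∈ trivialExponents := by
  have h1 := isJ_slavnovTaylor hj hk
  rw [slavnovTaylor, Y_pow, Y_pow] at h1
  rw [mem_trivialExponents]
  generalize (j.valence - 2) • (Pi.single k 1 : Vertex → ℤ) = a at *
  generalize (k.valence - 2) • (Pi.single j 1 : Vertex → ℤ) = b at *
  have h2 : Ypow (a - b) - 1 = Ypow (-b) * (Ypow a - Ypow b) := by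
    have h3 : Ypow (-b) * Ypow b = 1 := by rw [← Ypow_add, neg_add_cancel, Ypow_zero]
    rw [sub_eq_add_neg a b, Ypow_add]
    linear_combination h3
  rw [h2]
  exact IsJ.mul (isH_Ypow _) h1

/-- Since the quark-gluon vertex has N - 2 = 1, the identities comparing it with the other three
interaction vertices generate the kernel over ℤ; the other vertices may have any coefficient, and
that of the quark-gluon vertex is then determined. -/
theorem mem_trivialExponents_of_loopMass {n : Vertex → ℤ} (h : loopMass n = 0) :
    n ∈ trivialExponents := by
  rw [loopMass_apply] at h
  have h1 := congrArg Prod.fst h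
  have h2 := congrArg Prod.snd h
  dsimp only [Prod.fst_zero, Prod.snd_zero] at h1 h2
  have e2 := sub_mem_trivialExponents (j := .quarkGluon) (k := .ghostGluon) (by decide) (by decide)
  have e3 := sub_mem_trivialExponents (j := .quarkGluon) (k := .gluon3) (by decide) (by decide)
  have e4 := sub_mem_trivialExponents (j := .quarkGluon) (k := .gluon4) (by decide) (by decide)
  have h3 : n = n .ghostGluon • ((Vertex.quarkGluon.valence - 2) • Pi.single .ghostGluon 1 -
        (Vertex.ghostGluon.valence - 2) • Pi.single .quarkGluon 1) +
      n .gluon3 • ((Vertex.quarkGluon.valence - 2) • Pi.single .gluon3 1 -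
        (Vertex.gluon3.valence - 2) • Pi.single .quarkGluon 1) +
      n .gluon4 • ((Vertex.quarkGluon.valence - 2) • Pi.single .gluon4 1 -
        (Vertex.gluon4.valence - 2) • Pi.single .quarkGluon 1) := by
    have v1 : Vertex.quarkGluon.valence - 2 = 1 := by decide
    have v2 : Vertex.ghostGluon.valence - 2 = 1 := by decide
    have v3 : Vertex.gluon3.valence - 2 = 1 := by decide
    have v4 : Vertex.gluon4.valence - 2 = 2 := by decide
    rw [v1, v2, v3, v4]
    funext w
    cases w <;> simp <;> omega
  rw [h3]
  exact add_mem (add_mem (zsmul_mem e2 _) (zsmul_mem e3 _)) (zsmul_mem e4 _)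

theorem isJ_Ypow_sub {n n' : Vertex → ℤ} (h : loopMass n = loopMass n') :
    IsJ (Ypow n - Ypow n') := by
  have h1 : IsJ (Ypow (n - n') - 1) :=
    mem_trivialExponents_of_loopMass (by rw [map_sub, h, sub_self])
  have h2 : Ypow n = Ypow n' * Ypow (n - n') := by rw [← Ypow_add, add_sub_cancel]
  rw [h2, show Ypow n' * Ypow (n - n') - Ypow n' = Ypow n' * (Ypow (n - n') - 1) by ring]
  exact IsJ.mul (isH_Ypow _) h1

/-- An exponent with given `loopMass`. -/
def refExponent (c : ℤ × ℤ) : Vertex → ℤ := Pi.single .quarkGluon c.1 + Pi.single .mass c.2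

theorem loopMass_refExponent (c : ℤ × ℤ) : loopMass (refExponent c) = c := by
  rw [loopMass_apply, refExponent]
  simp

/-! ### The Hopf ideal -/

/-- `J ⊗ H + H ⊗ J`. -/
noncomputable def coideal : Ideal (H ⊗[ℂ] H) :=
  J.map (Algebra.TensorProduct.includeLeft : H →ₐ[ℂ] H ⊗[ℂ] H) ⊔
    J.map (Algebra.TensorProduct.includeRight : H →ₐ[ℂ] H ⊗[ℂ] H)

/-- `J ⊗ H + H ⊗ J`, as a subspace of the tensor square of the algebra of graphs. -/
noncomputable def coidealK : Submodule ℂ (HCK ⊗[ℂ] HCK) :=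
  (coideal.restrictScalars ℂ).map inclTensor.toLinearMap

theorem tmul_mem_coidealK_left {x y : HCK} (hx : x ∈ JK) (hy : y ∈ H) :
    x ⊗ₜ[ℂ] y ∈ coidealK := by
  obtain ⟨x, hx, rfl⟩ := hx
  refine ⟨x ⊗ₜ (⟨y, hy⟩ : H), ?_, Algebra.TensorProduct.map_tmul _ _ _ _⟩
  refine Ideal.mem_sup_left ?_
  have h1 : x ⊗ₜ[ℂ] (⟨y, hy⟩ : H) = (1 ⊗ₜ (⟨y, hy⟩ : H)) * (x ⊗ₜ 1) := by
    rw [Algebra.TensorProduct.tmul_mul_tmul, one_mul, mul_one]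
  rw [h1]
  exact Ideal.mul_mem_left _ _ (Ideal.mem_map_of_mem _ hx)

theorem tmul_mem_coidealK_right {x y : HCK} (hx : x ∈ H) (hy : y ∈ JK) :
    x ⊗ₜ[ℂ] y ∈ coidealK := by
  obtain ⟨y, hy, rfl⟩ := hy
  refine ⟨(⟨x, hx⟩ : H) ⊗ₜ y, ?_, Algebra.TensorProduct.map_tmul _ _ _ _⟩
  refine Ideal.mem_sup_right ?_
  have h1 : (⟨x, hx⟩ : H) ⊗ₜ[ℂ] y = ((⟨x, hx⟩ : H) ⊗ₜ 1) * (1 ⊗ₜ y) := by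
    rw [Algebra.TensorProduct.tmul_mul_tmul, one_mul, mul_one]
  rw [h1]
  exact Ideal.mul_mem_left _ _ (Ideal.mem_map_of_mem _ hy)

theorem mem_coideal_of_inclTensor {z : H ⊗[ℂ] H} (h : inclTensor z ∈ coidealK) : z ∈ coideal := by
  obtain ⟨z', hz', h1⟩ := h
  rwa [← inclTensor_injective h1]

theorem finite_loopMass_id (c : ℤ × ℤ) :
    {m | (AddMonoidHom.id _).comp (loopMass.comp multideg) m = c}.Finite := finite_loopMass c

/-- Telescope `f Ypow n ⊗ f_n - g Ypow n ⊗ g_n`, then replace `n` on the left by the reference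
exponent of its `loopMass`. The last sum can then be graded by `loopMass` instead of the
multidegree, so its right factors are the components that generate J. -/
theorem comul_loopComp_sub {f g : Formal} (hf : GroupLike f) (hg : GroupLike g) (c : ℤ × ℤ) :
    comul (loopComp c (f - g)) =
      tensorComp multideg finite_multideg loopMass finite_loopMass c
        (fun n => (f - g) * Ypow n) f +
      tensorComp multideg finite_multideg loopMass finite_loopMass c
        (fun n => g * (Ypow n - Ypow (refExponent (loopMass n)))) (f - g) +
      tensorComp (loopMass.comp multideg) finite_loopMass (AddMonoidHom.id _) finite_loopMass_id c
        (fun a => g * Ypow (refExponent a)) (f - g) := by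
  classical
  refine tcoeff_ext fun m m' => ?_
  rw [loopComp, comp_sub, map_sub, map_sub, map_add, map_add, tcoeff_comul_comp,
    tcoeff_comul_comp, tcoeff_tensorComp, tcoeff_tensorComp, tcoeff_tensorComp]
  simp only [AddMonoidHom.id_apply, AddMonoidHom.comp_apply]
  split_ifs
  · rw [hf, hg, mul_sub, sub_mul, map_sub, map_sub, map_sub]
    ring
  · simp

theorem comul_loopComp_mem {f g : Formal} (hf : GroupLike f) (hg : GroupLike g) (hf' : IsH f)
    (hg' : IsH g) (h : IsJ (f - g)) (c : ℤ × ℤ) : comul (loopComp c (f - g)) ∈ coidealK := by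
  rw [comul_loopComp_sub hf hg]
  refine add_mem (add_mem ?_ ?_) ?_
  · refine tensorComp_mem _ _ _ _ fun n => tmul_mem_coidealK_left ?_ (hf' n)
    rw [mul_comm]
    exact IsJ.mul (isH_Ypow n) h _
  · refine tensorComp_mem _ _ _ _ fun n => tmul_mem_coidealK_left ?_ ((hf'.sub hg') n)
    exact IsJ.mul hg' (isJ_Ypow_sub (loopMass_refExponent _).symm) _
  · exact tensorComp_mem _ _ _ _ fun a => tmul_mem_coidealK_right
      ((hg'.mul (isH_Ypow _)).loopComp_mem _) (h a)

theorem comulH_mem_coideal {x : H} (hx : x ∈ J) : comulH x ∈ coideal := by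
  suffices h : J ≤ coideal.comap comulH from h hx
  refine Ideal.span_le.2 ?_
  rintro x ⟨j, k, hj, hk, l, s, hx⟩
  rw [← coe_loopComp, MvPolynomial.coe_inj] at hx
  refine mem_coideal_of_inclTensor ?_
  rw [inclTensor_comulH, hx]
  have h := isJ_slavnovTaylor hj hk
  rw [slavnovTaylor, Y_pow, Y_pow] at h
  rw [Y_pow, Y_pow]
  exact comul_loopComp_mem (groupLike_Ypow _) (groupLike_Ypow _) (isH_Ypow _) (isH_Ypow _) h _

theorem counit_eq_coeff (x : HCK) : counit x = x.coeff 0 := MvPolynomial.aeval_zero' x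

theorem counit_eq_zero {x : H} (hx : x ∈ J) : counit (x : HCK) = 0 := by
  suffices h : J ≤ RingHom.ker (counit.comp H.val) from h hx
  refine Ideal.span_le.2 ?_
  rintro x ⟨j, k, -, -, l, s, hx⟩
  rw [← coe_loopComp, MvPolynomial.coe_inj] at hx
  change counit (x : HCK) = 0
  classical
  rw [counit_eq_coeff, hx, coeff_comp, map_sub, MvPowerSeries.coeff_zero_eq_constantCoeff_apply,
    MvPowerSeries.coeff_zero_eq_constantCoeff_apply, Y_pow, Y_pow, constantCoeff_Ypow,
    constantCoeff_Ypow, sub_self, ite_self]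

end QCD

/-! ### The statement assembled -/

theorem mainTheorem1 :
    (∀ r n, ∃ x : QCD.H, ((x : QCD.HCK) : QCD.Formal) = QCD.multidegPart n (QCD.green r)) ∧
    (∀ j k : QCD.Vertex, j ≠ .mass → k ≠ .mass → ∀ (l : ℕ) (s : ℤ), ∃ a b : QCD.H,
      ((a : QCD.HCK) : QCD.Formal) = QCD.loopMassPart l s (QCD.Y k ^ (j.valence - 2)) ∧
      ((b : QCD.HCK) : QCD.Formal) = QCD.loopMassPart l s (QCD.Y j ^ (k.valence - 2)) ∧
      Ideal.Quotient.mk QCD.J a = Ideal.Quotient.mk QCD.J b) ∧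
    (∀ x ∈ QCD.J, QCD.counit (x : QCD.HCK) = 0) ∧
    ∃ Δ : QCD.H →ₐ[ℂ] TensorProduct ℂ QCD.H QCD.H,
      (∀ x : QCD.H, Algebra.TensorProduct.map QCD.H.val QCD.H.val (Δ x) = QCD.comul x) ∧
      ∀ x ∈ QCD.J, Δ x ∈
        LinearMap.range (LinearMap.rTensor QCD.H (QCD.J.restrictScalars ℂ).subtype) ⊔
        LinearMap.range (LinearMap.lTensor QCD.H (QCD.J.restrictScalars ℂ).subtype) := by
  refine ⟨fun r n => ⟨⟨_, QCD.isH_green r n⟩, QCD.coe_degComp n _⟩, fun j k hj hk l s =>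
    ⟨⟨_, (QCD.isH_Y_pow k (j.valence - 2)).loopComp_mem (2 * l, s)⟩,
      ⟨_, (QCD.isH_Y_pow j (k.valence - 2)).loopComp_mem (2 * l, s)⟩,
      QCD.coe_loopComp l s _, QCD.coe_loopComp l s _, ?_⟩,
    fun x hx => QCD.counit_eq_zero hx, QCD.comulH, QCD.inclTensor_comulH, fun x hx => ?_⟩
  · rw [Ideal.Quotient.mk_eq_mk_iff_sub_mem]
    convert QCD.loopComp_slavnovTaylor_mem hj hk l s using 1
    exact Subtype.ext (QCD.comp_sub _ _ _ _ _).symm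
  -- The images of J ⊗ H and H ⊗ J are the ideals generated by J in the two factors, whose sum is
  -- `coideal`.
  · rw [← Ideal.map_includeLeft_eq, ← Ideal.map_includeRight_eq]
    have h := QCD.comulH_mem_coideal hx
    rw [QCD.coideal, Submodule.mem_sup] at h
    obtain ⟨y, hy, z, hz, h⟩ := h
    rw [← h]
    exact Submodule.add_mem_sup hy hz
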